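/- Let $G$ be a directed graph (loops and parallel edges allowed). A \emph{virtual graph diagram} of $G$ is a generic immersion of $G$ in the plane (vertices go to distinct points, edges are disjoint from the vertices in their interior, and edges meet only in finitely many transverse double points in their interiors), considered up to planar isotopy, in which every double point is marked either as a classical crossing, with a choice of upper and lower strand, or as a virtual crossing. It is \emph{classical} if it has no virtual crossings. Two virtual graph diagrams of $G$ are \emph{virtually equivalent} if they are related by a finite sequence of planar isotopies and the following local moves and their inverses: removing a curl with one crossing, classical or virtual; pulling apart two strands that form a bigon with two crossings, which are either both virtual, or both classical with the same strand on top; moving a strand past a crossing of two other strands (third Reidemeister move), where the three crossings are all classical (and come from three strands at different heights), or all virtual, or the moving strand crosses both of the others virtually and the crossing of those two is classical; moving a strand past a vertex, where the strand is above all, below all, or crosses virtually all of the edges that it meets; and twisting two cyclically neighbouring edges at a vertex around each other by one classical crossing. (Exchanging two neighbouring edges at a vertex by a virtual crossing, and third moves with exactly one virtual crossing, are not allowed.) The \emph{Gauss code} of a virtual graph diagram consists of, for every edge, the sequence of the classical crossings met when the edge is traversed from its initial to its final vertex, each recorded by its name, by whether it is passed on the upper or on the lower strand, and by its sign, together with,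 for every vertex, the counterclockwise cyclic order of the half-edges at it. Virtual crossings are ignored, and the code is considered up to renaming the crossings. A Gauss code on $G$ is \emph{realizable} if it is the Gauss code of a classical diagram of $G$. If the Gauss code of a virtual graph diagram $D$ of $G$ is realizable, then $D$ is virtually equivalent to a classical graph diagram of $G$. -/

import Mathlib

/-!
Virtual spatial graph diagrams.

A diagram in the plane is put in general position with respect to the height function and cut
by horizontal lines into slices, each containing exactly one elementary piece: a local minimum,
a local maximum, a crossing (classical or virtual), or a vertex; all other strands of the slice are
vertical.  So a diagram is a list of slices, read from bottom to top.  Every strand carries the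
name of the edge of the graph it belongs to and its direction (upwards or downwards).
Planar isotopy is then generated by local rules, and so are the Reidemeister moves.
-/

namespace VirtualGraph

/-- A directed graph with vertices `V` and edges `E` (loops and parallel edges are allowed). -/
structure DirectedGraph (V E : Type*) where
  src : E → V
  tgt : E → V

/-- A strand at a horizontal line: its edge, and whether the edge is directed upwards there. -/
abbrev Strand (E : Type*) := E × Bool

/-- The same edge, running in the opposite vertical direction. -/
def rev {E : Type*} (x : Strand E) : Strand E := (x.1, !x.2)

/-- A half-edge: `(e, true)` is the initial half of `e`, `(e, false)` is its final half. -/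
abbrev HalfEdge (E : Type*) := E × Bool

/-- The vertex at which a half-edge is attached. -/
def DirectedGraph.foot {V E : Type*} (G : DirectedGraph V E) (h : HalfEdge E) : V :=
  if h.2 then G.src h.1 else G.tgt h.1

/-- Crossing types.  In a crossing one strand runs from bottom left to top right, the other one
from bottom right to top left; `upper` means that the former is the upper strand, `lower` that it
is the lower strand. -/
inductive CrossingType
  | upper
  | lower
  | virt
  deriving DecidableEq

/-- Exchange upper and lower strand; virtual crossings stay virtual. -/
def CrossingType.flip : CrossingType → CrossingType
  | upper => lower
  | lower => upper
  | virt => virt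

/-- Elementary pieces, with the strands at their bottom and top listed from left to right:
* `cup x`: a local minimum, from `[]` to `[x, rev x]`;
* `cap x`: a local maximum, from `[x, rev x]` to `[]`;
* `cross t x y`: a crossing, from `[x, y]` to `[y, x]`;
* `vertex v below above`: the vertex `v`, from `below` to `above`. -/
inductive Piece (V E : Type*)
  | cup (x : Strand E)
  | cap (x : Strand E)
  | cross (t : CrossingType) (x y : Strand E)
  | vertex (v : V) (below above : List (Strand E))

/-- Strands at the bottom of a piece. -/
def Piece.dom {V E : Type*} : Piece V E → List (Strand E)
  | cup _ => []
  | cap x => [x, rev x]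
  | cross _ x y => [x, y]
  | vertex _ below _ => below

/-- Strands at the top of a piece. -/
def Piece.cod {V E : Type*} : Piece V E → List (Strand E)
  | cup x => [x, rev x]
  | cap _ => []
  | cross _ x y => [y, x]
  | vertex _ _ above => above

/-- A slice: one elementary piece with vertical strands to its left and to its right. -/
structure Slice (V E : Type*) where
  left : List (Strand E)
  piece : Piece V E
  right : List (Strand E)

def Slice.dom {V E : Type*} (s : Slice V E) : List (Strand E) := s.left ++ s.piece.dom ++ s.right

def Slice.cod {V E : Type*} (s : Slice V E) : List (Strand E) := s.left ++ s.piece.cod ++ s.right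

/-- Add vertical strands `a` on the left and `b` on the right. -/
def Slice.whisker {V E : Type*} (a b : List (Strand E)) (s : Slice V E) : Slice V E :=
  ⟨a ++ s.left, s.piece, s.right ++ b⟩

/-- `Fits a w b`: the slices of `w` can be stacked on top of each other, starting with the
strands `a` at the bottom and ending with the strands `b` at the top. -/
def Fits {V E : Type*} : List (Strand E) → List (Slice V E) → List (Strand E) → Prop
  | a, [], b => a = b
  | a, s :: w, b => s.dom = a ∧ Fits s.cod w b

/-- A closed picture in the plane (nothing leaves it at the bottom or at the top). -/
structure Picture (V E : Type*) where
  word : List (Slice V E)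
  fits : Fits [] word []

/-! ### Following strands -/

/-- Follow a strand through a piece.  It enters through the top (`true`) or the bottom (`false`) at
the given position (counted from the left, starting with `0`).  The result is the side and the
position where it leaves the piece and, if it has passed a classical crossing, whether it was the
upper strand there; the result is `none` if the strand ends at a vertex. -/
def Piece.follow {V E : Type*} : Piece V E → Bool → ℕ → Option (Bool × ℕ × Option Bool)
  | cup _, b, i => some (b, 1 - i, none)
  | cap _, b, i => some (b, 1 - i, none)
  | cross t _ _, b, i =>
      some (!b, 1 - i,
        match t with
        | .virt => none
        -- the strand from bottom left to top right is the one with `b = false`, `i = 0`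
        -- or `b = true`, `i = 1`
        | .upper => some (b == (i == 1))
        | .lower => some (!(b == (i == 1))))
  | vertex _ _ _, _, _ => none

/-- Number of ends of a piece at its top (`true`) or bottom (`false`). -/
def Piece.arity {V E : Type*} (p : Piece V E) (b : Bool) : ℕ :=
  if b then p.cod.length else p.dom.length

/-- Follow a strand through a slice, with the same conventions as for `Piece.follow`. -/
def Slice.follow {V E : Type*} (s : Slice V E) (b : Bool) (j : ℕ) :
    Option (Bool × ℕ × Option Bool) :=
  if j < s.left.length then some (!b, j, none)
  else if j < s.left.length + s.piece.arity b then
    (s.piece.follow b (j - s.left.length)).map fun r => (r.1, s.left.length + r.2.1, r.2.2)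
  else some (!b, j - s.piece.arity b + s.piece.arity (!b), none)

/-- The sign of a crossing (`true` for positive): a crossing of two upward strands in which the
strand from bottom left to top right is the upper one is positive, and reversing one of the two
strands or exchanging upper and lower strand changes the sign. -/
def Piece.sign {V E : Type*} : Piece V E → Bool
  | cross t x y => (t == .upper) == (x.2 == y.2)
  | _ => false

/-- A letter of a Gauss code: the name of the crossing, whether it is passed on the upper strand,
and the sign of the crossing (`true` for positive). -/
structure Letter where
  name : ℕ
  isOver : Bool
  isPos : Bool

/-- The slice entered by a strand that leaves slice `k` through the top (`true`) or the bottom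
(`false`).  (In a closed picture no strand leaves slice `0` through the bottom.) -/
def nextIndex (k : ℕ) (b : Bool) : ℕ := if b then k + 1 else k - 1

/-- `Trace w k b j l`: the strand which leaves the `k`-th slice of `w` through the top (`b = true`)
or bottom (`b = false`) at position `j` ends, when followed from there, at a vertex, and the
classical crossings met on the way are listed in `l`; a crossing is named by the index of its slice.
Virtual crossings are ignored. -/
inductive Trace {V E : Type*} (w : List (Slice V E)) : ℕ → Bool → ℕ → List Letter → Prop
  | finish {k : ℕ} {b : Bool} {j : ℕ} {s : Slice V E} :
      w[nextIndex k b]? = some s → s.follow (!b) j = none → Trace w k b j []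
  | pass {k : ℕ} {b : Bool} {j : ℕ} {s : Slice V E} {b' : Bool} {j' : ℕ} {l : List Letter} :
      w[nextIndex k b]? = some s → s.follow (!b) j = some (b', j', none) →
      Trace w (nextIndex k b) b' j' l → Trace w k b j l
  | meet {k : ℕ} {b : Bool} {j : ℕ} {s : Slice V E} {b' : Bool} {j' : ℕ} {o : Bool}
      {l : List Letter} :
      w[nextIndex k b]? = some s → s.follow (!b) j = some (b', j', some o) →
      Trace w (nextIndex k b) b' j' l →
      Trace w k b j (⟨nextIndex k b, o, s.piece.sign⟩ :: l)

/-- `EdgeTrace w e l`: the edge `e`, followed from its initial vertex to its final vertex, meets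
the sequence `l` of classical crossings.  (At a vertex, an edge starts at a strand above the vertex
that is directed upwards or at a strand below the vertex that is directed downwards.) -/
inductive EdgeTrace {V E : Type*} (w : List (Slice V E)) (e : E) : List Letter → Prop
  | up {k i : ℕ} {v : V} {left below above right : List (Strand E)} {l : List Letter} :
      w[k]? = some ⟨left, .vertex v below above, right⟩ → above[i]? = some (e, true) →
      Trace w k true (left.length + i) l → EdgeTrace w e l
  | down {k i : ℕ} {v : V} {left below above right : List (Strand E)} {l : List Letter} :
      w[k]? = some ⟨left, .vertex v below above, right⟩ → below[i]? = some (e, false) →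
      Trace w k false (left.length + i) l → EdgeTrace w e l

/-! ### Diagrams -/

/-- If the slice contains a vertex: the vertex, and the half-edges attached to it in
counterclockwise order (the ones below from left to right, then those above from right to left). -/
def Slice.star {V E : Type*} (s : Slice V E) : Option (V × List (HalfEdge E)) :=
  match s.piece with
  | .vertex v below above => some (v, below.map rev ++ above.reverse)
  | _ => none

/-- All vertices of a picture, with their half-edges in counterclockwise order. -/
def stars {V E : Type*} (w : List (Slice V E)) : List (V × List (HalfEdge E)) :=
  w.filterMap Slice.star

/-- A virtual graph diagram of the directed graph `G`. -/
structure Diagram {V E : Type*} (G : DirectedGraph V E) extends Picture V E where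
  /-- no vertex is drawn twice -/
  vertex_nodup : ((stars word).map Prod.fst).Nodup
  /-- every vertex is drawn -/
  vertex_mem : ∀ v : V, ∃ h, (v, h) ∈ stars word
  /-- the half-edges at `v` are drawn once each, and nothing else is attached at `v` -/
  star_nodup : ∀ v h, (v, h) ∈ stars word → h.Nodup
  star_mem : ∀ v h, (v, h) ∈ stars word → ∀ x : HalfEdge E, x ∈ h ↔ G.foot x = v
  /-- there are no closed curves without vertices: every strand, followed from the top of
  any slice, ends at a vertex -/
  no_circle : ∀ (k : ℕ) (s : Slice V E), word[k]? = some s → ∀ j < s.cod.length,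
    ∃ l, Trace word k true j l

/-- A classical graph diagram: a diagram without virtual crossings. -/
def Diagram.IsClassical {V E : Type*} {G : DirectedGraph V E} (D : Diagram G) : Prop :=
  ∀ s ∈ D.word, ∀ x y, s.piece ≠ .cross .virt x y

/-! ### Gauss codes -/

/-- A Gauss code on a vertex-oriented directed graph: a word for every edge and a cyclic order
of half-edges (counterclockwise) for every vertex. -/
structure GaussCode (V E : Type*) where
  word : E → List Letter
  rotation : V → Cycle (HalfEdge E)

/-- `S` is a Gauss code of `D`: after distinct names have been given to the crossings, the word of
an edge is the sequence of the classical crossings met along it, and the cyclic order at a vertex is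
the one in the diagram. -/
def Diagram.HasGaussCode {V E : Type*} {G : DirectedGraph V E} (D : Diagram G)
    (S : GaussCode V E) : Prop :=
  (∃ f : ℕ → ℕ, f.Injective ∧ ∀ e : E, ∃ l, EdgeTrace D.word e l ∧
    S.word e = l.map fun a => { a with name := f a.name }) ∧
  ∀ v h, (v, h) ∈ stars D.word → S.rotation v = (h : Cycle (HalfEdge E))

/-- A Gauss code is realizable if it is the Gauss code of a classical diagram of `G`. -/
def GaussCode.Realizable {V E : Type*} (S : GaussCode V E) (G : DirectedGraph V E) : Prop :=
  ∃ D : Diagram G, D.IsClassical ∧ D.HasGaussCode S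

/-! ### Moves -/

/-- Which triangles may be reversed by a Reidemeister move of the third kind.  The strands
`x, y, z` start from left to right, and the arguments are the types of the crossings of `x` with `y`,
of `x` with `z`, and of `y` with `z`. -/
def TriangleAllowed : CrossingType → CrossingType → CrossingType → Prop
  -- purely virtual
  | .virt, .virt, .virt => True
  -- one classical crossing, and a strand meeting the two others virtually
  | _, .virt, .virt => True
  | .virt, _, .virt => True
  | .virt, .virt, _ => True
  -- forbidden: exactly one virtual crossing
  | .virt, _, _ => False
  | _, .virt, _ => False
  | _, _, .virt => False
  -- classical: no strand would have to be cyclically above the others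
  | .upper, .lower, .upper => False
  | .lower, .upper, .lower => False
  | _, _, _ => True

/-- The strand `y` moves from the left of the strands in the list to their right; all crossings
have type `t`, where `upper` means that `y` is the upper strand. -/
def passRight {V E : Type*} (t : CrossingType) (y : Strand E) : List (Strand E) → List (Slice V E)
  | [] => []
  | z :: zs => ⟨[], .cross t y z, zs⟩ :: (passRight t y zs).map (Slice.whisker [z] [])

/-- Planar isotopy. -/
inductive PlanarRule {V E : Type*} : List (Slice V E) → List (Slice V E) → Prop
  /-- two pieces next to each other exchange their heights -/
  | interchange (p q : Piece V E) (m : List (Strand E)) :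
      PlanarRule [⟨[], p, m ++ q.dom⟩, ⟨p.cod ++ m, q, []⟩]
        [⟨p.dom ++ m, q, []⟩, ⟨[], p, m ++ q.cod⟩]
  /-- a local maximum cancels a local minimum -/
  | zigzagLeft (x : Strand E) :
      PlanarRule [⟨[x], .cup (rev x), []⟩, ⟨[], .cap x, [x]⟩] []
  | zigzagRight (x : Strand E) :
      PlanarRule [⟨[], .cup x, [x]⟩, ⟨[x], .cap (rev x), []⟩] []
  /-- a crossing slides through a local maximum -/
  | slideCap (t : CrossingType) (x y : Strand E) :
      PlanarRule [⟨[x], .cross t y (rev x), []⟩, ⟨[], .cap x, [y]⟩]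
        [⟨[], .cross t.flip x y, [rev x]⟩, ⟨[y], .cap x, []⟩]
  /-- a crossing slides through a local minimum -/
  | slideCup (t : CrossingType) (x y : Strand E) :
      PlanarRule [⟨[], .cup x, [y]⟩, ⟨[x], .cross t (rev x) y, []⟩]
        [⟨[y], .cup x, []⟩, ⟨[], .cross t.flip y x, [rev x]⟩]
  /-- the leftmost or rightmost edge at the top of a vertex is bent down -/
  | bendLeft (v : V) (below above : List (Strand E)) (x : Strand E) :
      PlanarRule [⟨[], .vertex v below (x :: above), []⟩]
        [⟨[], .cup x, below⟩, ⟨[x], .vertex v (rev x :: below) above, []⟩]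
  | bendRight (v : V) (below above : List (Strand E)) (x : Strand E) :
      PlanarRule [⟨[], .vertex v below (above ++ [x]), []⟩]
        [⟨below, .cup (rev x), []⟩, ⟨[], .vertex v (below ++ [rev x]) above, [x]⟩]

/-- The Reidemeister moves for virtual graph diagrams.  Where the crossing type `t` is arbitrary,
the rule comprises the classical move and its purely virtual version. -/
inductive ReidemeisterRule {V E : Type*} : List (Slice V E) → List (Slice V E) → Prop
  /-- first move: removing a curl -/
  | curlRight (t : CrossingType) (x : Strand E) :
      ReidemeisterRule
        [⟨[x], .cup x, []⟩, ⟨[], .cross t x x, [rev x]⟩, ⟨[x], .cap x, []⟩] []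
  | curlLeft (t : CrossingType) (x : Strand E) :
      ReidemeisterRule
        [⟨[], .cup (rev x), [x]⟩, ⟨[rev x], .cross t x x, []⟩, ⟨[], .cap (rev x), [x]⟩] []
  /-- second move: pulling two strands apart -/
  | bigon (t : CrossingType) (x y : Strand E) :
      ReidemeisterRule [⟨[], .cross t x y, []⟩, ⟨[], .cross t.flip y x, []⟩] []
  /-- third move (classical, virtual, or a virtual strand sliding past a classical crossing) -/
  | triangle (t₁ t₂ t₃ : CrossingType) (h : TriangleAllowed t₁ t₂ t₃) (x y z : Strand E) :
      ReidemeisterRule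
        [⟨[], .cross t₁ x y, [z]⟩, ⟨[y], .cross t₂ x z, []⟩, ⟨[], .cross t₃ y z, [x]⟩]
        [⟨[x], .cross t₃ y z, []⟩, ⟨[], .cross t₂ x z, [y]⟩, ⟨[z], .cross t₁ x y, []⟩]
  /-- fourth move: a strand slides over, under, or virtually past a vertex -/
  | pastVertex (t : CrossingType) (y : Strand E) (v : V) (below above : List (Strand E)) :
      ReidemeisterRule (passRight t y below ++ [⟨[], .vertex v below above, [y]⟩])
        (⟨[y], .vertex v below above, []⟩ :: passRight t y above)
  /-- fifth move: two neighbouring edges at a vertex are twisted around each other by a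
  classical crossing (the virtual version is forbidden) -/
  | twist (t : CrossingType) (ht : t ≠ .virt) (v : V) (below l r : List (Strand E))
      (x y : Strand E) :
      ReidemeisterRule [⟨[], .vertex v below (l ++ x :: y :: r), []⟩, ⟨l, .cross t x y, r⟩]
        [⟨[], .vertex v below (l ++ y :: x :: r), []⟩]

/-- A single move: some consecutive slices, up to vertical strands `a` on the left and `b` on the
right, are replaced according to one of the rules. -/
inductive Move {V E : Type*} : Picture V E → Picture V E → Prop
  | planar {P Q : Picture V E} (p q L R : List (Slice V E)) (a b : List (Strand E)) :
      PlanarRule L R → P.word = p ++ L.map (Slice.whisker a b) ++ q →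
      Q.word = p ++ R.map (Slice.whisker a b) ++ q → Move P Q
  | reidemeister {P Q : Picture V E} (p q L R : List (Slice V E)) (a b : List (Strand E)) :
      ReidemeisterRule L R → P.word = p ++ L.map (Slice.whisker a b) ++ q →
      Q.word = p ++ R.map (Slice.whisker a b) ++ q → Move P Q

/-- Virtual equivalence: the equivalence relation generated by planar isotopy and the Reidemeister
moves.  (The moves are local and do not change the underlying graph, so every picture obtained from
a diagram of `G` by moves is again a diagram of `G`.) -/
def VirtuallyEquivalent {V E : Type*} {G : DirectedGraph V E} (D D' : Diagram G) : Prop :=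
  Relation.EqvGen Move D.toPicture D'.toPicture

end VirtualGraph

namespace VirtualGraph

variable {V E : Type*}

/-! More is true: any two diagrams of `G` with a common Gauss code are virtually equivalent, and
realizability only supplies a classical diagram with the code of `D`. The reason is the detour
principle: an arc all of whose crossings are virtual can be replaced by any other such arc with the
same ends. So up to moves a diagram remembers only its nodes (vertices and classical crossings) and
how their ends are joined, and this is what the code records.

Words of slices modulo moves behave like the morphisms of a strict monoidal category in which a
virtual strand slides past everything (`Eqv.vpass_word`). Hence every diagram has a normal form: all
nodes side by side at the bottom with all their ends pointing up, and above them a closing word of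
maxima and virtual crossings (`Lift.normalForm`). When the strands carry distinct labels, the labels
at the bottom of the closing word determine it up to moves, because `x` can only be joined to `rev
x` (`IsVirtual.coherence`). The labels are auxiliary, and forgetting them preserves equivalence
(`Eqv.map`).

Local minima count as nodes at first. As there are no circles without vertices, each can be
straightened against a maximum of the closing word (`NormalForm.remove_cup`). A strand is then
determined by its edge and the number of crossings still ahead on that edge (`IsCode.trace_inj`),
and this canonical label can be read off from the code (`IsDiagramCode.match_pass`). So two diagrams
with the same code have the same nodes up to order and rotation: a vertex is given by its cyclic
order, a crossing by its four labels and its sign (`Pass.interchangeable`). Reordering and rotating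
nodes costs only virtual crossings (`Converts.swap`, `Eqv.rotate_vertex`, `Eqv.rotate_crossing`);
these are absorbed into the closing word, and coherence finishes the proof. No classical curl, bigon
or triangle move and no twist at a vertex is needed. -/

@[simp] theorem rev_rev (x : Strand E) : rev (rev x) = x := by
  simp [rev]

theorem rev_ne (x : Strand E) : rev x ≠ x := by
  intro h
  have := congrArg Prod.snd h
  simp [rev] at this

@[simp] theorem CrossingType.flip_flip (t : CrossingType) : t.flip.flip = t := by
  cases t <;> rfl

/-! ### Words with fixed bottom and top, and their equivalence under the moves -/

/-- Add vertical strands `l` on the left and `r` on the right of all slices of a word. -/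
def whiskerWord (l : List (Strand E)) (u : List (Slice V E)) (r : List (Strand E)) :
    List (Slice V E) :=
  u.map (Slice.whisker l r)

@[simp] theorem whiskerWord_nil (l r : List (Strand E)) :
    whiskerWord l ([] : List (Slice V E)) r = [] := rfl

@[simp] theorem whiskerWord_cons (l r : List (Strand E)) (s : Slice V E) (u : List (Slice V E)) :
    whiskerWord l (s :: u) r = ⟨l ++ s.left, s.piece, s.right ++ r⟩ :: whiskerWord l u r := rfl

@[simp] theorem whiskerWord_append (l r : List (Strand E)) (u v : List (Slice V E)) :
    whiskerWord l (u ++ v) r = whiskerWord l u r ++ whiskerWord l v r := by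
  simp [whiskerWord]

@[simp] theorem whiskerWord_whiskerWord (l l' r r' : List (Strand E)) (u : List (Slice V E)) :
    whiskerWord l (whiskerWord l' u r') r = whiskerWord (l ++ l') u (r' ++ r) := by
  simp [whiskerWord, Slice.whisker]

@[simp] theorem whiskerWord_nil_nil (u : List (Slice V E)) : whiskerWord [] u [] = u := by
  induction u with
  | nil => rfl
  | cons s u ih => simp [ih]

@[simp] theorem fits_nil (a b : List (Strand E)) : Fits a ([] : List (Slice V E)) b ↔ a = b :=
  Iff.rfl

@[simp] theorem fits_cons (a b : List (Strand E)) (s : Slice V E) (w : List (Slice V E)) :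
    Fits a (s :: w) b ↔ s.dom = a ∧ Fits s.cod w b := Iff.rfl

theorem fits_append_iff {a c : List (Strand E)} {u v : List (Slice V E)} :
    Fits a (u ++ v) c ↔ ∃ b, Fits a u b ∧ Fits b v c := by
  induction u generalizing a with
  | nil => simp
  | cons s u ih => simp [ih, and_assoc]

theorem Fits.append {a b c : List (Strand E)} {u v : List (Slice V E)}
    (hu : Fits a u b) (hv : Fits b v c) : Fits a (u ++ v) c :=
  fits_append_iff.2 ⟨b, hu, hv⟩

theorem Fits.whisker {a b : List (Strand E)} {u : List (Slice V E)} (h : Fits a u b)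
    (l r : List (Strand E)) : Fits (l ++ a ++ r) (whiskerWord l u r) (l ++ b ++ r) := by
  induction u generalizing a with
  | nil => simpa using h
  | cons s u ih =>
    obtain ⟨h₁, h₂⟩ := h
    simp only [whiskerWord_cons, fits_cons]
    refine ⟨?_, ?_⟩
    · simp [Slice.dom, ← h₁]
    · simpa [Slice.cod] using ih h₂

theorem Fits.cast {a b a' b' : List (Strand E)} {u u' : List (Slice V E)} (h : Fits a u b)
    (ha : a = a') (hb : b = b') (hu : u = u') : Fits a' u' b' := by
  subst ha hb hu; exact h

/-- The local rules: planar isotopy and Reidemeister moves. -/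
def Rule (L R : List (Slice V E)) : Prop := PlanarRule L R ∨ ReidemeisterRule L R

/-- Equivalence of words with bottom `a` and top `b`. -/
inductive Eqv (a b : List (Strand E)) : List (Slice V E) → List (Slice V E) → Prop
  | refl {w} : Fits a w b → Eqv a b w w
  | step {L R} (p q l r) : Rule L R → Fits a (p ++ whiskerWord l L r ++ q) b →
      Fits a (p ++ whiskerWord l R r ++ q) b →
      Eqv a b (p ++ whiskerWord l L r ++ q) (p ++ whiskerWord l R r ++ q)
  | symm {u v} : Eqv a b u v → Eqv a b v u
  | trans {u v w} : Eqv a b u v → Eqv a b v w → Eqv a b u w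

theorem Eqv.fits {a b : List (Strand E)} {u v : List (Slice V E)} (h : Eqv a b u v) :
    Fits a u b ∧ Fits a v b := by
  induction h with
  | refl h => exact ⟨h, h⟩
  | step p q l r _ h₁ h₂ => exact ⟨h₁, h₂⟩
  | symm _ ih => exact ⟨ih.2, ih.1⟩
  | trans _ _ ih₁ ih₂ => exact ⟨ih₁.1, ih₂.2⟩

/-- Every word in a derivation of `Eqv` fits, so the middle word of a transitivity step is again the
word of a picture. This is what allows all local work to be done with words that have free ends. -/
theorem Eqv.eqvGen {u v : List (Slice V E)} (h : Eqv [] [] u v) (P Q : Picture V E)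
    (hP : P.word = u) (hQ : Q.word = v) : Relation.EqvGen Move P Q := by
  induction h generalizing P Q with
  | refl h =>
    cases P; cases Q
    simp only at hP hQ
    subst hP hQ
    exact .refl _
  | step p q l r hr h₁ h₂ =>
    rcases hr with hr | hr
    · exact .rel _ _ (.planar p q _ _ l r hr hP hQ)
    · exact .rel _ _ (.reidemeister p q _ _ l r hr hP hQ)
  | symm _ ih => exact .symm _ _ (ih _ _ hQ hP)
  | trans h₁ _ ih₁ ih₂ =>
    exact .trans _ ⟨_, h₁.fits.2⟩ _ (ih₁ _ _ hP rfl) (ih₂ _ _ rfl hQ)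

theorem Eqv.of_rule {a b : List (Strand E)} {L R : List (Slice V E)} (h : Rule L R)
    (hL : Fits a L b) (hR : Fits a R b) : Eqv a b L R := by
  simpa using Eqv.step (a := a) (b := b) [] [] [] [] h (by simpa using hL) (by simpa using hR)

theorem Eqv.cast {a b a' b' : List (Strand E)} {u v u' v' : List (Slice V E)} (h : Eqv a b u v)
    (ha : a = a') (hb : b = b') (hu : u = u') (hv : v = v') : Eqv a' b' u' v' := by
  subst ha hb hu hv; exact h

theorem Eqv.prepend {a b c : List (Strand E)} {u v v' : List (Slice V E)} (hu : Fits a u b)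
    (h : Eqv b c v v') : Eqv a c (u ++ v) (u ++ v') := by
  induction h with
  | refl h => exact .refl (hu.append h)
  | step p q l r hr h₁ h₂ =>
    have := Eqv.step (a := a) (b := c) (u ++ p) q l r hr (by simpa using hu.append h₁)
      (by simpa using hu.append h₂)
    simpa using this
  | symm _ ih => exact ih.symm
  | trans _ _ ih₁ ih₂ => exact ih₁.trans ih₂

theorem Eqv.postpend {a b c : List (Strand E)} {u u' v : List (Slice V E)}
    (h : Eqv a b u u') (hv : Fits b v c) : Eqv a c (u ++ v) (u' ++ v) := by
  induction h with
  | refl h => exact .refl (h.append hv)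
  | step p q l r hr h₁ h₂ =>
    have := Eqv.step (a := a) (b := c) p (q ++ v) l r hr (by simpa using h₁.append hv)
      (by simpa using h₂.append hv)
    simpa using this
  | symm _ ih => exact ih.symm
  | trans _ _ ih₁ ih₂ => exact ih₁.trans ih₂

theorem Eqv.append {a b c : List (Strand E)} {u u' v v' : List (Slice V E)}
    (h : Eqv a b u u') (h' : Eqv b c v v') : Eqv a c (u ++ v) (u' ++ v') :=
  (h.postpend h'.fits.1).trans (.prepend h.fits.2 h')

theorem Eqv.whisker {a b : List (Strand E)} {u u' : List (Slice V E)} (h : Eqv a b u u')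
    (l r : List (Strand E)) :
    Eqv (l ++ a ++ r) (l ++ b ++ r) (whiskerWord l u r) (whiskerWord l u' r) := by
  induction h with
  | refl h => exact .refl (h.whisker l r)
  | step p q l' r' hr h₁ h₂ =>
    have := Eqv.step (a := l ++ a ++ r) (b := l ++ b ++ r) (whiskerWord l p r)
      (whiskerWord l q r) (l ++ l') (r' ++ r) hr (by simpa using h₁.whisker l r)
      (by simpa using h₂.whisker l r)
    simpa using this
  | symm _ ih => exact ih.symm
  | trans _ _ ih₁ ih₂ => exact ih₁.trans ih₂

/-- Rewriting a factor of a word, in a context. -/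
theorem Eqv.context {a b s t : List (Strand E)} {u v : List (Slice V E)} (h : Eqv a b u v)
    (p q : List (Slice V E)) (l r : List (Strand E)) (hp : Fits s p (l ++ a ++ r))
    (hq : Fits (l ++ b ++ r) q t) :
    Eqv s t (p ++ (whiskerWord l u r ++ q)) (p ++ (whiskerWord l v r ++ q)) :=
  .prepend hp ((h.whisker l r).postpend hq)

/-! ### Interchange -/

theorem Eqv.interchange_piece (p q : Piece V E) (m : List (Strand E)) :
    Eqv (p.dom ++ m ++ q.dom) (p.cod ++ m ++ q.cod)
      [⟨[], p, m ++ q.dom⟩, ⟨p.cod ++ m, q, []⟩]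
      [⟨p.dom ++ m, q, []⟩, ⟨[], p, m ++ q.cod⟩] :=
  .of_rule (.inl (.interchange p q m)) (by simp [Slice.dom, Slice.cod])
    (by simp [Slice.dom, Slice.cod])

theorem Eqv.interchange_slice (s s' : Slice V E) :
    Eqv (s.dom ++ s'.dom) (s.cod ++ s'.cod)
      [⟨s.left, s.piece, s.right ++ s'.dom⟩, ⟨s.cod ++ s'.left, s'.piece, s'.right⟩]
      [⟨s.dom ++ s'.left, s'.piece, s'.right⟩, ⟨s.left, s.piece, s.right ++ s'.cod⟩] := by
  have := (Eqv.interchange_piece s.piece s'.piece (s.right ++ s'.left)).whisker s.left s'.right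
  simpa [Slice.dom, Slice.cod] using this

theorem Eqv.interchange_slice_word (s : Slice V E) {c d : List (Strand E)} {v : List (Slice V E)}
    (hv : Fits c v d) :
    Eqv (s.dom ++ c) (s.cod ++ d)
      (⟨s.left, s.piece, s.right ++ c⟩ :: whiskerWord s.cod v [])
      (whiskerWord s.dom v [] ++ [⟨s.left, s.piece, s.right ++ d⟩]) := by
  induction v generalizing c with
  | nil =>
    simp only [fits_nil] at hv
    subst hv
    exact .refl (by simp [Slice.dom, Slice.cod])
  | cons s' v ih =>
    obtain ⟨h₁, h₂⟩ := hv
    subst h₁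
    have h1 := (Eqv.interchange_slice s s').postpend (v := whiskerWord s.cod v [])
      (c := s.cod ++ d) (by simpa using h₂.whisker s.cod [])
    have h2 := Eqv.prepend (u := [⟨s.dom ++ s'.left, s'.piece, s'.right⟩])
      (a := s.dom ++ s'.dom) (by simp [Slice.dom, Slice.cod]) (ih h₂)
    simpa using h1.trans (by simpa using h2)

/-- Adjacent words exchange heights one slice at a time: first a single slice of `u` climbs past all
of `v`, then the slices of `u` do so in turn. This is the interchange law of a monoidal category. -/
theorem Eqv.interchange {a b c d : List (Strand E)} {u v : List (Slice V E)}
    (hu : Fits a u b) (hv : Fits c v d) :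
    Eqv (a ++ c) (b ++ d) (whiskerWord [] u c ++ whiskerWord b v [])
      (whiskerWord a v [] ++ whiskerWord [] u d) := by
  induction u generalizing a with
  | nil =>
    simp only [fits_nil] at hu
    subst hu
    simpa using Eqv.refl (by simpa using hv.whisker a [])
  | cons s u ih =>
    obtain ⟨h₁, h₂⟩ := hu
    subst h₁
    have h1 := Eqv.prepend (u := [⟨s.left, s.piece, s.right ++ c⟩])
      (a := s.dom ++ c) (by simp [Slice.dom, Slice.cod]) (ih h₂)
    have h2 := (Eqv.interchange_slice_word s hv).postpend (v := whiskerWord [] u d)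
      (c := b ++ d) (by simpa using h₂.whisker [] d)
    refine .trans (by simpa using h1) (by simpa using h2)

/-! ### A strand passing other strands virtually -/

/-- The strand `y` passes the strands of the list virtually from left to right. -/
abbrev vpass (y : Strand E) (zs : List (Strand E)) : List (Slice V E) := passRight .virt y zs

theorem passRight_cons (t : CrossingType) (y z : Strand E) (zs : List (Strand E)) :
    (passRight t y (z :: zs) : List (Slice V E)) =
      ⟨[], .cross t y z, zs⟩ :: whiskerWord [z] (passRight t y zs) [] := rfl

@[simp] theorem passRight_nil (t : CrossingType) (y : Strand E) :
    (passRight t y [] : List (Slice V E)) = [] := rfl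

theorem passRight_append (t : CrossingType) (y : Strand E) (l m : List (Strand E)) :
    (passRight t y (l ++ m) : List (Slice V E)) =
      whiskerWord [] (passRight t y l) m ++ whiskerWord l (passRight t y m) [] := by
  induction l with
  | nil => simp
  | cons z l ih => simp [passRight_cons, ih]

theorem fits_passRight (t : CrossingType) (y : Strand E) (zs : List (Strand E)) :
    Fits (y :: zs) (passRight t y zs : List (Slice V E)) (zs ++ [y]) := by
  induction zs with
  | nil => simp
  | cons z zs ih =>
    rw [passRight_cons]
    refine ⟨by simp [Slice.dom, Piece.dom], ?_⟩
    simpa [Slice.cod, Piece.cod] using ih.whisker [z] []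

theorem Eqv.bigon (t : CrossingType) (x y : Strand E) :
    Eqv [x, y] [x, y]
      ([⟨[], .cross t x y, []⟩, ⟨[], .cross t.flip y x, []⟩] : List (Slice V E)) [] :=
  .of_rule (.inr (.bigon t x y)) (by simp [Slice.dom, Slice.cod, Piece.dom, Piece.cod]) (by simp)

theorem Eqv.vbigon (x y : Strand E) :
    Eqv [x, y] [x, y]
      ([⟨[], .cross .virt x y, []⟩, ⟨[], .cross .virt y x, []⟩] : List (Slice V E)) [] :=
  Eqv.bigon .virt x y

theorem Eqv.slideCap (t : CrossingType) (x y : Strand E) :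
    Eqv [x, y, rev x] [y] ([⟨[x], .cross t y (rev x), []⟩, ⟨[], .cap x, [y]⟩] : List (Slice V E))
      [⟨[], .cross t.flip x y, [rev x]⟩, ⟨[y], .cap x, []⟩] :=
  .of_rule (.inl (.slideCap t x y)) (by simp [Slice.dom, Slice.cod, Piece.dom, Piece.cod])
    (by simp [Slice.dom, Slice.cod, Piece.dom, Piece.cod])

theorem Eqv.slideCup (t : CrossingType) (x y : Strand E) :
    Eqv [y] [x, y, rev x] ([⟨[], .cup x, [y]⟩, ⟨[x], .cross t (rev x) y, []⟩] : List (Slice V E))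
      [⟨[y], .cup x, []⟩, ⟨[], .cross t.flip y x, [rev x]⟩] :=
  .of_rule (.inl (.slideCup t x y)) (by simp [Slice.dom, Slice.cod, Piece.dom, Piece.cod])
    (by simp [Slice.dom, Slice.cod, Piece.dom, Piece.cod])

theorem Eqv.zigzagLeft (x : Strand E) :
    Eqv [x] [x] ([⟨[x], .cup (rev x), []⟩, ⟨[], .cap x, [x]⟩] : List (Slice V E)) [] :=
  .of_rule (.inl (.zigzagLeft x)) (by simp [Slice.dom, Slice.cod, Piece.dom, Piece.cod]) (by simp)

theorem Eqv.zigzagRight (x : Strand E) :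
    Eqv [x] [x] ([⟨[], .cup x, [x]⟩, ⟨[x], .cap (rev x), []⟩] : List (Slice V E)) [] :=
  .of_rule (.inl (.zigzagRight x)) (by simp [Slice.dom, Slice.cod, Piece.dom, Piece.cod])
    (by simp)

/-- A strand slides virtually past an arbitrary piece. -/
theorem Eqv.vpass_piece (y : Strand E) (p : Piece V E) :
    Eqv (y :: p.dom) (p.cod ++ [y]) (vpass y p.dom ++ [⟨[], p, [y]⟩])
      (⟨[y], p, []⟩ :: vpass y p.cod) := by
  cases p with
  | cup a =>
    -- `slideCup` turns a crossing with one leg of the minimum into a crossing with the other leg;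
    -- the strand is to cross both legs, and the surplus pair is a virtual bigon.
    have h1 := (Eqv.slideCup (V := V) .virt a y).postpend
      (v := [⟨[a], .cross .virt y (rev a), []⟩]) (c := [a, rev a, y])
      (by simp [Slice.dom, Slice.cod, Piece.dom, Piece.cod])
    have h2 := (Eqv.vbigon (V := V) (rev a) y).context [⟨[], .cup a, [y]⟩] [] [a] []
      (s := [y]) (t := [a, rev a, y]) (by simp [Slice.dom, Slice.cod, Piece.dom, Piece.cod])
      (by simp)
    have h1' := h1.symm.trans (by simpa using h2)
    simpa [Piece.dom, Piece.cod, passRight_cons, CrossingType.flip] using h1'.symm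
  | cap a =>
    have h1 := Eqv.prepend (u := [⟨[], .cross .virt y a, [rev a]⟩]) (a := [y, a, rev a])
      (by simp [Slice.dom, Slice.cod, Piece.dom, Piece.cod])
      (Eqv.slideCap (V := V) .virt a y)
    have h2 := (Eqv.vbigon (V := V) y a).context [] [⟨[y], .cap a, []⟩] [] [rev a]
      (s := [y, a, rev a]) (t := [y]) (by simp)
      (by simp [Slice.dom, Slice.cod, Piece.dom, Piece.cod])
    have h1' := h1.trans (by simpa [CrossingType.flip] using h2)
    simpa [Piece.dom, Piece.cod, passRight_cons] using h1'
  | cross t a b =>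
    -- The moving strand meets both others virtually, so the triangle is allowed whatever the type
    -- `t` of the crossing it passes.
    have := Eqv.of_rule (V := V) (a := [y, a, b]) (b := [b, a, y])
      (.inr (.triangle .virt .virt t (by cases t <;> trivial) y a b))
      (by simp [Slice.dom, Slice.cod, Piece.dom, Piece.cod])
      (by simp [Slice.dom, Slice.cod, Piece.dom, Piece.cod])
    simpa [Piece.dom, Piece.cod, passRight_cons] using this
  | vertex v below above =>
    refine Eqv.of_rule (.inr (.pastVertex .virt y v below above)) ?_ ?_
    · exact (fits_passRight _ _ _).append (by simp [Slice.dom, Slice.cod, Piece.dom, Piece.cod])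
    · refine ⟨by simp [Slice.dom, Piece.dom], ?_⟩
      simpa [Slice.cod, Piece.cod] using fits_passRight (V := V) .virt y above

/-- The passage splits into crossings with the strands left of the piece, at the piece and right of
it. The outer parts commute with the piece by interchange; only the middle one needs
`Eqv.vpass_piece`. -/
theorem Eqv.vpass_slice (y : Strand E) (s : Slice V E) :
    Eqv (y :: s.dom) (s.cod ++ [y]) (vpass y s.dom ++ [⟨s.left, s.piece, s.right ++ [y]⟩])
      (⟨y :: s.left, s.piece, s.right⟩ :: vpass y s.cod) := by
  obtain ⟨l, p, r⟩ := s
  have hp : Fits p.dom [(⟨[], p, []⟩ : Slice V E)] p.cod := by simp [Slice.dom, Slice.cod]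
  have h1 := (Eqv.interchange hp (fits_passRight (V := V) .virt y r)).symm.context
    (whiskerWord [] (vpass y l) (p.dom ++ r) ++ whiskerWord l (vpass y p.dom) r) [] l []
    (s := y :: (l ++ p.dom ++ r)) (t := l ++ p.cod ++ r ++ [y])
    (.append (by simpa using (fits_passRight (V := V) .virt y l).whisker [] (p.dom ++ r))
      (by simpa using (fits_passRight (V := V) .virt y p.dom).whisker l r))
    (by simp)
  have h2 := (Eqv.vpass_piece y p).context (whiskerWord [] (vpass y l) (p.dom ++ r))
    (whiskerWord (l ++ p.cod) (vpass y r) []) l r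
    (s := y :: (l ++ p.dom ++ r)) (t := l ++ p.cod ++ r ++ [y])
    (by simpa using (fits_passRight (V := V) .virt y l).whisker [] (p.dom ++ r))
    (by simpa using (fits_passRight (V := V) .virt y r).whisker (l ++ p.cod) [])
  have h3 := (Eqv.interchange (fits_passRight (V := V) .virt y l) (hp.whisker [] r)).postpend
    (v := whiskerWord l (vpass y p.cod) r ++ whiskerWord (l ++ p.cod) (vpass y r) [])
    (c := l ++ p.cod ++ r ++ [y])
    (.append (b := l ++ p.cod ++ [y] ++ r)
      (by simpa using (fits_passRight (V := V) .virt y p.cod).whisker l r)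
      (by simpa using (fits_passRight (V := V) .virt y r).whisker (l ++ p.cod) []))
  simp only [Slice.dom, Slice.cod, vpass, passRight_append] at *
  refine .trans (h1.cast (by simp) (by simp) (by simp) rfl) ?_
  refine .trans (h2.cast (by simp) (by simp) (by simp) rfl) ?_
  exact h3.cast (by simp) (by simp) (by simp) (by simp)

/-- A strand slides virtually past an arbitrary word. -/
theorem Eqv.vpass_word (y : Strand E) {a b : List (Strand E)} {u : List (Slice V E)}
    (hu : Fits a u b) :
    Eqv (y :: a) (b ++ [y]) (vpass y a ++ whiskerWord [] u [y])
      (whiskerWord [y] u [] ++ vpass y b) := by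
  induction u generalizing a with
  | nil =>
    simp only [fits_nil] at hu
    subst hu
    simpa using Eqv.refl (fits_passRight (V := V) .virt y a)
  | cons s u ih =>
    obtain ⟨h₁, h₂⟩ := hu
    subst h₁
    have h1 := (Eqv.vpass_slice y s).postpend (v := whiskerWord [] u [y]) (c := b ++ [y])
      (by simpa using h₂.whisker [] [y])
    have h2 := Eqv.prepend (u := [⟨y :: s.left, s.piece, s.right⟩]) (a := y :: s.dom)
      (by simp [Slice.dom, Slice.cod]) (ih h₂)
    refine .trans (by simpa using h1) (by simpa using h2)

/-- The strands `d` pass the strands `c` virtually from left to right. -/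
def passBlock : List (Strand E) → List (Strand E) → List (Slice V E)
  | [], _ => []
  | y :: d, c => whiskerWord [y] (passBlock d c) [] ++ whiskerWord [] (vpass y c) d

theorem fits_passBlock (d c : List (Strand E)) :
    Fits (d ++ c) (passBlock d c : List (Slice V E)) (c ++ d) := by
  induction d with
  | nil => simp [passBlock]
  | cons y d ih =>
    refine .append (by simpa using ih.whisker [y] [])
      (by simpa using (fits_passRight (V := V) .virt y c).whisker [] d)

@[simp] theorem passBlock_nil (d : List (Strand E)) :
    (passBlock d [] : List (Slice V E)) = [] := by
  induction d with
  | nil => rfl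
  | cons y d ih => simp [passBlock, ih]

theorem Eqv.passBlock_word (d : List (Strand E)) {a b : List (Strand E)} {u : List (Slice V E)}
    (hu : Fits a u b) :
    Eqv (d ++ a) (b ++ d) (passBlock d a ++ whiskerWord [] u d)
      (whiskerWord d u [] ++ passBlock d b) := by
  induction d with
  | nil => simpa [passBlock] using Eqv.refl hu
  | cons y d ih =>
    have h1 := ((Eqv.vpass_word y hu).whisker [] d)
    have h1' := Eqv.prepend (u := whiskerWord [y] (passBlock d a) []) (a := y :: (d ++ a))
      (by simpa using (fits_passBlock (V := V) d a).whisker [y] []) h1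
    have h2 := (ih.whisker [y] []).postpend (v := whiskerWord [] (vpass y b) d)
      (c := b ++ [y] ++ d)
      (by simpa using (fits_passRight (V := V) .virt y b).whisker [] d)
    refine .trans (h1'.cast (by simp) (by simp) (by simp [passBlock]) rfl)
      (h2.cast (by simp) (by simp) (by simp) (by simp [passBlock]))

/-- A closed-off word on the right of the strands `d` is moved to their left. -/
theorem Eqv.passBlock_closed (d : List (Strand E)) {b : List (Strand E)} {u : List (Slice V E)}
    (hu : Fits [] u b) :
    Eqv d (b ++ d) (whiskerWord d u [] ++ passBlock d b) (whiskerWord [] u d) := by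
  simpa using (Eqv.passBlock_word d hu).symm

/-! ### Virtual curls -/

/-- This is uniqueness of duals. Both sides straighten against `cup x`: the right side by a zigzag,
the left side because sliding the crossing through the maximum produces a virtual curl. Inserting a
zigzag on `rev x` and exchanging the heights of the two maxima identifies them. -/
theorem Eqv.vcross_cap (x : Strand E) :
    Eqv [rev x, x] [] ([⟨[], .cross .virt (rev x) x, []⟩, ⟨[], .cap x, []⟩] : List (Slice V E))
      [⟨[], .cap (rev x), []⟩] := by
  set C : List (Slice V E) := [⟨[], .cross .virt (rev x) x, []⟩, ⟨[], .cap x, []⟩] with hC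
  have hfit : Fits [rev x, x] C [] := by simp [hC, Slice.dom, Slice.cod, Piece.dom, Piece.cod]
  have hcap : Fits [rev x, x] ([⟨[], .cap (rev x), []⟩] : List (Slice V E)) [] := by
    simp [Slice.dom, Slice.cod, Piece.dom, Piece.cod]
  have hid : Eqv [x] [x] (⟨[], .cup x, [x]⟩ :: whiskerWord [x] C []) [] := by
    have h1 := (Eqv.slideCup (V := V) .virt x x).postpend (v := [⟨[x], .cap x, []⟩]) (c := [x])
      (by simp [Slice.dom, Slice.cod, Piece.dom, Piece.cod])
    have h2 := Eqv.of_rule (V := V) (a := [x]) (b := [x]) (.inr (.curlRight .virt x))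
      (by simp [Slice.dom, Slice.cod, Piece.dom, Piece.cod]) (by simp)
    refine .trans ?_ h2
    simpa [hC, CrossingType.flip] using h1
  have z := ((Eqv.zigzagLeft (V := V) (rev x)).whisker [] [x]).postpend hfit
  have i := Eqv.prepend (u := [⟨[rev x], .cup x, [x]⟩]) (a := [rev x, x])
    (by simp [Slice.dom, Slice.cod, Piece.dom, Piece.cod]) (Eqv.interchange hcap hfit)
  have k := (hid.whisker [rev x] []).postpend (v := [⟨[], .cap (rev x), []⟩]) (c := [])
    (by simpa using hcap)
  refine .trans (z.symm.cast (by simp) rfl (by simp) rfl) ?_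
  refine .trans (i.cast (by simp) (by simp) (by simp) rfl) ?_
  exact k.cast (by simp) (by simp) (by simp) (by simp)

/-- Dual to `Eqv.vcross_cap`: both minima straighten against `cap x`, and a minimum with this
property is unique. -/
theorem Eqv.cup_vcross (x : Strand E) :
    Eqv [] [rev x, x] ([⟨[], .cup x, []⟩, ⟨[], .cross .virt x (rev x), []⟩] : List (Slice V E))
      [⟨[], .cup (rev x), []⟩] := by
  set K : List (Slice V E) := [⟨[], .cup x, []⟩, ⟨[], .cross .virt x (rev x), []⟩] with hK
  have hfit : Fits [] K [rev x, x] := by simp [hK, Slice.dom, Slice.cod, Piece.dom, Piece.cod]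
  have hcup : Fits [] ([⟨[], .cup (rev x), []⟩] : List (Slice V E)) [rev x, x] := by
    simp [Slice.dom, Slice.cod, Piece.dom, Piece.cod]
  have hid : Eqv [x] [x] (whiskerWord [x] K [] ++ [⟨[], .cap x, [x]⟩]) [] := by
    have h1 := Eqv.prepend (u := [⟨[x], .cup x, []⟩]) (a := [x])
      (by simp [Slice.dom, Slice.cod, Piece.dom, Piece.cod]) (Eqv.slideCap (V := V) .virt x x)
    have h2 := Eqv.of_rule (V := V) (a := [x]) (b := [x]) (.inr (.curlRight .virt x))
      (by simp [Slice.dom, Slice.cod, Piece.dom, Piece.cod]) (by simp)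
    refine .trans ?_ h2
    simpa [hK, CrossingType.flip] using h1
  have z := Eqv.prepend hfit ((Eqv.zigzagRight (V := V) (rev x)).whisker [] [x])
  have i := (Eqv.interchange hcup hfit).postpend (v := [⟨[rev x], .cap x, [x]⟩])
    (c := [rev x, x]) (by simp [Slice.dom, Slice.cod, Piece.dom, Piece.cod])
  have k := Eqv.prepend hcup (hid.whisker [rev x] [])
  refine .trans (z.symm.cast rfl (by simp) (by simp) rfl) ?_
  refine .trans (i.symm.cast (by simp) (by simp) (by simp) rfl) ?_
  exact k.cast (by simp) (by simp) (by simp) (by simp)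

/-! ### Snakes -/

/-- Nested local minima, from `[]` to `(d.map rev).reverse ++ d`. -/
def cups : List (Strand E) → List (Slice V E)
  | [] => []
  | x :: d => cups d ++ [⟨(d.map rev).reverse, .cup (rev x), d⟩]

/-- Nested local maxima, from `d ++ (d.map rev).reverse` to `[]`. -/
def caps : List (Strand E) → List (Slice V E)
  | [] => []
  | x :: d => whiskerWord [x] (caps d) [rev x] ++ [⟨[], .cap x, []⟩]

theorem fits_cups (d : List (Strand E)) :
    Fits [] (cups d : List (Slice V E)) ((d.map rev).reverse ++ d) := by
  induction d with
  | nil => simp [cups]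
  | cons x d ih => exact ih.append (by simp [Slice.dom, Slice.cod, Piece.dom, Piece.cod])

theorem fits_caps (d : List (Strand E)) :
    Fits (d ++ (d.map rev).reverse) (caps d : List (Slice V E)) [] := by
  induction d with
  | nil => simp [caps]
  | cons x d ih =>
    refine .append (by simpa using ih.whisker [x] [rev x])
      (by simp [Slice.dom, Slice.cod, Piece.dom, Piece.cod])

/-- The minimum of the head strand commutes with the maxima of the tail, so the tail straightens
first by induction and a single zigzag remains. -/
theorem Eqv.snake (d : List (Strand E)) :
    Eqv d d (whiskerWord d (cups d : List (Slice V E)) [] ++ whiskerWord [] (caps d) d) [] := by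
  induction d with
  | nil => exact .refl (by simp [cups, caps])
  | cons x d ih =>
    have hcup : Fits [] ([⟨[], .cup (rev x), []⟩] : List (Slice V E)) [rev x, x] := by
      simp [Slice.dom, Slice.cod, Piece.dom, Piece.cod]
    have h1 := (Eqv.interchange (fits_caps (V := V) d) hcup).symm.context
      (whiskerWord (x :: d) (cups d) []) [⟨[], .cap x, x :: d⟩] [x] d (s := x :: d) (t := x :: d)
      (by simpa using (fits_cups (V := V) d).whisker (x :: d) [])
      (by simp [Slice.dom, Slice.cod, Piece.dom, Piece.cod])
    have h2 := (ih.whisker [x] []).postpend (v := [⟨[x], .cup (rev x), d⟩, ⟨[], .cap x, x :: d⟩])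
      (c := x :: d) (by simp [Slice.dom, Slice.cod, Piece.dom, Piece.cod])
    have h3 := (Eqv.zigzagLeft (V := V) x).whisker [] d
    refine .trans (h1.cast rfl rfl (by simp [cups, caps]) rfl) ?_
    refine .trans (h2.cast (by simp) (by simp) (by simp) rfl) ?_
    exact h3.cast (by simp) (by simp) (by simp) (by simp)

/-- The strands at the top of a piece after its bottom strands have been bent up to the left. -/
def Piece.ports (p : Piece V E) : List (Strand E) := (p.dom.map rev).reverse ++ p.cod

/-- The piece with its bottom strands bent up to the left. -/
def Piece.bent (p : Piece V E) : List (Slice V E) :=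
  cups p.dom ++ [⟨(p.dom.map rev).reverse, p, []⟩]

theorem Piece.fits_bent (p : Piece V E) : Fits [] p.bent p.ports :=
  (fits_cups p.dom).append (by simp [Slice.dom, Slice.cod, Piece.ports])

/-- Bending the bottom strands up and then closing them with maxima gives a snake on each of them;
once the piece is lifted above the maxima, the snakes straighten. -/
theorem Eqv.bent_caps (p : Piece V E) :
    Eqv p.dom p.cod (whiskerWord p.dom p.bent [] ++ whiskerWord [] (caps p.dom) p.cod)
      [⟨[], p, []⟩] := by
  have hp : Fits p.dom [(⟨[], p, []⟩ : Slice V E)] p.cod := by simp [Slice.dom, Slice.cod]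
  have h1 := Eqv.prepend (u := whiskerWord p.dom (cups p.dom) []) (a := p.dom)
    (by simpa using (fits_cups p.dom).whisker p.dom [])
    (Eqv.interchange (fits_caps (V := V) p.dom) hp).symm
  have h2 := (Eqv.snake (V := V) p.dom).postpend hp
  refine .trans (h1.cast (by simp) (by simp) (by simp [Piece.bent]) rfl) ?_
  exact h2.cast rfl rfl (by simp) (by simp)

/-! ### Relabelling strands -/

section Map

variable {F : Type*}

/-- Relabel a strand. -/
def mapStrand (g : E → F) (x : Strand E) : Strand F := (g x.1, x.2)

@[simp] theorem mapStrand_rev (g : E → F) (x : Strand E) :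
    mapStrand g (rev x) = rev (mapStrand g x) := rfl

/-- Relabel the strands of a piece. -/
def Piece.map (g : E → F) : Piece V E → Piece V F
  | cup x => cup (mapStrand g x)
  | cap x => cap (mapStrand g x)
  | cross t x y => cross t (mapStrand g x) (mapStrand g y)
  | vertex v below above => vertex v (below.map (mapStrand g)) (above.map (mapStrand g))

@[simp] theorem Piece.dom_map (g : E → F) (p : Piece V E) :
    (p.map g).dom = p.dom.map (mapStrand g) := by
  cases p <;> simp [Piece.map, Piece.dom]

@[simp] theorem Piece.cod_map (g : E → F) (p : Piece V E) :
    (p.map g).cod = p.cod.map (mapStrand g) := by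
  cases p <;> simp [Piece.map, Piece.cod]

/-- Relabel the strands of a slice. -/
def Slice.map (g : E → F) (s : Slice V E) : Slice V F :=
  ⟨s.left.map (mapStrand g), s.piece.map g, s.right.map (mapStrand g)⟩

/-- Relabel the strands of a word. -/
abbrev mapWord (g : E → F) (w : List (Slice V E)) : List (Slice V F) := w.map (Slice.map g)

theorem mapWord_whiskerWord (g : E → F) (l r : List (Strand E)) (u : List (Slice V E)) :
    mapWord g (whiskerWord l u r) =
      whiskerWord (l.map (mapStrand g)) (mapWord g u) (r.map (mapStrand g)) := by
  simp [whiskerWord, Slice.whisker, Slice.map, Function.comp_def]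

theorem Fits.map (g : E → F) {a b : List (Strand E)} {u : List (Slice V E)} (h : Fits a u b) :
    Fits (a.map (mapStrand g)) (mapWord g u) (b.map (mapStrand g)) := by
  induction u generalizing a with
  | nil => simpa using congrArg _ h
  | cons s u ih =>
    obtain ⟨h₁, h₂⟩ := h
    subst h₁
    exact ⟨by simp [Slice.dom, Slice.map], by simpa [Slice.cod, Slice.map] using ih h₂⟩

theorem mapWord_passRight (g : E → F) (t : CrossingType) (y : Strand E) (zs : List (Strand E)) :
    mapWord g (passRight t y zs : List (Slice V E)) =
      passRight t (mapStrand g y) (zs.map (mapStrand g)) := by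
  induction zs with
  | nil => rfl
  | cons z zs ih =>
    rw [passRight_cons, mapWord, List.map_cons, ← mapWord, mapWord_whiskerWord, ih]
    simp [passRight_cons, Slice.map, Piece.map]

theorem mapWord_passBlock (g : E → F) (d c : List (Strand E)) :
    mapWord g (passBlock d c : List (Slice V E)) =
      passBlock (d.map (mapStrand g)) (c.map (mapStrand g)) := by
  induction d with
  | nil => rfl
  | cons y d ih =>
    rw [passBlock, mapWord, List.map_append, ← mapWord, ← mapWord, mapWord_whiskerWord,
      mapWord_whiskerWord, ih, mapWord_passRight]
    simp [passBlock]

theorem mapWord_caps (g : E → F) (d : List (Strand E)) :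
    mapWord g (caps d : List (Slice V E)) = caps (d.map (mapStrand g)) := by
  induction d with
  | nil => rfl
  | cons y d ih =>
    rw [caps, mapWord, List.map_append, ← mapWord, ← mapWord, mapWord_whiskerWord, ih]
    simp [caps, Slice.map, Piece.map]

theorem PlanarRule.map (g : E → F) {L R : List (Slice V E)} (h : PlanarRule L R) :
    PlanarRule (mapWord g L) (mapWord g R) := by
  cases h with
  | interchange p q m =>
    simpa [Slice.map] using PlanarRule.interchange (p.map g) (q.map g) (m.map (mapStrand g))
  | zigzagLeft x => exact .zigzagLeft (mapStrand g x)
  | zigzagRight x => exact .zigzagRight (mapStrand g x)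
  | slideCap t x y => exact .slideCap t (mapStrand g x) (mapStrand g y)
  | slideCup t x y => exact .slideCup t (mapStrand g x) (mapStrand g y)
  | bendLeft v below above x =>
    exact .bendLeft v (below.map (mapStrand g)) (above.map (mapStrand g)) (mapStrand g x)
  | bendRight v below above x =>
    simpa [Slice.map, Piece.map] using
      PlanarRule.bendRight v (below.map (mapStrand g)) (above.map (mapStrand g)) (mapStrand g x)

theorem ReidemeisterRule.map (g : E → F) {L R : List (Slice V E)} (h : ReidemeisterRule L R) :
    ReidemeisterRule (mapWord g L) (mapWord g R) := by
  cases h with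
  | curlRight t x => exact .curlRight t (mapStrand g x)
  | curlLeft t x => exact .curlLeft t (mapStrand g x)
  | bigon t x y => exact .bigon t (mapStrand g x) (mapStrand g y)
  | triangle t₁ t₂ t₃ h x y z =>
    exact .triangle t₁ t₂ t₃ h (mapStrand g x) (mapStrand g y) (mapStrand g z)
  | pastVertex t y v below above =>
    have := ReidemeisterRule.pastVertex t (mapStrand g y) v (below.map (mapStrand g))
      (above.map (mapStrand g))
    rw [← mapWord_passRight, ← mapWord_passRight] at this
    simpa [mapWord, Slice.map, Piece.map] using this
  | twist t ht v below l r x y =>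
    simpa [mapWord, Slice.map, Piece.map] using
      ReidemeisterRule.twist t ht v (below.map (mapStrand g)) (l.map (mapStrand g))
        (r.map (mapStrand g)) (mapStrand g x) (mapStrand g y)

/-- All rules are uniform in the names of the strands. Thus an equivalence proved for strands with
distinct labels survives forgetting the labels, where one edge may supply many strands. -/
theorem Eqv.map (g : E → F) {a b : List (Strand E)} {u v : List (Slice V E)} (h : Eqv a b u v) :
    Eqv (a.map (mapStrand g)) (b.map (mapStrand g)) (mapWord g u) (mapWord g v) := by
  induction h with
  | refl h => exact .refl (h.map g)
  | @step L R p q l r hr h₁ h₂ =>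
    have e : ∀ K : List (Slice V E), mapWord g (p ++ whiskerWord l K r ++ q) =
        mapWord g p ++ whiskerWord (l.map (mapStrand g)) (mapWord g K) (r.map (mapStrand g)) ++
          mapWord g q := by
      intro K
      rw [← mapWord_whiskerWord]
      simp [mapWord]
    have h₁' := h₁.map g
    have h₂' := h₂.map g
    rw [e] at h₁' h₂' ⊢
    rw [e]
    exact .step _ _ _ _ (hr.imp (PlanarRule.map g) (ReidemeisterRule.map g)) h₁' h₂'
  | symm _ ih => exact ih.symm
  | trans _ _ ih₁ ih₂ => exact ih₁.trans ih₂

end Map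

/-! ### Words of local maxima and virtual crossings -/

/-- The word consists of local maxima and virtual crossings. -/
def IsVirtual (u : List (Slice V E)) : Prop :=
  ∀ s ∈ u, (∃ x, s.piece = .cap x) ∨ ∃ x y, s.piece = .cross .virt x y

@[simp] theorem isVirtual_nil : IsVirtual ([] : List (Slice V E)) := by simp [IsVirtual]

@[simp] theorem isVirtual_cons {s : Slice V E} {u : List (Slice V E)} : IsVirtual (s :: u) ↔
    ((∃ x, s.piece = .cap x) ∨ ∃ x y, s.piece = .cross .virt x y) ∧ IsVirtual u := by
  simp [IsVirtual]

@[simp] theorem isVirtual_append {u v : List (Slice V E)} :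
    IsVirtual (u ++ v) ↔ IsVirtual u ∧ IsVirtual v := by
  simp only [IsVirtual, List.mem_append, or_imp, forall_and]

@[simp] theorem isVirtual_whiskerWord {l r : List (Strand E)} {u : List (Slice V E)} :
    IsVirtual (whiskerWord l u r) ↔ IsVirtual u := by
  simp [IsVirtual, whiskerWord, Slice.whisker]

@[simp] theorem isVirtual_vpass (y : Strand E) (zs : List (Strand E)) :
    IsVirtual (vpass y zs : List (Slice V E)) := by
  induction zs with
  | nil => simp
  | cons z zs ih => simpa [passRight_cons] using ih

@[simp] theorem isVirtual_passBlock (d c : List (Strand E)) :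
    IsVirtual (passBlock d c : List (Slice V E)) := by
  induction d with
  | nil => simp [passBlock]
  | cons z zs ih => simpa [passBlock] using ih

@[simp] theorem isVirtual_caps (d : List (Strand E)) :
    IsVirtual (caps d : List (Slice V E)) := by
  induction d with
  | nil => simp [caps]
  | cons z zs ih => simpa [caps] using ih

theorem IsVirtual.map {F : Type*} (g : E → F) {u : List (Slice V E)} (h : IsVirtual u) :
    IsVirtual (mapWord g u) := by
  intro s hs
  obtain ⟨s, hs', rfl⟩ := List.mem_map.1 hs
  rcases h s hs' with ⟨x, hx⟩ | ⟨x, y, hx⟩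
  · exact .inl ⟨mapStrand g x, by simp [Slice.map, hx, Piece.map]⟩
  · exact .inr ⟨mapStrand g x, mapStrand g y, by simp [Slice.map, hx, Piece.map]⟩

/-! ### Shrinking one arc of a closing word -/

/-- The strand `x` passes the strands `b` virtually and meets `rev x` in a local maximum. -/
def capOver (x : Strand E) (b : List (Strand E)) : List (Slice V E) :=
  whiskerWord [] (vpass x b) [rev x] ++ [⟨b, .cap x, []⟩]

theorem fits_capOver (x : Strand E) (b : List (Strand E)) :
    Fits (x :: (b ++ [rev x])) (capOver x b : List (Slice V E)) b :=
  .append (by simpa using (fits_passRight (V := V) .virt x b).whisker [] [rev x])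
    (by simp [Slice.dom, Slice.cod, Piece.dom, Piece.cod])

theorem capOver_cons (x y : Strand E) (b : List (Strand E)) :
    (capOver x (y :: b) : List (Slice V E)) =
      ⟨[], .cross .virt x y, b ++ [rev x]⟩ :: whiskerWord [y] (capOver x b) [] := by
  simp [capOver, passRight_cons]

/-- An arc enclosing the word `u` is pulled down: its left leg slides virtually past `u`, and the
maximum, now beside `u`, changes height with it. -/
theorem Eqv.capOver_word (x : Strand E) {a b : List (Strand E)} {u : List (Slice V E)}
    (hu : Fits a u b) :
    Eqv (x :: (a ++ [rev x])) b (whiskerWord [x] u [rev x] ++ capOver x b) (capOver x a ++ u) := by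
  have hcap : Fits [x, rev x] ([⟨[], .cap x, []⟩] : List (Slice V E)) [] := by
    simp [Slice.dom, Slice.cod, Piece.dom, Piece.cod]
  have h1 := ((Eqv.vpass_word x hu).symm.whisker [] [rev x]).postpend
    (v := [⟨b, .cap x, []⟩]) (c := b) (by simp [Slice.dom, Slice.cod, Piece.dom, Piece.cod])
  have h2 := Eqv.prepend (u := whiskerWord [] (vpass x a) [rev x]) (a := x :: (a ++ [rev x]))
    (by simpa using (fits_passRight (V := V) .virt x a).whisker [] [rev x])
    (Eqv.interchange hu hcap)
  refine .trans (h1.cast (by simp) rfl (by simp [capOver]) rfl) ?_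
  exact h2.cast rfl (by simp) (by simp) (by simp [capOver])

theorem Eqv.vcross_capOver (x y : Strand E) (b : List (Strand E)) :
    Eqv (y :: x :: (b ++ [rev x])) (y :: b)
      (⟨[], .cross .virt y x, b ++ [rev x]⟩ :: capOver x (y :: b) : List (Slice V E))
      (whiskerWord [y] (capOver x b) []) := by
  have := ((Eqv.vbigon (V := V) y x).whisker [] (b ++ [rev x])).postpend
    (v := whiskerWord [y] (capOver x b) []) (c := y :: b)
    (by simpa using (fits_capOver (V := V) x b).whisker [y] [])
  simpa [capOver_cons] using this

/-- The last strand under the arc can be crossed by either leg of the arc; `slideCap` moves this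
crossing from the left leg to the right one. -/
theorem Eqv.capOver_concat (x y : Strand E) (b : List (Strand E)) :
    Eqv (x :: (b ++ [y, rev x])) (b ++ [y])
      (capOver x (b ++ [y]) : List (Slice V E))
      (⟨x :: b, .cross .virt y (rev x), []⟩ :: whiskerWord [] (capOver x b) [y]) := by
  have hcr : Fits [y, rev x] ([⟨[], .cross .virt y (rev x), []⟩] : List (Slice V E))
      [rev x, y] := by
    simp [Slice.dom, Slice.cod, Piece.dom, Piece.cod]
  have h1 := (Eqv.slideCap (V := V) .virt x y).symm.context
    (whiskerWord [] (vpass x b) [y, rev x]) [] b [] (s := x :: (b ++ [y, rev x]))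
    (t := b ++ [y]) (by simpa using (fits_passRight (V := V) .virt x b).whisker [] [y, rev x])
    (by simp)
  have h2 := (Eqv.interchange (fits_passRight (V := V) .virt x b) hcr).postpend
    (v := [⟨b, .cap x, [y]⟩]) (c := b ++ [y])
    (by simp [Slice.dom, Slice.cod, Piece.dom, Piece.cod])
  refine .trans (h1.cast rfl rfl (by simp [capOver, passRight_append, passRight_cons,
    CrossingType.flip]) rfl) ?_
  exact h2.cast (by simp) rfl (by simp) (by simp [capOver])

theorem Eqv.vcross_capOver_concat (x y : Strand E) (b : List (Strand E)) :
    Eqv (x :: (b ++ [rev x, y])) (b ++ [y])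
      (⟨x :: b, .cross .virt (rev x) y, []⟩ :: capOver x (b ++ [y]) : List (Slice V E))
      (whiskerWord [] (capOver x b) [y]) := by
  have h1 := Eqv.prepend (u := [⟨x :: b, .cross .virt (rev x) y, []⟩])
    (a := x :: (b ++ [rev x, y])) (by simp [Slice.dom, Slice.cod, Piece.dom, Piece.cod])
    (Eqv.capOver_concat (V := V) x y b)
  have h2 := ((Eqv.vbigon (V := V) (rev x) y).whisker (x :: b) []).postpend
    (v := whiskerWord [] (capOver x b) [y]) (c := b ++ [y])
    (by simpa using (fits_capOver (V := V) x b).whisker [] [y])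
  refine .trans (h1.cast rfl rfl (by simp) rfl) ?_
  exact h2.cast (by simp) rfl (by simp) (by simp)

theorem pair_split_cons {α : Type*} {l r L R : List α} {u v x : α}
    (h : l ++ u :: v :: r = L ++ x :: R) :
    (∃ L₂, L = l ++ u :: v :: L₂ ∧ r = L₂ ++ x :: R) ∨
    (L = l ++ [u] ∧ v = x ∧ r = R) ∨
    (l = L ∧ u = x ∧ v :: r = R) ∨
    (∃ l₂, l = L ++ x :: l₂ ∧ R = l₂ ++ u :: v :: r) := by
  rcases List.append_eq_append_iff.1 h with ⟨a, h₁, h₂⟩ | ⟨a, h₁, h₂⟩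
  · rcases a with _ | ⟨a, _ | ⟨b, c⟩⟩ <;> simp_all
  · rcases a with _ | ⟨a, c⟩ <;> simp_all

/-- An adjacent pair `u`, `v` can lie in eight positions relative to two marked entries `x` and `z`.
They are the cases of the induction in `IsVirtual.extract`, where the pair is the bottom of the
lowest piece and the marks are the two ends of the arc. -/
theorem pair_split {α : Type*} {l r L B C : List α} {u v x z : α}
    (h : l ++ u :: v :: r = L ++ x :: (B ++ z :: C)) :
    (∃ L₂, L = l ++ u :: v :: L₂ ∧ r = L₂ ++ x :: (B ++ z :: C)) ∨
    (L = l ++ [u] ∧ v = x ∧ r = B ++ z :: C) ∨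
    (l = L ∧ u = x ∧ B = [] ∧ v = z ∧ r = C) ∨
    (l = L ∧ u = x ∧ ∃ B', B = v :: B' ∧ r = B' ++ z :: C) ∨
    (∃ B₁ B₂, l = L ++ x :: B₁ ∧ B = B₁ ++ u :: v :: B₂ ∧ r = B₂ ++ z :: C) ∨
    (∃ B₁, B = B₁ ++ [u] ∧ v = z ∧ l = L ++ x :: B₁ ∧ r = C) ∨
    (l = L ++ x :: B ∧ u = z ∧ C = v :: r) ∨
    (∃ C₁, l = L ++ x :: (B ++ z :: C₁) ∧ C = C₁ ++ u :: v :: r) := by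
  rcases pair_split_cons h with h | h | ⟨h₁, h₂, h₃⟩ | ⟨l₂, h₁, h₂⟩
  · exact .inl h
  · exact .inr (.inl h)
  · rcases B with _ | ⟨b, B⟩ <;> simp_all
  · rcases pair_split_cons h₂.symm with ⟨a, h₃, h₄⟩ | ⟨h₃, h₄, h₅⟩ | ⟨h₃, h₄, h₅⟩ | ⟨a, h₃, h₄⟩
    · exact .inr (.inr (.inr (.inr (.inl ⟨l₂, a, h₁, h₃, h₄⟩))))
    · exact .inr (.inr (.inr (.inr (.inr (.inl ⟨l₂, h₃, h₄, h₁, h₅⟩)))))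
    · subst h₃
      exact .inr (.inr (.inr (.inr (.inr (.inr (.inl ⟨h₁, h₄, h₅.symm⟩))))))
    · subst h₃
      exact .inr (.inr (.inr (.inr (.inr (.inr (.inr ⟨a, h₁, h₄⟩))))))

/-- A maximum only deletes strands and a crossing only permutes them. -/
theorem nodup_cod {s : Slice V E}
    (h : (∃ x, s.piece = .cap x) ∨ ∃ x y, s.piece = .cross .virt x y) (hd : s.dom.Nodup) :
    s.cod.Nodup := by
  obtain ⟨l, p, r⟩ := s
  rcases h with ⟨x, rfl : p = _⟩ | ⟨x, y, rfl : p = _⟩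
  · refine hd.sublist ?_
    simp [Slice.dom, Slice.cod, Piece.dom, Piece.cod]
  · refine (List.Perm.nodup_iff ?_).1 hd
    simp only [Slice.dom, Slice.cod, Piece.dom, Piece.cod]
    exact ((List.Perm.swap _ _ _).append_left l).append_right r

/-- In a word of local maxima and virtual crossings, the strand starting at `x` and ending at
`rev x` can be shrunk to the bottom. -/
theorem IsVirtual.extract {M : List (Slice V E)} (hM : IsVirtual M) {L B C : List (Strand E)}
    {x : Strand E} (hfit : Fits (L ++ x :: (B ++ rev x :: C)) M [])
    (hnd : (L ++ x :: (B ++ rev x :: C)).Nodup) :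
    ∃ M', IsVirtual M' ∧ Fits (L ++ (B ++ C)) M' [] ∧
      Eqv (L ++ x :: (B ++ rev x :: C)) [] M (whiskerWord L (capOver x B) C ++ M') := by
  induction M generalizing L B C x with
  | nil => simp at hfit
  | cons s M ih =>
    replace ⟨hs, hM⟩ := isVirtual_cons.1 hM
    obtain ⟨hdom, hfit⟩ := hfit
    have hcod := nodup_cod hs (hdom ▸ hnd)
    obtain ⟨l, p, r⟩ := s
    obtain ⟨u, v, hp⟩ : ∃ u v, p.dom = [u, v] := by
      rcases hs with ⟨x, rfl : p = _⟩ | ⟨x, y, rfl : p = _⟩ <;> simp [Piece.dom]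
    simp only [Slice.dom, Slice.cod, hp] at hdom hcod hfit
    have hpf : Fits [u, v] [(⟨[], p, []⟩ : Slice V E)] p.cod := by
      simp [Slice.dom, Slice.cod, hp]
    have hhead : Fits (l ++ [u, v] ++ r) [(⟨l, p, r⟩ : Slice V E)] (l ++ p.cod ++ r) := by
      simp [Slice.dom, Slice.cod, hp]
    rcases pair_split (by simpa using hdom) with
      ⟨L₂, rfl, rfl⟩ | ⟨rfl, rfl, rfl⟩ | ⟨rfl, rfl, rfl, rfl, rfl⟩ | ⟨rfl, rfl, B', rfl, rfl⟩ |
      ⟨B₁, B₂, rfl, rfl, rfl⟩ | ⟨B₁, rfl, rfl, rfl, rfl⟩ | ⟨rfl, rfl, rfl⟩ | ⟨C₁, rfl, rfl⟩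
    · obtain ⟨M', hM', hf', he⟩ := ih hM (L := l ++ p.cod ++ L₂) (B := B) (C := C) (x := x)
        (by simpa using hfit) (by simpa using hcod)
      refine ⟨⟨l, p, L₂ ++ (B ++ C)⟩ :: M', isVirtual_cons.2 ⟨hs, hM'⟩, ?_, ?_⟩
      · exact ⟨by simp [Slice.dom, hp], by simpa [Slice.cod] using hf'⟩
      · have h1 := Eqv.prepend hhead (he.cast (by simp) rfl rfl rfl)
        have h2 := (Eqv.interchange (hpf.whisker l L₂)
          ((fits_capOver (V := V) x B).whisker [] C)).postpend (v := M') (c := [])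
          (by simpa using hf')
        refine .trans (h1.cast (by simp) rfl (by simp) rfl) ?_
        exact h2.cast (by simp) rfl (by simp) (by simp)
    · rcases hs with ⟨y, rfl : p = _⟩ | ⟨y, z, rfl : p = _⟩
      -- A maximum whose right end is `x` has left end `rev x`, which would then occur twice at the
      -- bottom. The other cases where a maximum touches just one of the two marked ends are
      -- excluded in the same way.
      · simp only [Piece.dom, List.cons.injEq] at hp
        obtain ⟨rfl, rfl, -⟩ := hp
        simp [List.nodup_append] at hnd
      · simp only [Piece.dom, List.cons.injEq] at hp
        obtain ⟨rfl, rfl, -⟩ := hp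
        obtain ⟨M', hM', hf', he⟩ := ih hM (L := l) (B := y :: B) (C := C) (x := z)
          (by simpa [Piece.cod] using hfit) (by simpa [Piece.cod] using hcod)
        refine ⟨M', hM', by simpa using hf', ?_⟩
        have h1 := Eqv.prepend hhead (he.cast (by simp [Piece.cod]) rfl rfl rfl)
        have h2 := ((Eqv.vcross_capOver (V := V) z y B).whisker l C).postpend (v := M') (c := [])
          (by simpa using hf')
        refine .trans (h1.cast (by simp) rfl (by simp) rfl) ?_
        exact h2.cast (by simp) rfl (by simp) (by simp)
    · rcases hs with ⟨y, rfl : p = _⟩ | ⟨y, z, rfl : p = _⟩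
      · simp only [Piece.dom, List.cons.injEq] at hp
        obtain ⟨rfl, -, -⟩ := hp
        refine ⟨M, hM, by simpa [Piece.cod] using hfit, ?_⟩
        have := Eqv.refl (V := V) (w := ⟨l, .cap y, r⟩ :: M)
          (a := l ++ y :: ([] ++ rev y :: r)) (b := [])
          ⟨by simp [Slice.dom, Piece.dom], by simpa [Piece.cod, Slice.cod] using hfit⟩
        simpa [capOver] using this
      · simp only [Piece.dom, List.cons.injEq] at hp
        obtain ⟨rfl, rfl, -⟩ := hp
        -- The crossing exchanges the two ends of the arc, so above it `rev y` is the left end. The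
        -- resulting virtual curl is removed by `Eqv.vcross_cap`.
        obtain ⟨M', hM', hf', he⟩ := ih hM (L := l) (B := []) (C := r) (x := rev y)
          (by simpa [Piece.cod] using hfit) (by simpa [Piece.cod] using hcod)
        refine ⟨M', hM', by simpa using hf', ?_⟩
        have h1 := Eqv.prepend hhead (he.cast (by simp [Piece.cod]) rfl rfl rfl)
        have h2 := ((Eqv.vcross_cap (V := V) (rev y)).whisker l r).postpend (v := M') (c := [])
          (by simpa using hf')
        refine .trans (h1.cast (by simp) rfl (by simp) rfl) ?_
        exact h2.cast (by simp) rfl (by simp [capOver]) (by simp [capOver])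
    · rcases hs with ⟨y, rfl : p = _⟩ | ⟨y, z, rfl : p = _⟩
      · simp only [Piece.dom, List.cons.injEq] at hp
        obtain ⟨rfl, rfl, -⟩ := hp
        simp [List.nodup_append] at hnd
      · simp only [Piece.dom, List.cons.injEq] at hp
        obtain ⟨rfl, rfl, -⟩ := hp
        -- Here no move is needed: the crossing is the first crossing of the longer arc.
        obtain ⟨M', hM', hf', he⟩ := ih hM (L := l ++ [z]) (B := B') (C := C) (x := y)
          (by simpa [Piece.cod] using hfit) (by simpa [Piece.cod] using hcod)
        refine ⟨M', hM', by simpa using hf', ?_⟩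
        have h1 := Eqv.prepend hhead (he.cast (by simp [Piece.cod]) rfl rfl rfl)
        exact h1.cast (by simp) rfl (by simp) (by simp [capOver_cons])
    · obtain ⟨M', hM', hf', he⟩ := ih hM (L := L) (B := B₁ ++ p.cod ++ B₂) (C := C) (x := x)
        (by simpa using hfit) (by simpa using hcod)
      refine ⟨⟨L ++ B₁, p, B₂ ++ C⟩ :: M', isVirtual_cons.2 ⟨hs, hM'⟩, ?_, ?_⟩
      · exact ⟨by simp [Slice.dom, hp], by simpa [Slice.cod] using hf'⟩
      · have h1 := Eqv.prepend hhead (he.cast (by simp) rfl rfl rfl)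
        have h2 := ((Eqv.capOver_word x (hpf.whisker B₁ B₂)).whisker L C).postpend
          (v := M') (c := []) (by simpa using hf')
        refine .trans (h1.cast (by simp) rfl (by simp) rfl) ?_
        exact h2.cast (by simp) rfl (by simp) (by simp)
    · rcases hs with ⟨y, rfl : p = _⟩ | ⟨y, z, rfl : p = _⟩
      · simp only [Piece.dom, List.cons.injEq] at hp
        obtain ⟨rfl, h, -⟩ := hp
        obtain rfl : y = x := by simpa using congrArg rev h
        simp [List.nodup_append] at hnd
      · simp only [Piece.dom, List.cons.injEq] at hp
        obtain ⟨rfl, rfl, -⟩ := hp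
        obtain ⟨M', hM', hf', he⟩ := ih hM (L := L) (B := B₁) (C := y :: r) (x := x)
          (by simpa [Piece.cod] using hfit) (by simpa [Piece.cod] using hcod)
        refine ⟨M', hM', by simpa using hf', ?_⟩
        have h1 := Eqv.prepend hhead (he.cast (by simp [Piece.cod]) rfl rfl rfl)
        have h2 := ((Eqv.capOver_concat (V := V) x y B₁).symm.whisker L r).postpend
          (v := M') (c := []) (by simpa using hf')
        refine .trans (h1.cast (by simp) rfl (by simp) rfl) ?_
        exact h2.cast (by simp) rfl (by simp) (by simp)
    · rcases hs with ⟨y, rfl : p = _⟩ | ⟨y, z, rfl : p = _⟩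
      · simp only [Piece.dom, List.cons.injEq] at hp
        obtain ⟨rfl, rfl, -⟩ := hp
        simp [List.nodup_append] at hnd
      · simp only [Piece.dom, List.cons.injEq] at hp
        obtain ⟨rfl, rfl, -⟩ := hp
        obtain ⟨M', hM', hf', he⟩ := ih hM (L := L) (B := B ++ [z]) (C := r) (x := x)
          (by simpa [Piece.cod] using hfit) (by simpa [Piece.cod] using hcod)
        refine ⟨M', hM', by simpa using hf', ?_⟩
        have h1 := Eqv.prepend hhead (he.cast (by simp [Piece.cod]) rfl rfl rfl)
        have h2 := ((Eqv.vcross_capOver_concat (V := V) x z B).whisker L r).postpend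
          (v := M') (c := []) (by simpa using hf')
        refine .trans (h1.cast (by simp) rfl (by simp) rfl) ?_
        exact h2.cast (by simp) rfl (by simp) (by simp)
    · obtain ⟨M', hM', hf', he⟩ := ih hM (L := L) (B := B) (C := C₁ ++ p.cod ++ r) (x := x)
        (by simpa using hfit) (by simpa using hcod)
      refine ⟨⟨L ++ B ++ C₁, p, r⟩ :: M', isVirtual_cons.2 ⟨hs, hM'⟩, ?_, ?_⟩
      · exact ⟨by simp [Slice.dom, hp], by simpa [Slice.cod] using hf'⟩
      · have h1 := Eqv.prepend hhead (he.cast (by simp) rfl rfl rfl)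
        have h2 := (Eqv.interchange ((fits_capOver (V := V) x B).whisker L [])
          (hpf.whisker C₁ r)).symm.postpend (v := M') (c := []) (by simpa using hf')
        refine .trans (h1.cast (by simp) rfl (by simp) rfl) ?_
        exact h2.cast (by simp) rfl (by simp) (by simp)

/-- A strand can only end in a maximum, and a maximum joins `x` to `rev x`; crossings do not change
the set of strands. -/
theorem IsVirtual.rev_mem {M : List (Slice V E)} (hM : IsVirtual M) {a : List (Strand E)}
    (hfit : Fits a M []) {x : Strand E} (hx : x ∈ a) : rev x ∈ a := by
  induction M generalizing a with
  | nil =>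
    simp only [fits_nil] at hfit
    simp [hfit] at hx
  | cons s M ih =>
    replace ⟨hs, hM⟩ := isVirtual_cons.1 hM
    obtain ⟨rfl, hfit⟩ := hfit
    obtain ⟨l, p, r⟩ := s
    have := ih hM hfit
    rcases hs with ⟨y, rfl : p = _⟩ | ⟨y, z, rfl : p = _⟩
    · simp only [Slice.dom, Slice.cod, Piece.dom, Piece.cod, List.append_nil, List.mem_append,
        List.mem_cons, List.not_mem_nil, or_false] at *
      rcases hx with (hx | rfl | rfl) | hx <;> (try simp only [rev_rev]) <;> tauto
    · simp only [Slice.dom, Slice.cod, Piece.dom, Piece.cod, List.mem_append,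
        List.mem_cons, List.not_mem_nil, or_false] at *
      tauto

/-- Two words of local maxima and virtual crossings which close off the same list of distinct
strands are equivalent. -/
theorem IsVirtual.coherence {M N : List (Slice V E)} (hM : IsVirtual M) (hN : IsVirtual N)
    {a : List (Strand E)} (hnd : a.Nodup) (hfM : Fits a M []) (hfN : Fits a N []) :
    Eqv a [] M N := by
  induction h : a.length using Nat.strong_induction_on generalizing a M N with
  | _ n ih =>
  rcases a with _ | ⟨x, a⟩
  -- Maxima and virtual crossings have two strands at their bottom, so none fits above an empty
  -- line.
  · have key : ∀ {K : List (Slice V E)}, IsVirtual K → Fits [] K [] → K = [] := by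
      intro K hK hf
      rcases K with _ | ⟨⟨l, p, r⟩, K⟩
      · rfl
      · obtain ⟨⟨y, rfl : p = _⟩ | ⟨y, z, rfl : p = _⟩, -⟩ := isVirtual_cons.1 hK <;>
          simp [Slice.dom, Piece.dom] at hf
    rw [key hM hfM, key hN hfN]
    exact .refl (by simp)
  · have hx : rev x ∈ a := by
      have := hM.rev_mem hfM (List.mem_cons_self (a := x))
      simpa [rev_ne] using this
    obtain ⟨B, C, rfl⟩ := List.append_of_mem hx
    -- Since labels are distinct, both words join `x` to the same `rev x`. Hence the same arc splits
    -- off from both at the bottom, and two strands fewer are left to close.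
    obtain ⟨M', hM', hfM', heM⟩ := hM.extract (L := []) hfM hnd
    obtain ⟨N', hN', hfN', heN⟩ := hN.extract (L := []) hfN hnd
    refine heM.trans (.trans ?_ heN.symm)
    refine .prepend (by simpa using (fits_capOver (V := V) x B).whisker [] C)
      (ih (B ++ C).length ?_ hM' hN' ?_ hfM' hfN' rfl)
    · rw [← h]
      simp
    · refine hnd.sublist ?_
      exact (((List.sublist_cons_self (rev x) C)).append_left B).cons x

/-! ### Nodes -/

/-- The pieces of a diagram at which strands end or change their name: vertices, classical
crossings, and local minima. -/
inductive Kind (V : Type*)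
  | vert (v : V)
  | crs (t : CrossingType)
  | cup

/-- A node drawn with all its strands at the top. -/
def Kind.word : Kind V → List (Strand E) → List (Slice V E)
  | vert v, os => [⟨[], .vertex v [] os, []⟩]
  | crs t, [a, b, c, d] => [⟨[], .cup a, []⟩, ⟨[a], .cup b, [c]⟩, ⟨[a, b], .cross t d c, []⟩]
  | cup, [a, _] => [⟨[], .cup a, []⟩]
  | _, _ => []

/-- The strands `os` may leave a node of kind `k`. -/
def Kind.Admits : Kind V → List (Strand E) → Prop
  | vert _, _ => True
  | crs t, os => t ≠ .virt ∧ ∃ x y, os = [rev y, rev x, y, x]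
  | cup, os => ∃ x, os = [x, rev x]

theorem Kind.Admits.fits {k : Kind V} {os : List (Strand E)} (h : k.Admits os) :
    Fits [] (k.word os) os := by
  cases k with
  | vert v => simp [Kind.word, Slice.dom, Slice.cod, Piece.dom, Piece.cod]
  | crs t =>
    obtain ⟨-, x, y, rfl⟩ := h
    simp [Kind.word, Slice.dom, Slice.cod, Piece.dom, Piece.cod]
  | cup =>
    obtain ⟨x, rfl⟩ := h
    simp [Kind.word, Slice.dom, Slice.cod, Piece.dom, Piece.cod]

/-- The kind of a piece, if it is a node. -/
inductive Piece.HasKind : Piece V E → Kind V → Prop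
  | vertex (v : V) (below above : List (Strand E)) : HasKind (.vertex v below above) (.vert v)
  | cross (t : CrossingType) (x y : Strand E) (ht : t ≠ .virt) : HasKind (.cross t x y) (.crs t)
  | cup (x : Strand E) : HasKind (.cup x) .cup

/-- Each minimum attached to the left of the vertex is an edge bent down, and `bendLeft` read
backwards absorbs it. -/
theorem Eqv.bent_vertex (v : V) (below above : List (Strand E)) :
    Eqv [] (Piece.vertex v below above).ports (Piece.vertex v below above).bent
      [⟨[], .vertex v [] (Piece.vertex v below above).ports, []⟩] := by
  induction below generalizing above with
  | nil => exact .refl (Piece.fits_bent _)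
  | cons z zs ih =>
    have h1 := (Eqv.of_rule (a := zs) (b := rev z :: above)
      (.inl (.bendLeft v zs above (rev z)))
      (by simp [Slice.dom, Slice.cod, Piece.dom, Piece.cod])
      (by simp [Slice.dom, Slice.cod, Piece.dom, Piece.cod])).symm
    have h2 := Eqv.prepend (fits_cups (V := V) zs)
      ((h1.whisker (zs.map rev).reverse []).cast (by simp) rfl rfl rfl)
    refine .trans (h2.cast rfl (by simp [Piece.ports, Piece.dom, Piece.cod])
      (by simp [Piece.bent, Piece.dom, cups]) rfl) ?_
    exact (ih (rev z :: above)).cast rfl (by simp [Piece.ports, Piece.dom, Piece.cod])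
      (by simp [Piece.bent, Piece.dom]) (by simp [Piece.ports, Piece.dom, Piece.cod])

theorem Piece.HasKind.admits {p : Piece V E} {k : Kind V} (h : p.HasKind k) :
    k.Admits p.ports := by
  cases h with
  | vertex v below above => trivial
  | cross t x y ht => exact ⟨ht, x, y, by simp [Piece.ports, Piece.dom, Piece.cod]⟩
  | cup x => exact ⟨x, by simp [Piece.ports, Piece.dom, Piece.cod]⟩

theorem Piece.HasKind.eqv {p : Piece V E} {k : Kind V} (h : p.HasKind k) :
    Eqv [] p.ports p.bent (k.word p.ports) := by
  cases h with
  | vertex v below above => exact .bent_vertex v below above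
  | cross t x y ht =>
    refine .cast (.refl (Piece.fits_bent _)) rfl rfl rfl ?_
    simp [Piece.bent, Piece.ports, Piece.dom, Piece.cod, cups, Kind.word]
  | cup x =>
    refine .cast (.refl (Piece.fits_bent _)) rfl rfl rfl ?_
    simp [Piece.bent, Piece.ports, Piece.dom, Piece.cod, cups, Kind.word]

/-- Bend the leftmost edge `z` down, so that its free leg crosses the remaining edges above the
vertex; slide this leg to below the vertex, where it only makes a virtual curl with the bent edge.
Removing the curl and unbending on the right puts `z` last. One edge thus travels around all the
others, so the forbidden virtual exchange of two neighbouring edges does not occur. -/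
theorem Eqv.rotate_vertex (v : V) (z : Strand E) (zs : List (Strand E)) :
    Eqv [] (zs ++ [z]) (⟨[], .vertex v [] (z :: zs), []⟩ :: vpass z zs)
      [⟨[], .vertex v [] (zs ++ [z]), []⟩] := by
  have h1 := (Eqv.of_rule (a := []) (b := z :: zs) (.inl (.bendLeft v [] zs z))
    (by simp [Slice.dom, Slice.cod, Piece.dom, Piece.cod])
    (by simp [Slice.dom, Slice.cod, Piece.dom, Piece.cod])).postpend
    (fits_passRight (V := V) .virt z zs)
  have h2 := Eqv.prepend (u := [⟨[], .cup z, []⟩]) (a := [])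
    (by simp [Slice.dom, Slice.cod, Piece.dom, Piece.cod])
    (Eqv.vpass_piece z (.vertex v [rev z] zs)).symm
  have h3 := (Eqv.cup_vcross (V := V) z).postpend (v := [⟨[], .vertex v [rev z] zs, [z]⟩])
    (c := zs ++ [z]) (by simp [Slice.dom, Slice.cod, Piece.dom, Piece.cod])
  have h4 := (Eqv.of_rule (a := []) (b := zs ++ [z]) (.inl (.bendRight v [] zs z))
    (by simp [Slice.dom, Slice.cod, Piece.dom, Piece.cod])
    (by simp [Slice.dom, Slice.cod, Piece.dom, Piece.cod])).symm
  refine .trans (h1.cast rfl rfl (by simp) rfl) ?_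
  refine .trans (h2.cast rfl rfl (by simp [Piece.cod]) rfl) ?_
  refine .trans (h3.cast rfl rfl (by simp [Piece.dom, passRight_cons]) rfl) ?_
  exact h4.cast rfl rfl (by simp) rfl

/-- As for a vertex, the leftmost end slides back below the crossing and leaves a virtual curl that
is removed. The quarter turn interchanges the two diagonals, so the type is flipped; this happens
when the classical crossing slides through a minimum, which is a planar isotopy. -/
theorem Eqv.rotate_crossing (t : CrossingType) (x y : Strand E) :
    Eqv [] [rev x, y, x, rev y]
      ((Kind.crs t : Kind V).word [rev y, rev x, y, x] ++ vpass (rev y) [rev x, y, x])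
      ((Kind.crs t.flip : Kind V).word [rev x, y, x, rev y]) := by
  set u : List (Slice V E) := [⟨[], .cup (rev x), [y]⟩, ⟨[rev x], .cross t x y, []⟩] with hu
  have hfit : Fits [y] u [rev x, y, x] := by
    simp [hu, Slice.dom, Slice.cod, Piece.dom, Piece.cod]
  have h1 := Eqv.prepend (u := [⟨[], .cup (rev y), []⟩]) (a := [])
    (by simp [Slice.dom, Slice.cod, Piece.dom, Piece.cod]) (Eqv.vpass_word (rev y) hfit).symm
  have h2 := (Eqv.cup_vcross (V := V) (rev y)).postpend (v := whiskerWord [] u [rev y])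
    (c := [rev x, y, x, rev y]) (by simpa using hfit.whisker [] [rev y])
  have h3 := (Eqv.interchange_piece (V := V) (.cup (rev x)) (.cup y) []).symm.postpend
    (v := [⟨[rev x], .cross t x y, [rev y]⟩]) (c := [rev x, y, x, rev y])
    (by simp [Slice.dom, Slice.cod, Piece.dom, Piece.cod])
  have h4 := Eqv.prepend (u := [⟨[], .cup (rev x), []⟩]) (a := [])
    (by simp [Slice.dom, Slice.cod, Piece.dom, Piece.cod])
    ((Eqv.slideCup (V := V) t.flip y x).symm.whisker [rev x] [])
  refine .trans (h1.cast rfl rfl (by simp [Kind.word, hu]) rfl) ?_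
  refine .trans (h2.cast rfl rfl (by simp [passRight_cons]) rfl) ?_
  refine .trans (h3.cast rfl rfl (by simp [hu, Piece.dom, Piece.cod]) rfl) ?_
  exact h4.cast rfl rfl (by simp [Piece.dom, Piece.cod]) (by simp [Kind.word])

/-! ### Lists of nodes with labelled strands -/

/-- A node with the name `idx` and labelled strands. -/
structure Node (V E : Type*) where
  idx : ℕ
  kind : Kind V
  outs : List (Strand (E × ℕ))

/-- Forget the numerical part of a label. -/
abbrev proj (x : Strand (E × ℕ)) : Strand E := mapStrand Prod.fst x

/-- All strands leaving the nodes of a list. -/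
def ports (ns : List (Node V E)) : List (Strand (E × ℕ)) := ns.flatMap Node.outs

@[simp] theorem ports_nil : ports ([] : List (Node V E)) = [] := rfl

@[simp] theorem ports_cons (n : Node V E) (ns : List (Node V E)) :
    ports (n :: ns) = n.outs ++ ports ns := rfl

@[simp] theorem ports_append (ns ms : List (Node V E)) :
    ports (ns ++ ms) = ports ns ++ ports ms := by
  simp [ports]

def Node.Admissible (n : Node V E) : Prop := n.kind.Admits (n.outs.map proj)

/-- The nodes of a list drawn side by side. -/
def nodesWord : List (Node V E) → List (Slice V E)
  | [] => []
  | n :: ns => n.kind.word (n.outs.map proj) ++ whiskerWord (n.outs.map proj) (nodesWord ns) []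

theorem fits_nodesWord {ns : List (Node V E)} (h : ∀ n ∈ ns, n.Admissible) :
    Fits [] (nodesWord ns) ((ports ns).map proj) := by
  induction ns with
  | nil => simp [nodesWord]
  | cons n ns ih =>
    simp only [List.mem_cons, forall_eq_or_imp] at h
    refine (Kind.Admits.fits h.1).append ?_
    simpa using (ih h.2).whisker (n.outs.map proj) []

theorem nodesWord_append (ns ms : List (Node V E)) :
    nodesWord (ns ++ ms) = nodesWord ns ++ whiskerWord ((ports ns).map proj) (nodesWord ms) [] := by
  induction ns with
  | nil => simp [nodesWord]
  | cons n ns ih => simp [nodesWord, ih]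

/-- The picture `w` is obtained from the nodes `ns` by connecting equal labels by virtual strands. -/
def NormalForm (ns : List (Node V E)) (w : List (Slice V E)) : Prop :=
  ∃ M : List (Slice V (E × ℕ)), IsVirtual M ∧ Fits (ports ns) M [] ∧
    Eqv [] [] w (nodesWord ns ++ mapWord Prod.fst M)

/-- Coherence applies to the labelled closing words, where the ends are distinct; the resulting
equivalence is then projected to edges. -/
theorem NormalForm.eqv {ns : List (Node V E)} {w w' : List (Slice V E)}
    (hnd : (ports ns).Nodup) (hw : NormalForm ns w) (hw' : NormalForm ns w')
    (hns : ∀ n ∈ ns, n.Admissible) : Eqv [] [] w w' := by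
  obtain ⟨M, hM, hf, he⟩ := hw
  obtain ⟨M', hM', hf', he'⟩ := hw'
  refine he.trans (.trans ?_ he'.symm)
  exact .prepend (fits_nodesWord hns) ((hM.coherence hM' hnd hf hf').map Prod.fst)

/-- The nodes `ns` can be drawn as the nodes `ms` followed by virtual crossings. -/
def Converts (ns ms : List (Node V E)) : Prop :=
  ∃ P : List (Slice V (E × ℕ)), IsVirtual P ∧ Fits (ports ms) P (ports ns) ∧
    Eqv [] ((ports ns).map proj) (nodesWord ns) (nodesWord ms ++ mapWord Prod.fst P)

/-- The virtual word produced by the conversion becomes the lower part of the closing word. So nodes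
may be reordered and rotated without control over the crossings this creates. -/
theorem NormalForm.converts {ns ms : List (Node V E)} {w : List (Slice V E)}
    (hw : NormalForm ns w) (h : Converts ns ms) : NormalForm ms w := by
  obtain ⟨M, hM, hf, he⟩ := hw
  obtain ⟨P, hP, hfP, heP⟩ := h
  refine ⟨P ++ M, by simp [hP, hM], hfP.append hf, he.trans ?_⟩
  simpa [mapWord] using heP.postpend (hf.map Prod.fst)

theorem Converts.refl {ns : List (Node V E)} (h : ∀ n ∈ ns, n.Admissible) : Converts ns ns :=
  ⟨[], by simp, by simp, by simpa [mapWord] using Eqv.refl (fits_nodesWord h)⟩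

theorem Converts.trans {ns ms ks : List (Node V E)} (h₁ : Converts ns ms) (h₂ : Converts ms ks) :
    Converts ns ks := by
  obtain ⟨P, hP, hfP, heP⟩ := h₁
  obtain ⟨Q, hQ, hfQ, heQ⟩ := h₂
  refine ⟨Q ++ P, by simp [hP, hQ], hfQ.append hfP, heP.trans ?_⟩
  simpa [mapWord] using heQ.postpend (hfP.map Prod.fst)

/-- Each list is converted on its own; the crossings above the first list then change height with
the new nodes of the second, so that all nodes are below all crossings again. -/
theorem Converts.append {ns ms ns' ms' : List (Node V E)} (h : Converts ns ms)
    (h' : Converts ns' ms') (hms : ∀ n ∈ ms, n.Admissible) (hms' : ∀ n ∈ ms', n.Admissible) :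
    Converts (ns ++ ns') (ms ++ ms') := by
  obtain ⟨P, hP, hfP, heP⟩ := h
  obtain ⟨Q, hQ, hfQ, heQ⟩ := h'
  refine ⟨whiskerWord [] P (ports ms') ++ whiskerWord (ports ns) Q [], by simp [hP, hQ], ?_, ?_⟩
  · simpa using (hfP.whisker [] (ports ms')).append (by simpa using hfQ.whisker (ports ns) [])
  · have h1 := heP.append ((heQ.whisker ((ports ns).map proj) []).cast (by simp) rfl rfl rfl)
    have h2 := (Eqv.interchange (hfP.map Prod.fst) (fits_nodesWord hms')).context
      (nodesWord ms) (whiskerWord ((ports ns).map proj) (mapWord Prod.fst Q) []) [] []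
      (s := []) (t := (ports (ns ++ ns')).map proj)
      (by simpa using fits_nodesWord hms)
      (by simpa using (hfQ.map Prod.fst).whisker ((ports ns).map proj) [])
    refine .trans (h1.cast rfl (by simp) (by simp [nodesWord_append]) rfl) ?_
    refine h2.cast rfl rfl (by simp) ?_
    have e1 := mapWord_whiskerWord (V := V) (Prod.fst : E × ℕ → E) [] (ports ms') P
    have e2 := mapWord_whiskerWord (V := V) (Prod.fst : E × ℕ → E) (ports ns) [] Q
    simp only [mapWord] at e1 e2
    simp [nodesWord_append, mapWord, e1, e2]

/-- Nothing enters a node from below, so it can be carried as a whole across the strands of its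
neighbour at the price of virtual crossings. -/
theorem Converts.swap {n m : Node V E} (hn : n.Admissible) (hm : m.Admissible) :
    Converts [n, m] [m, n] := by
  refine ⟨passBlock m.outs n.outs, by simp,
    by simpa using fits_passBlock (V := V) m.outs n.outs, ?_⟩
  have h1 := Eqv.prepend hm.fits
    ((Eqv.passBlock_closed (m.outs.map proj) hn.fits))
  have h2 := Eqv.interchange hn.fits hm.fits
  refine .symm (.trans (h1.cast rfl (by simp) (by
    rw [mapWord_passBlock]; simp [nodesWord]) rfl) ?_)
  exact (h2.symm.cast (by simp) (by simp) (by simp) (by simp [nodesWord]))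

theorem Converts.of_perm {ns ms : List (Node V E)} (h : ns.Perm ms)
    (hns : ∀ n ∈ ns, n.Admissible) : Converts ns ms := by
  induction h with
  | nil => exact .refl hns
  | @cons n ns ms hp ih =>
    have h1 : Converts [n] [n] := .refl (by simpa using hns n (by simp))
    exact h1.append (ih fun m hm => hns m (by simp [hm]))
      (by simpa using hns n (by simp)) (fun m hm => hns m (by simp [hp.mem_iff.2 hm]))
  | @swap n m ns =>
    have h1 : Converts [m, n] [n, m] := .swap (hns m (by simp)) (hns n (by simp))
    have h2 : Converts ns ns := .refl fun k hk => hns k (by simp [hk])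
    exact h1.append h2 (fun k hk => hns k (by simp at hk ⊢; tauto))
      (fun k hk => hns k (by simp [hk]))
  | trans hp _ ih₁ ih₂ =>
    exact (ih₁ hns).trans (ih₂ fun m hm => hns m (hp.mem_iff.2 hm))

theorem Converts.of_forall₂ {ns ms : List (Node V E)}
    (h : List.Forall₂ (fun n m => Converts [n] [m] ∧ m.Admissible) ns ms) : Converts ns ms := by
  induction h with
  | nil => exact .refl (by simp)
  | @cons n m ns ms hnm h ih =>
    refine hnm.1.append ih (by simpa using hnm.2) ?_
    intro k hk
    obtain ⟨i, hi, rfl⟩ := List.getElem_of_mem hk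
    exact (h.get (by simpa [h.length_eq] using hi) hi).2

theorem Converts.rotate_vertex {k k' : ℕ} (v : V) (z : Strand (E × ℕ))
    (zs : List (Strand (E × ℕ))) :
    Converts [(⟨k, .vert v, zs ++ [z]⟩ : Node V E)] [⟨k', .vert v, z :: zs⟩] := by
  refine ⟨vpass z zs, by simp, by simpa using fits_passRight (V := V) .virt z zs, ?_⟩
  have := (Eqv.rotate_vertex v (proj z) (zs.map proj)).symm
  refine this.cast rfl (by simp) (by simp [nodesWord, Kind.word]) ?_
  rw [mapWord_passRight]
  simp [nodesWord, Kind.word]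

theorem Converts.rotate_crossing {k k' : ℕ} {t : CrossingType} {a b c d : Strand (E × ℕ)}
    (h : (⟨k, .crs t, [a, b, c, d]⟩ : Node V E).Admissible) :
    Converts [(⟨k', .crs t.flip, [b, c, d, a]⟩ : Node V E)] [⟨k, .crs t, [a, b, c, d]⟩] := by
  refine ⟨vpass a [b, c, d], by simp, by simpa using fits_passRight (V := V) .virt a [b, c, d], ?_⟩
  obtain ⟨-, x, y, h⟩ := h
  simp only [List.map_cons, List.map_nil, List.cons.injEq, and_true] at h
  obtain ⟨ha, hb, hc, hd⟩ := h
  have := (Eqv.rotate_crossing (V := V) t x y).symm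
  refine this.cast rfl (by simp [ha, hb, hc, hd]) (by simp [nodesWord, ha, hb, hc, hd]) ?_
  rw [mapWord_passRight]
  simp [nodesWord, ha, hb, hc, hd]

/-! ### Labelling the strands of a picture -/

/-- `PieceLift k p d c o`: the strands of the `k`-th piece `p` are labelled by `d` at the bottom
and `c` at the top, labels change only at nodes, and `o` is the corresponding labelled node. -/
inductive PieceLift (k : ℕ) : Piece V E → List (Strand (E × ℕ)) → List (Strand (E × ℕ)) →
    Option (Node V E) → Prop
  | cap (x) : PieceLift k (.cap (proj x)) [x, rev x] [] none
  | virt (x y) : PieceLift k (.cross .virt (proj x) (proj y)) [x, y] [y, x] none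
  | node {p κ d c} : p.HasKind κ → d.map proj = p.dom → c.map proj = p.cod →
      PieceLift k p d c (some ⟨k, κ, (d.map rev).reverse ++ c⟩)

/-- A labelling of the strands of a word that starts with the `k`-th slice. -/
inductive Lift : ℕ → List (Strand (E × ℕ)) → List (Slice V E) → List (Node V E) → Prop
  | nil (k) : Lift k [] [] []
  | cons {k l r p d c o w ns} : PieceLift k p d c o → Lift (k + 1) (l ++ c ++ r) w ns →
      Lift k (l ++ d ++ r) (⟨l.map proj, p, r.map proj⟩ :: w) (o.toList ++ ns)

theorem PieceLift.map_eq {k : ℕ} {p : Piece V E} {d c : List (Strand (E × ℕ))}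
    {o : Option (Node V E)} (h : PieceLift k p d c o) :
    d.map proj = p.dom ∧ c.map proj = p.cod := by
  cases h with
  | cap x => simp [Piece.dom, Piece.cod]
  | virt x y => simp [Piece.dom, Piece.cod]
  | node _ h₁ h₂ => exact ⟨h₁, h₂⟩

/-- Distinctness is required of the labels without their directions, since both `x` and `rev x` will
appear for every new strand. -/
theorem exists_fresh (a : List (Strand E)) (N : ℕ) :
    ∃ d : List (Strand (E × ℕ)), d.map proj = a ∧ (d.map Prod.fst).Nodup ∧
      ∀ x ∈ d, N ≤ x.1.2 := by
  induction a generalizing N with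
  | nil => exact ⟨[], by simp⟩
  | cons x a ih =>
    obtain ⟨d, h₁, h₂, h₃⟩ := ih (N + 1)
    refine ⟨((x.1, N), x.2) :: d, by simp [h₁, mapStrand], ?_, ?_⟩
    · simp only [List.map_cons, List.nodup_cons, h₂, and_true, List.mem_map, not_exists, not_and]
      intro y hy h
      have := h₃ y hy
      rw [h] at this
      simp at this
    · simp only [List.mem_cons, forall_eq_or_imp, le_refl, true_and]
      exact fun y hy => (Nat.le_succ N).trans (h₃ y hy)

theorem exists_label_bound (a : List (Strand (E × ℕ))) : ∃ N, ∀ x ∈ a, x.1.2 < N := by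
  induction a with
  | nil => exact ⟨0, by simp⟩
  | cons x a ih =>
    obtain ⟨N, hN⟩ := ih
    refine ⟨max N (x.1.2 + 1), ?_⟩
    simp only [List.mem_cons, forall_eq_or_imp]
    exact ⟨by omega, fun y hy => lt_of_lt_of_le (hN y hy) (le_max_left _ _)⟩

theorem nodup_append_fresh {d a : List (Strand (E × ℕ))} {N : ℕ} (hd : (d.map Prod.fst).Nodup)
    (hN : ∀ x ∈ d, N ≤ x.1.2) (ha : ∀ x ∈ a, x.1.2 < N) (hnd : a.Nodup) :
    (d ++ d.map rev ++ a).Nodup := by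
  have hinj : ∀ x ∈ d, ∀ y ∈ d, x.1 = y.1 → x = y := fun x hx y hy h =>
    List.inj_on_of_nodup_map hd hx hy h
  have hd' : d.Nodup := List.Nodup.of_map _ hd
  refine List.Nodup.append (List.Nodup.append hd' (hd'.map ?_) ?_) hnd ?_
  · intro x y h
    simpa using congrArg rev h
  · intro x hx hx'
    obtain ⟨y, hy, rfl⟩ := List.mem_map.1 hx'
    exact rev_ne y (hinj _ hx _ hy rfl)
  · intro x hx hx'
    have h1 := ha x hx'
    rcases List.mem_append.1 hx with hx | hx
    · exact absurd (hN x hx) (by omega)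
    · obtain ⟨y, hy, rfl⟩ := List.mem_map.1 hx
      exact absurd (hN y hy) (by simpa [rev] using h1)

/-- Labels are chosen from the top downwards: virtual crossings transport them, a maximum gets a new
one, and the bottom strands of a node get new ones. The invariant is that the strands at the current
level and the ends of the nodes above it are all distinct; a node turns its top strands into ends
and adds each new label in both directions. -/
theorem exists_lift {b : List (Strand E)} {w : List (Slice V E)} (h : Fits b w []) (k : ℕ) :
    ∃ b' ns, b'.map proj = b ∧ Lift k b' w ns ∧ (b' ++ ports ns).Nodup := by
  classical
  induction w generalizing b k with
  | nil =>
    simp only [fits_nil] at h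
    exact ⟨[], [], by simp [h], .nil k, by simp⟩
  | cons s w ih =>
    obtain ⟨rfl, h⟩ := h
    obtain ⟨b', ns, hb', hl, hnd⟩ := ih h (k + 1)
    obtain ⟨l, p, r⟩ := s
    obtain ⟨b₁, r', rfl, hb₁, rfl⟩ := List.map_eq_append_iff.1 hb'
    obtain ⟨l', c, rfl, rfl, hc⟩ := List.map_eq_append_iff.1 hb₁
    obtain ⟨N, hN⟩ := exists_label_bound (l' ++ c ++ r' ++ ports ns)
    have hnode : ∀ κ, p.HasKind κ → ∃ b' ns, b'.map proj = l'.map proj ++ p.dom ++ r'.map proj ∧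
        Lift k b' (⟨l'.map proj, p, r'.map proj⟩ :: w) ns ∧ (b' ++ ports ns).Nodup := by
      intro κ hκ
      obtain ⟨d, hd₁, hd₂, hd₃⟩ := exists_fresh p.dom N
      refine ⟨_, _, ?_, .cons (l := l') (r := r') (.node hκ hd₁ hc) hl, ?_⟩
      · simp [hd₁]
      · refine (List.Perm.nodup_iff ?_).1 (nodup_append_fresh hd₂ hd₃ hN hnd)
        rw [List.perm_iff_count]
        intro x
        simp
        omega
    cases p with
    | cup x => exact hnode _ (.cup x)
    | vertex v below above => exact hnode _ (.vertex v below above)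
    | cap x =>
      obtain rfl : c = [] := by simpa [Piece.cod] using hc
      have hx := nodup_append_fresh (d := [((x.1, N), x.2)]) (by simp) (by simp) hN hnd
      refine ⟨_, _, ?_, .cons (l := l') (r := r') (.cap ((x.1, N), x.2)) hl, ?_⟩
      · simp [Slice.dom, Piece.dom, mapStrand]
      · refine (List.Perm.nodup_iff ?_).1 hx
        rw [List.perm_iff_count]
        intro x
        simp [List.count_cons]
        omega
    | cross t x y =>
      by_cases ht : t = .virt
      · subst ht
        obtain ⟨y', c, rfl, rfl, hc₁⟩ := List.map_eq_cons_iff.1 hc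
        obtain ⟨x', c, rfl, rfl, hc₂⟩ := List.map_eq_cons_iff.1 hc₁
        obtain rfl : c = [] := by simpa using hc₂
        refine ⟨_, _, ?_, .cons (l := l') (r := r') (.virt x' y') hl, ?_⟩
        · simp [Slice.dom, Piece.dom]
        · refine (List.Perm.nodup_iff ?_).1 hnd
          rw [List.perm_iff_count]
          intro x
          simp [List.count_cons]
          omega
      · exact hnode _ (.cross t x y ht)

theorem PieceLift.admissible {k : ℕ} {p : Piece V E} {d c : List (Strand (E × ℕ))}
    {n : Node V E} (h : PieceLift k p d c (some n)) : n.Admissible := by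
  cases h with
  | node h₁ h₂ h₃ =>
    have := h₁.admits
    simp only [Node.Admissible]
    rw [List.map_append, h₃, List.map_reverse, List.map_map]
    rw [Piece.ports, ← h₂, List.map_map] at this
    exact this

theorem Lift.admissible {k : ℕ} {b : List (Strand (E × ℕ))} {w : List (Slice V E)}
    {ns : List (Node V E)} (h : Lift k b w ns) : ∀ n ∈ ns, n.Admissible := by
  induction h with
  | nil => simp
  | @cons k l r p d c o w ns hp _ ih =>
    intro n hn
    rcases List.mem_append.1 hn with hn | hn
    · obtain rfl : o = some n := by simpa using hn
      exact hp.admissible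
    · exact ih n hn

/-- The node is created to the right of all strands, its ends are brought across `r` virtually, and
maxima join the bent-up ends to the strands `p.dom` that arrive from below. -/
theorem Eqv.slice_node {p : Piece V E} {κ : Kind V} (h : p.HasKind κ) (l r : List (Strand E)) :
    Eqv (l ++ p.dom ++ r) (l ++ p.cod ++ r)
      (whiskerWord (l ++ p.dom ++ r) (κ.word p.ports) [] ++
        (whiskerWord (l ++ p.dom) (passBlock r p.ports) [] ++
          whiskerWord l (caps p.dom) (p.cod ++ r)))
      [⟨l, p, r⟩] := by
  have hq : Fits (l ++ p.dom ++ p.ports ++ r)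
      (whiskerWord l (caps p.dom : List (Slice V E)) (p.cod ++ r)) (l ++ p.cod ++ r) := by
    simpa [Piece.ports] using (fits_caps (V := V) p.dom).whisker l (p.cod ++ r)
  have h1 := ((Eqv.passBlock_closed r h.admits.fits).whisker (l ++ p.dom) []).postpend
    (v := whiskerWord l (caps p.dom) (p.cod ++ r)) (c := l ++ p.cod ++ r)
    (by simpa using hq)
  have h2 := (h.eqv.symm.whisker (l ++ p.dom) r).postpend hq
  have h3 := (Eqv.bent_caps p).whisker l r
  refine .trans (h1.cast (by simp) (by simp) (by simp) rfl) ?_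
  refine .trans (h2.cast (by simp) (by simp) (by simp) rfl) ?_
  exact h3.cast (by simp) (by simp) (by simp) (by simp)

/-- Induction from the top. The nodes above the current slice lie to the right of its strands and
can be lowered past it by interchange; a node in the slice is first expelled to the right by
`Eqv.slice_node`. -/
theorem Lift.normalForm_aux {k : ℕ} {b : List (Strand (E × ℕ))} {w : List (Slice V E)}
    {ns : List (Node V E)} (h : Lift k b w ns) :
    ∃ M : List (Slice V (E × ℕ)), IsVirtual M ∧ Fits (b ++ ports ns) M [] ∧
      Eqv (b.map proj) [] w
        (whiskerWord (b.map proj) (nodesWord ns) [] ++ mapWord Prod.fst M) := by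
  induction h with
  | nil => exact ⟨[], by simp, by simp, .refl (by simp)⟩
  | @cons k l r p d c o w ns hp hl ih =>
    obtain ⟨M, hM, hf, he⟩ := ih
    obtain ⟨hd, hc⟩ := hp.map_eq
    have hs : Fits ((l ++ d ++ r).map proj) [(⟨l.map proj, p, r.map proj⟩ : Slice V E)]
        ((l ++ c ++ r).map proj) := by
      simp [Slice.dom, Slice.cod, hd, hc]
    have h1 := Eqv.prepend hs he
    have hN := fits_nodesWord hl.admissible
    -- A maximum or virtual crossing is kept, with its labels, as the lowest slice of the closing
    -- word.
    have hvirt : ∀ s : Slice V (E × ℕ),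
        (∃ x, s.piece = .cap x) ∨ (∃ x y, s.piece = .cross .virt x y) →
        s.dom = l ++ d ++ r → s.cod = l ++ c ++ r →
        s.map Prod.fst = ⟨l.map proj, p, r.map proj⟩ →
        ∃ M : List (Slice V (E × ℕ)), IsVirtual M ∧ Fits (l ++ d ++ r ++ ports ns) M [] ∧
          Eqv ((l ++ d ++ r).map proj) [] (⟨l.map proj, p, r.map proj⟩ :: w)
            (whiskerWord ((l ++ d ++ r).map proj) (nodesWord ns) [] ++ mapWord Prod.fst M) := by
      intro s hs' hdom hcod hmap
      refine ⟨⟨s.left, s.piece, s.right ++ ports ns⟩ :: M, isVirtual_cons.2 ⟨hs', hM⟩, ?_, ?_⟩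
      · simp only [fits_cons]
        simp only [Slice.dom, Slice.cod] at hdom hcod ⊢
        rw [← hdom]
        refine ⟨by simp, ?_⟩
        rw [← List.append_assoc, hcod]
        exact hf
      · have h2 := (Eqv.interchange hs hN).postpend (v := mapWord Prod.fst M) (c := [])
          (by simpa using hf.map Prod.fst)
        refine .trans (h1.cast rfl rfl (by simp) rfl) ?_
        refine h2.cast (by simp) rfl (by simp) ?_
        have e : (mapWord Prod.fst [(⟨s.left, s.piece, s.right ++ ports ns⟩ :
            Slice V (E × ℕ))]) = whiskerWord [] [s.map Prod.fst] ((ports ns).map proj) := by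
          simp [mapWord, Slice.map]
        rw [hmap] at e
        simp only [mapWord, List.map_cons, List.map_nil] at e ⊢
        rw [← e]
        simp
    cases hp with
    | cap x =>
      exact hvirt ⟨l, .cap x, r⟩ (.inl ⟨x, rfl⟩) (by simp [Slice.dom, Piece.dom])
        (by simp [Slice.cod, Piece.cod]) (by simp [Slice.map, Piece.map])
    | virt x y =>
      exact hvirt ⟨l, .cross .virt x y, r⟩ (.inr ⟨x, y, rfl⟩) (by simp [Slice.dom, Piece.dom])
        (by simp [Slice.cod, Piece.cod]) (by simp [Slice.map, Piece.map])
    | @node _ κ _ _ hκ _ _ =>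
      set outs := (d.map rev).reverse ++ c with houts
      have hports : outs.map proj = p.ports := by
        simp [houts, Piece.ports, ← hd, ← hc, Function.comp_def]
      set Q : List (Slice V (E × ℕ)) := whiskerWord (l ++ d) (passBlock r outs) [] ++
        whiskerWord l (caps d) (c ++ r) with hQ
      have hfQ : Fits (l ++ d ++ r ++ outs) Q (l ++ c ++ r) := by
        refine .append (by simpa using (fits_passBlock (V := V) r outs).whisker (l ++ d) []) ?_
        simpa [houts] using (fits_caps (V := V) d).whisker l (c ++ r)
      have hmapQ : mapWord Prod.fst Q =
          whiskerWord (l.map proj ++ p.dom) (passBlock (r.map proj) p.ports) [] ++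
          whiskerWord (l.map proj) (caps p.dom) (p.cod ++ r.map proj) := by
        have e1 := mapWord_whiskerWord (V := V) (Prod.fst : E × ℕ → E) (l ++ d) []
          (passBlock r outs)
        have e2 := mapWord_whiskerWord (V := V) (Prod.fst : E × ℕ → E) l (c ++ r) (caps d)
        rw [mapWord_passBlock] at e1
        rw [mapWord_caps] at e2
        rw [hQ, mapWord, List.map_append, ← mapWord, ← mapWord, e1, e2, ← hports, ← hd, ← hc]
        simp
      refine ⟨whiskerWord [] Q (ports ns) ++ M, by simp [hQ, hM], ?_, ?_⟩
      · refine .append ?_ hf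
        simpa using hfQ.whisker [] (ports ns)
      · have hfM : Fits (((l ++ c ++ r) ++ ports ns).map proj) (mapWord Prod.fst M) [] := by
          simpa using hf.map Prod.fst
        have h2 := (Eqv.slice_node hκ (l.map proj) (r.map proj)).symm.postpend
          (v := whiskerWord ((l ++ c ++ r).map proj) (nodesWord ns) [] ++ mapWord Prod.fst M)
          (c := []) (.append (b := ((l ++ c ++ r) ++ ports ns).map proj)
            (by simpa [hc] using hN.whisker ((l ++ c ++ r).map proj) []) hfM)
        have h3 := (Eqv.interchange (hfQ.map Prod.fst) hN).context
          (whiskerWord ((l ++ d ++ r).map proj) (κ.word p.ports) []) (mapWord Prod.fst M) [] []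
          (s := (l ++ d ++ r).map proj) (t := [])
          (by simpa [hports] using hκ.admits.fits.whisker ((l ++ d ++ r).map proj) [])
          (by simpa using hfM)
        refine .trans (h1.cast rfl rfl (by simp) rfl) ?_
        refine .trans (h2.cast (by simp [hd]) rfl (by simp) rfl) ?_
        refine h3.cast rfl rfl (by simp [hmapQ, hd]) ?_
        have e := mapWord_whiskerWord (V := V) (Prod.fst : E × ℕ → E) [] (ports ns) Q
        simp only [mapWord] at e ⊢
        simp [nodesWord, hports, e]

theorem Lift.normalForm {k : ℕ} {w : List (Slice V E)} {ns : List (Node V E)}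
    (h : Lift k [] w ns) : NormalForm ns w := by
  obtain ⟨M, hM, hf, he⟩ := h.normalForm_aux
  exact ⟨M, hM, by simpa using hf, by simpa using he⟩

/-! ### Following labels through nodes -/

/-- `Pass n x y m`: a strand that arrives at the end `x` of the node `n` continues at the end `y`;
`m` is the letter recorded at a classical crossing. -/
inductive Pass : Node V E → Strand (E × ℕ) → Strand (E × ℕ) → Option Letter → Prop
  | cup_left {k a b} : Pass ⟨k, .cup, [a, b]⟩ a b none
  | cup_right {k a b} : Pass ⟨k, .cup, [a, b]⟩ b a none
  | cross_up {k t a b c d} : Pass ⟨k, .crs t, [a, b, c, d]⟩ b d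
      (some ⟨k, t == .upper, (t == .upper) == (d.2 == c.2)⟩)
  | cross_down {k t a b c d} : Pass ⟨k, .crs t, [a, b, c, d]⟩ d b
      (some ⟨k, t == .upper, (t == .upper) == (d.2 == c.2)⟩)
  | cross_up' {k t a b c d} : Pass ⟨k, .crs t, [a, b, c, d]⟩ a c
      (some ⟨k, !(t == .upper), (t == .upper) == (d.2 == c.2)⟩)
  | cross_down' {k t a b c d} : Pass ⟨k, .crs t, [a, b, c, d]⟩ c a
      (some ⟨k, !(t == .upper), (t == .upper) == (d.2 == c.2)⟩)

/-- The strand leaving a node at the end `x`, followed through the nodes `ns`, ends at a vertex and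
meets the crossings `l`. -/
inductive NodeTrace (ns : List (Node V E)) : Strand (E × ℕ) → List Letter → Prop
  | finish {n v x} : n ∈ ns → n.kind = .vert v → rev x ∈ n.outs → NodeTrace ns x []
  | pass {n x y m l} : n ∈ ns → Pass n (rev x) y m → NodeTrace ns y l →
      NodeTrace ns x (m.toList ++ l)

/-- The label of a strand leaving a slice through the top (`true`) or the bottom (`false`), as seen
from the node it comes from. -/
def leaving (b : Bool) (x : Strand (E × ℕ)) : Strand (E × ℕ) := if b then x else rev x

theorem PieceLift.follow_none {k : ℕ} {p : Piece V E} {d c : List (Strand (E × ℕ))}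
    {o : Option (Node V E)} (h : PieceLift k p d c o) {b : Bool} {i : ℕ} {x : Strand (E × ℕ)}
    (hx : (if b then c else d)[i]? = some x) (hf : p.follow b i = none) :
    ∃ n v, o = some n ∧ n.kind = .vert v ∧ rev (leaving (!b) x) ∈ n.outs := by
  cases h with
  | cap x => simp [Piece.follow] at hf
  | virt x y => simp [Piece.follow] at hf
  | node hκ hd hc =>
    cases hκ with
    | cup x => simp [Piece.follow] at hf
    | cross t x y ht => simp [Piece.follow] at hf
    | vertex v below above =>
      refine ⟨_, v, rfl, rfl, ?_⟩
      have hm := List.mem_of_getElem? hx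
      cases b
      · exact List.mem_append_left _ (List.mem_reverse.2 (List.mem_map_of_mem hm))
      · exact List.mem_append_right _ (by simpa [leaving] using hm)

/-- Labels change only at nodes: either the label seen on leaving is the one seen on entering, or
the step is a passage through the node of this piece. -/
theorem PieceLift.follow_some {k : ℕ} {p : Piece V E} {d c : List (Strand (E × ℕ))}
    {o : Option (Node V E)} (h : PieceLift k p d c o) {b : Bool} {i : ℕ} {x : Strand (E × ℕ)}
    (hx : (if b then c else d)[i]? = some x) {b' : Bool} {j : ℕ} {m : Option Bool}
    (hf : p.follow b i = some (b', j, m)) :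
    ∃ y, (if b' then c else d)[j]? = some y ∧
      ((m = none ∧ leaving b' y = leaving (!b) x) ∨ ∃ n, o = some n ∧
        Pass n (rev (leaving (!b) x)) (leaving b' y) (m.map fun a => ⟨k, a, p.sign⟩)) := by
  have two : ∀ {u v : Strand (E × ℕ)}, [u, v][i]? = some x → (i = 0 ∧ u = x) ∨ (i = 1 ∧ v = x) := by
    intro u v h
    rcases i with _ | _ | i <;> simp_all
  cases h with
  | cap z =>
    simp only [Piece.follow, Option.some.injEq, Prod.mk.injEq] at hf
    obtain ⟨rfl, rfl, rfl⟩ := hf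
    cases b
    · rcases two hx with ⟨rfl, rfl⟩ | ⟨rfl, rfl⟩ <;> simp [leaving]
    · simp at hx
  | virt z z' =>
    simp only [Piece.follow, Option.some.injEq, Prod.mk.injEq] at hf
    obtain ⟨rfl, rfl, rfl⟩ := hf
    cases b <;> rcases two hx with ⟨rfl, rfl⟩ | ⟨rfl, rfl⟩ <;> simp [leaving]
  | node hκ hd hc =>
    cases hκ with
    | cup z =>
      obtain rfl : d = [] := by simpa [Piece.dom] using hd
      obtain ⟨u, c, rfl, -, hc₁⟩ := List.map_eq_cons_iff.1 hc
      obtain ⟨u', c, rfl, -, hc₂⟩ := List.map_eq_cons_iff.1 hc₁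
      obtain rfl : c = [] := by simpa using hc₂
      simp only [Piece.follow, Option.some.injEq, Prod.mk.injEq] at hf
      obtain ⟨rfl, rfl, rfl⟩ := hf
      cases b
      · simp at hx
      · rcases two hx with ⟨rfl, rfl⟩ | ⟨rfl, rfl⟩
        · exact ⟨u', rfl, .inr ⟨_, rfl, by simpa [leaving] using Pass.cup_left⟩⟩
        · exact ⟨u, rfl, .inr ⟨_, rfl, by simpa [leaving] using Pass.cup_right⟩⟩
    | vertex v below above => simp [Piece.follow] at hf
    | cross t z z' ht =>
      obtain ⟨d₀, d, rfl, hz, hd₁⟩ := List.map_eq_cons_iff.1 hd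
      obtain ⟨d₁, d, rfl, hz', hd₂⟩ := List.map_eq_cons_iff.1 hd₁
      obtain rfl : d = [] := by simpa using hd₂
      obtain ⟨c₀, c, rfl, hy, hc₁⟩ := List.map_eq_cons_iff.1 hc
      obtain ⟨c₁, c, rfl, hy', hc₂⟩ := List.map_eq_cons_iff.1 hc₁
      obtain rfl : c = [] := by simpa using hc₂
      have e0 : c₀.2 = z'.2 := by rw [← hy]; rfl
      have e1 : c₁.2 = z.2 := by rw [← hy']; rfl
      simp only [Piece.follow, Option.some.injEq, Prod.mk.injEq] at hf
      obtain ⟨rfl, rfl, rfl⟩ := hf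
      have hs : (Piece.cross t z z' : Piece V E).sign = ((t == .upper) == (c₁.2 == c₀.2)) := by
        simp [Piece.sign, e0, e1]
      rw [hs]
      cases b <;> rcases two hx with ⟨rfl, rfl⟩ | ⟨rfl, rfl⟩
      · refine ⟨c₁, rfl, .inr ⟨_, rfl, ?_⟩⟩
        cases t <;> first | exact absurd rfl ht | exact Pass.cross_up
      · refine ⟨c₀, rfl, .inr ⟨_, rfl, ?_⟩⟩
        cases t <;> first | exact absurd rfl ht | exact Pass.cross_up'
      · refine ⟨d₁, rfl, .inr ⟨_, rfl, ?_⟩⟩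
        simp only [leaving, Bool.not_true, Bool.false_eq_true, if_false, rev_rev]
        cases t <;> first | exact absurd rfl ht | exact Pass.cross_down'
      · refine ⟨d₀, rfl, .inr ⟨_, rfl, ?_⟩⟩
        simp only [leaving, Bool.not_true, Bool.false_eq_true, if_false, rev_rev]
        cases t <;> first | exact absurd rfl ht | exact Pass.cross_down

/-- A labelling of a slice. -/
def SliceLift (k : ℕ) (s : Slice V E) (B T : List (Strand (E × ℕ))) (o : Option (Node V E)) :
    Prop :=
  ∃ l r d c, B = l ++ d ++ r ∧ T = l ++ c ++ r ∧ PieceLift k s.piece d c o ∧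
    s.left = l.map proj ∧ s.right = r.map proj

theorem getElem?_middle {α : Type*} {l d r : List α} {j : ℕ} (h : l.length ≤ j)
    (h' : j < l.length + d.length) : (l ++ d ++ r)[j]? = d[j - l.length]? := by
  rw [List.append_assoc, List.getElem?_append_right h, List.getElem?_append_left (by omega)]

theorem getElem?_right {α : Type*} {l d r : List α} {j : ℕ}
    (h' : l.length + d.length ≤ j) :
    (l ++ d ++ r)[j]? = r[j - (l.length + d.length)]? := by
  rw [List.getElem?_append_right (by simpa using h')]
  simp

theorem getElem?_left {α : Type*} {l d r : List α} {j : ℕ} (h : j < l.length) :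
    (l ++ d ++ r)[j]? = l[j]? := by
  rw [List.append_assoc, List.getElem?_append_left h]

theorem SliceLift.follow_none {k : ℕ} {s : Slice V E} {B T : List (Strand (E × ℕ))}
    {o : Option (Node V E)} (h : SliceLift k s B T o) {b : Bool} {j : ℕ} {x : Strand (E × ℕ)}
    (hx : (if b then T else B)[j]? = some x) (hf : s.follow b j = none) :
    ∃ n v, o = some n ∧ n.kind = .vert v ∧ rev (leaving (!b) x) ∈ n.outs := by
  obtain ⟨l, r, d, c, rfl, rfl, hp, hl, -⟩ := h
  obtain ⟨hd, hc⟩ := hp.map_eq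
  obtain ⟨q, hq⟩ : ∃ q : Bool → List (Strand (E × ℕ)), ∀ b, (if b then c else d) = q b :=
    ⟨_, fun _ => rfl⟩
  have ha : s.piece.arity b = (q b).length := by
    rw [← hq]
    cases b <;> simp [Piece.arity, ← hd, ← hc]
  have hT : (if b then l ++ c ++ r else l ++ d ++ r) = l ++ q b ++ r := by
    rw [← hq]
    cases b <;> simp
  rw [hT] at hx
  have hlen : s.left.length = l.length := by simp [hl]
  simp only [Slice.follow, hlen, ha] at hf
  split_ifs at hf with h1 h2
  rw [getElem?_middle (by omega) h2] at hx
  exact hp.follow_none ((hq b).symm ▸ hx) (by simpa using hf)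

theorem SliceLift.follow_some {k : ℕ} {s : Slice V E} {B T : List (Strand (E × ℕ))}
    {o : Option (Node V E)} (h : SliceLift k s B T o) {b : Bool} {j : ℕ} {x : Strand (E × ℕ)}
    (hx : (if b then T else B)[j]? = some x) {b' : Bool} {j' : ℕ} {m : Option Bool}
    (hf : s.follow b j = some (b', j', m)) :
    ∃ y, (if b' then T else B)[j']? = some y ∧
      ((m = none ∧ leaving b' y = leaving (!b) x) ∨ ∃ n, o = some n ∧
        Pass n (rev (leaving (!b) x)) (leaving b' y)
          (m.map fun a => ⟨k, a, s.piece.sign⟩)) := by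
  obtain ⟨l, r, d, c, rfl, rfl, hp, hl, -⟩ := h
  obtain ⟨hd, hc⟩ := hp.map_eq
  obtain ⟨q, hq⟩ : ∃ q : Bool → List (Strand (E × ℕ)), ∀ b, (if b then c else d) = q b :=
    ⟨_, fun _ => rfl⟩
  have ha : ∀ b, s.piece.arity b = (q b).length := by
    intro b
    rw [← hq]
    cases b <;> simp [Piece.arity, ← hd, ← hc]
  have hT : ∀ b : Bool, (if b then l ++ c ++ r else l ++ d ++ r) = l ++ q b ++ r := by
    intro b
    rw [← hq]
    cases b <;> simp
  rw [hT] at hx ⊢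
  have hlen : s.left.length = l.length := by simp [hl]
  simp only [Slice.follow, hlen, ha] at hf
  split_ifs at hf with h1 h2
  · simp only [Option.some.injEq, Prod.mk.injEq] at hf
    obtain ⟨rfl, rfl, rfl⟩ := hf
    rw [getElem?_left h1] at hx
    exact ⟨x, by rw [getElem?_left h1, hx], .inl ⟨rfl, rfl⟩⟩
  · rw [getElem?_middle (by omega) h2] at hx
    simp only [Option.map_eq_some_iff, Prod.mk.injEq, Prod.exists] at hf
    obtain ⟨b'', i, m', hf, rfl, rfl, rfl⟩ := hf
    obtain ⟨y, hy, h⟩ := hp.follow_some ((hq b).symm ▸ hx) hf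
    refine ⟨y, ?_, h⟩
    rw [hq] at hy
    have := (List.getElem?_eq_some_iff.1 hy).1
    rw [getElem?_middle (by omega) (by omega)]
    simpa using hy
  · simp only [Option.some.injEq, Prod.mk.injEq] at hf
    obtain ⟨rfl, rfl, rfl⟩ := hf
    rw [getElem?_right (by omega)] at hx
    refine ⟨x, ?_, .inl ⟨rfl, rfl⟩⟩
    rw [getElem?_right (by omega), ← hx]
    congr 1
    omega

/-- The labels at all levels of a labelled word. -/
theorem Lift.exists_levels {k : ℕ} {b : List (Strand (E × ℕ))} {w : List (Slice V E)}
    {ns : List (Node V E)} (h : Lift k b w ns) :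
    ∃ (lev : ℕ → List (Strand (E × ℕ))) (o : ℕ → Option (Node V E)), lev 0 = b ∧
      (∀ i s, w[i]? = some s → SliceLift (k + i) s (lev i) (lev (i + 1)) (o i) ∧
        ∀ n, o i = some n → n ∈ ns) ∧
      ∀ n ∈ ns, ∃ i s, w[i]? = some s ∧ o i = some n := by
  induction h with
  | nil => exact ⟨fun _ => [], fun _ => none, rfl, by simp, by simp⟩
  | @cons k l r p d c o w ns hp _ ih =>
    obtain ⟨lev, os, h0, h1, h2⟩ := ih
    refine ⟨fun i => i.casesOn (l ++ d ++ r) lev, fun i => i.casesOn o os, rfl, ?_, ?_⟩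
    · rintro (_ | i) s hs
      · obtain rfl : _ = s := by simpa using hs
        refine ⟨⟨l, r, d, c, rfl, h0, hp, rfl, rfl⟩, ?_⟩
        rintro n (rfl : o = _)
        simp
      · obtain ⟨h3, h4⟩ := h1 i s (by simpa using hs)
        refine ⟨by rwa [Nat.add_right_comm, Nat.add_assoc] at h3, fun n hn => ?_⟩
        exact List.mem_append_right _ (h4 n hn)
    · intro n hn
      rcases List.mem_append.1 hn with hn | hn
      · exact ⟨0, _, rfl, by simpa using hn⟩
      · obtain ⟨i, s, h3, h4⟩ := h2 n hn
        exact ⟨i + 1, s, by simpa using h3, h4⟩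

/-- Slices in which the label does not change contribute nothing; what remains of the geometric
trace is a sequence of passages through nodes with the same letters. -/
theorem Trace.nodeTrace {w : List (Slice V E)} {ns : List (Node V E)}
    {lev : ℕ → List (Strand (E × ℕ))} {o : ℕ → Option (Node V E)} (h0 : lev 0 = [])
    (hlev : ∀ i s, w[i]? = some s → SliceLift i s (lev i) (lev (i + 1)) (o i) ∧
        ∀ n, o i = some n → n ∈ ns)
    {k : ℕ} {b : Bool} {j : ℕ} {l : List Letter} (h : Trace w k b j l) {x : Strand (E × ℕ)}
    (hx : (lev (if b then k + 1 else k))[j]? = some x) : NodeTrace ns (leaving b x) l := by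
  -- Leaving slice `k` downwards at level `k` means entering slice `k - 1` through its top, which
  -- has the same level. For `k = 0` the truncated subtraction would be wrong, but level `0` has no
  -- strands.
  have key : ∀ {k : ℕ} {b : Bool} {j : ℕ} {x : Strand (E × ℕ)},
      (lev (if b then k + 1 else k))[j]? = some x →
      (if !b then lev (nextIndex k b + 1) else lev (nextIndex k b))[j]? = some x := by
    intro k b j x hx
    cases b
    · rcases k with _ | k
      · simp [h0] at hx
      · simpa [nextIndex] using hx
    · simpa [nextIndex] using hx
  have ite_lev : ∀ (b : Bool) (k : ℕ),
      (if b then lev (k + 1) else lev k) = lev (if b then k + 1 else k) := by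
    intro b k
    cases b <;> rfl
  induction h generalizing x with
  | finish hs hf =>
    obtain ⟨hsl, ho⟩ := hlev _ _ hs
    obtain ⟨n, v, hn, hv, hm⟩ := hsl.follow_none (key hx) hf
    exact .finish (ho n hn) hv (by simpa using hm)
  | pass hs hf _ ih =>
    obtain ⟨hsl, ho⟩ := hlev _ _ hs
    obtain ⟨y, hy, ⟨-, h⟩ | ⟨n, hn, hp⟩⟩ := hsl.follow_some (key hx) hf
    · rw [ite_lev] at hy
      have := ih hy
      rwa [h, Bool.not_not] at this
    · rw [ite_lev] at hy
      exact .pass (ho n hn) (by simpa using hp) (ih hy)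
  | meet hs hf _ ih =>
    obtain ⟨hsl, ho⟩ := hlev _ _ hs
    obtain ⟨y, hy, ⟨h, -⟩ | ⟨n, hn, hp⟩⟩ := hsl.follow_some (key hx) hf
    · simp at h
    · rw [ite_lev] at hy
      exact .pass (ho n hn) (by simpa using hp) (ih hy)

theorem node_unique {ns : List (Node V E)} (hnd : (ports ns).Nodup) {n n' : Node V E}
    (hn : n ∈ ns) (hn' : n' ∈ ns) {x : Strand (E × ℕ)} (hx : x ∈ n.outs) (hx' : x ∈ n'.outs) :
    n = n' := by
  have h := (List.nodup_flatMap.1 hnd).2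
  by_contra hne
  have hs : Std.Symm (Function.onFun List.Disjoint (Node.outs (V := V) (E := E))) :=
    ⟨fun _ _ h => h.symm⟩
  exact (h.forall hn hn' hne) hx hx'

theorem outs_nodup {ns : List (Node V E)} (hnd : (ports ns).Nodup) {n : Node V E}
    (hn : n ∈ ns) : n.outs.Nodup :=
  (List.nodup_flatMap.1 hnd).1 n hn

theorem mem_ports {ns : List (Node V E)} {x : Strand (E × ℕ)} :
    x ∈ ports ns ↔ ∃ n ∈ ns, x ∈ n.outs := by
  simp [ports]

theorem Pass.symm {n : Node V E} {x y : Strand (E × ℕ)} {m : Option Letter} (h : Pass n x y m) :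
    Pass n y x m := by
  cases h <;> constructor

theorem Pass.mem {n : Node V E} {x y : Strand (E × ℕ)} {m : Option Letter} (h : Pass n x y m) :
    x ∈ n.outs ∧ y ∈ n.outs := by
  cases h <;> simp

theorem Pass.kind_ne {n : Node V E} {x y : Strand (E × ℕ)} {m : Option Letter}
    (h : Pass n x y m) (v : V) : n.kind ≠ .vert v := by
  cases h <;> simp

theorem Pass.unique {n : Node V E} {x y y' : Strand (E × ℕ)} {m m' : Option Letter}
    (hnd : n.outs.Nodup) (h : Pass n x y m) (h' : Pass n x y' m') : y = y' ∧ m = m' := by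
  cases h <;> cases h' <;> simp_all

theorem Pass.proj_eq {n : Node V E} {x y : Strand (E × ℕ)} {m : Option Letter}
    (hn : n.Admissible) (h : Pass n x y m) : proj y = rev (proj x) := by
  cases h with
  | cup_left =>
    obtain ⟨z, hz⟩ := hn
    simp at hz
    simp [hz]
  | cup_right =>
    obtain ⟨z, hz⟩ := hn
    simp at hz
    simp [hz]
  | _ =>
    obtain ⟨-, z, z', hz⟩ := hn
    simp at hz
    simp [hz]

theorem NodeTrace.of_pass {ns : List (Node V E)} (hnd : (ports ns).Nodup) {n : Node V E}
    {x y : Strand (E × ℕ)} {m : Option Letter} {l : List Letter} (h : NodeTrace ns x l)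
    (hn : n ∈ ns) (hp : Pass n (rev x) y m) : ∃ l', l = m.toList ++ l' ∧ NodeTrace ns y l' := by
  cases h with
  | finish hn' hv hx =>
    obtain rfl := node_unique hnd hn hn' hp.mem.1 hx
    exact absurd hv (hp.kind_ne _)
  | pass hn' hp' h =>
    obtain rfl := node_unique hnd hn hn' hp.mem.1 hp'.mem.1
    obtain ⟨rfl, rfl⟩ := hp.unique (outs_nodup hnd hn) hp'
    exact ⟨_, rfl, h⟩

theorem NodeTrace.of_vert {ns : List (Node V E)} (hnd : (ports ns).Nodup) {n : Node V E} {v : V}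
    {x : Strand (E × ℕ)} {l : List Letter} (h : NodeTrace ns x l)
    (hn : n ∈ ns) (hv : n.kind = .vert v) (hx : rev x ∈ n.outs) : l = [] := by
  cases h with
  | finish => rfl
  | pass hn' hp' h =>
    obtain rfl := node_unique hnd hn hn' hx hp'.mem.1
    exact absurd hv (hp'.kind_ne _)

/-- Following is deterministic: an end lies on only one node, and there it fixes both the
continuation and the letter. -/
theorem NodeTrace.unique {ns : List (Node V E)} (hnd : (ports ns).Nodup)
    {x : Strand (E × ℕ)} {l l' : List Letter} (h : NodeTrace ns x l) (h' : NodeTrace ns x l') :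
    l = l' := by
  induction h generalizing l' with
  | finish hn hv hx => exact (h'.of_vert hnd hn hv hx).symm
  | pass hn hp _ ih =>
    obtain ⟨l'', rfl, h''⟩ := h'.of_pass hnd hn hp
    rw [ih h'']

/-! ### Renaming nodes and labels -/

/-- Rename a node and the labels of its strands. -/
def Node.map (f : ℕ → ℕ) (h : E × ℕ → E × ℕ) (n : Node V E) : Node V E :=
  ⟨f n.idx, n.kind, n.outs.map (mapStrand h)⟩

theorem proj_mapStrand {h : E × ℕ → E × ℕ} (hh : ∀ a, (h a).1 = a.1) (x : Strand (E × ℕ)) :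
    proj (mapStrand h x) = proj x := by
  simp [mapStrand, hh]

theorem proj_mapStrand_comp {h : E × ℕ → E × ℕ} (hh : ∀ a, (h a).1 = a.1) :
    proj ∘ mapStrand h = proj :=
  funext (proj_mapStrand hh)

theorem Node.Admissible.map {n : Node V E} (hn : n.Admissible) (f : ℕ → ℕ)
    {h : E × ℕ → E × ℕ} (hh : ∀ a, (h a).1 = a.1) : (n.map f h).Admissible := by
  simpa [Node.Admissible, Node.map, proj_mapStrand_comp hh] using hn

theorem ports_map (ns : List (Node V E)) (f : ℕ → ℕ) (h : E × ℕ → E × ℕ) :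
    ports (ns.map (Node.map f h)) = (ports ns).map (mapStrand h) := by
  induction ns with
  | nil => rfl
  | cons n ns ih => simp [ih, Node.map]

theorem nodesWord_map (ns : List (Node V E)) (f : ℕ → ℕ) {h : E × ℕ → E × ℕ}
    (hh : ∀ a, (h a).1 = a.1) : nodesWord (ns.map (Node.map f h)) = nodesWord ns := by
  induction ns with
  | nil => rfl
  | cons n ns ih => simp [nodesWord, ih, Node.map, proj_mapStrand_comp hh]

theorem Piece.map_map {F F' : Type*} (g : E → F) (g' : F → F') (p : Piece V E) :
    (p.map g).map g' = p.map (g' ∘ g) := by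
  cases p <;> simp [Piece.map, mapStrand, Function.comp_def]

theorem mapWord_mapWord {F F' : Type*} (g : E → F) (g' : F → F') (w : List (Slice V E)) :
    mapWord g' (mapWord g w) = mapWord (g' ∘ g) w := by
  simp [mapWord, Slice.map, Piece.map_map, mapStrand, Function.comp_def]

theorem mapWord_fst {h : E × ℕ → E × ℕ} (hh : ∀ a, (h a).1 = a.1)
    (w : List (Slice V (E × ℕ))) : mapWord Prod.fst (mapWord h w) = mapWord Prod.fst w := by
  rw [mapWord_mapWord]
  rw [show (Prod.fst ∘ h : E × ℕ → E) = Prod.fst from funext hh]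

/-- The drawing only depends on the edges, which `h` preserves. Injectivity of `h` is not required,
so two labels can be merged when a minimum is removed. -/
theorem NormalForm.map {ns : List (Node V E)} {w : List (Slice V E)} (hw : NormalForm ns w)
    (f : ℕ → ℕ) {h : E × ℕ → E × ℕ} (hh : ∀ a, (h a).1 = a.1) :
    NormalForm (ns.map (Node.map f h)) w := by
  obtain ⟨M, hM, hf, he⟩ := hw
  refine ⟨mapWord h M, hM.map h, ?_, ?_⟩
  · rw [ports_map]
    exact hf.map h
  · rw [nodesWord_map _ _ hh, mapWord_fst hh]
    exact he

theorem Pass.map {n : Node V E} {x y : Strand (E × ℕ)} {m : Option Letter}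
    (hp : Pass n x y m) (h : E × ℕ → E × ℕ) :
    Pass (n.map id h) (mapStrand h x) (mapStrand h y) m := by
  cases hp with
  | cup_left => exact .cup_left
  | cup_right => exact .cup_right
  | cross_up => exact .cross_up
  | cross_down => exact .cross_down
  | cross_up' => exact .cross_up'
  | cross_down' => exact .cross_down'

/-! ### Codes -/

/-- The labelled nodes `ns` describe a graph whose edges have the Gauss words `W`. -/
structure IsCode (ns : List (Node V E)) (W : E → List Letter) : Prop where
  admissible : ∀ n ∈ ns, n.Admissible
  nodup : (ports ns).Nodup
  vert_inj : ∀ n ∈ ns, ∀ n' ∈ ns, ∀ v v', n.kind = .vert v → n'.kind = .vert v' →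
    ∀ x ∈ n.outs, ∀ x' ∈ n'.outs, proj x = proj x' → x = x'
  start : ∀ e, ∃ n ∈ ns, ∃ v, n.kind = .vert v ∧ ∃ x ∈ n.outs, proj x = (e, true) ∧
    NodeTrace ns x (W e)
  total : ∀ x ∈ ports ns, x.2 = true → ∃ l, NodeTrace ns x l

/-- The vertices of a list of nodes, with the strands at them. -/
def vertexData (ns : List (Node V E)) : List (V × List (Strand E)) :=
  ns.filterMap fun n => match n.kind with
    | .vert v => some (v, n.outs.map proj)
    | _ => none

theorem vertexData_append (ns ms : List (Node V E)) :
    vertexData (ns ++ ms) = vertexData ns ++ vertexData ms := by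
  simp [vertexData]

theorem vertexData_map (ns : List (Node V E)) (f : ℕ → ℕ) {h : E × ℕ → E × ℕ}
    (hh : ∀ a, (h a).1 = a.1) : vertexData (ns.map (Node.map f h)) = vertexData ns := by
  simp [vertexData, List.filterMap_map, Function.comp_def, Node.map, proj_mapStrand hh]

/-! ### Removing local minima -/

theorem NodeTrace.no_circle {ns : List (Node V E)} (hnd : (ports ns).Nodup) {k : ℕ}
    {a x : Strand (E × ℕ)} {l : List Letter} (hn : (⟨k, .cup, [a, rev a]⟩ : Node V E) ∈ ns)
    (h : NodeTrace ns x l) : x ≠ a ∧ x ≠ rev a := by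
  have hmem : ∀ y : Strand (E × ℕ), y = a ∨ y = rev a → rev y ∈ [a, rev a] := by
    rintro y (rfl | rfl) <;> simp
  rw [← not_or]
  intro hx
  induction h with
  | finish hn' hv hx' =>
    have := node_unique hnd hn hn' (hmem _ hx) hx'
    rw [← this] at hv
    simp at hv
  | pass hn' hp _ ih =>
    obtain rfl := node_unique hnd hn hn' (hmem _ hx) hp.mem.1
    exact ih (by simpa using hp.mem.2)

/-- The minimum and the maximum of the arc over `c` form a zigzag on one strand; straightened, it is
just the strand crossing `c`. -/
theorem Eqv.cup_capOver (z : Strand E) (c : List (Strand E)) :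
    Eqv (z :: c) (c ++ [z])
      (⟨z :: c, .cup (rev z), []⟩ :: whiskerWord [] (capOver z c) [z] : List (Slice V E))
      (vpass z c) := by
  have hcup : Fits [] ([⟨[], .cup (rev z), []⟩] : List (Slice V E)) [rev z, z] := by
    simp [Slice.dom, Slice.cod, Piece.dom, Piece.cod]
  have h1 := (Eqv.interchange (fits_passRight (V := V) .virt z c) hcup).symm.postpend
    (v := [⟨c, .cap z, [z]⟩]) (c := c ++ [z])
    (by simp [Slice.dom, Slice.cod, Piece.dom, Piece.cod])
  have h2 := Eqv.prepend (fits_passRight (V := V) .virt z c)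
    (((Eqv.zigzagLeft (V := V) z).whisker c []).cast (by simp) rfl rfl rfl)
  refine .trans (h1.cast (by simp) rfl (by simp [capOver]) rfl) ?_
  exact h2.cast rfl (by simp) (by simp) (by simp)

/-- The closing word joins the end `(a, d)` of the minimum to the end `(a, !d)` of another node.
This arc is extracted next to the nodes and straightened with the minimum. What is left is a virtual
strand from `(a, !d)` to the place of `(b, !d)`, so `a` and `b` have to become one label. -/
theorem NormalForm.remove_cup {ms : List (Node V E)} {w : List (Slice V E)} {k : ℕ} {a b : E × ℕ}
    {d : Bool} (hw : NormalForm (ms ++ [⟨k, .cup, [(a, d), (b, !d)]⟩]) w) (hab : a ≠ b)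
    (hproj : a.1 = b.1) (hms : ∀ n ∈ ms, n.Admissible)
    (hnd : (ports (ms ++ [⟨k, .cup, [(a, d), (b, !d)]⟩])).Nodup)
    {h : E × ℕ → E × ℕ} (ha : h a = b) (hb : h b = b) (hh : ∀ a, (h a).1 = a.1) :
    NormalForm (ms.map (Node.map id h)) w := by
  obtain ⟨M, hM, hf, he⟩ := hw
  simp only [ports_append, ports_cons, ports_nil, List.append_nil] at hf hnd
  have hmem : ((a, !d) : Strand (E × ℕ)) ∈ ports ms := by
    have := hM.rev_mem hf (x := (a, d)) (by simp)
    simpa [rev, hab] using this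
  obtain ⟨B, C, hBC⟩ := List.append_of_mem hmem
  have hr : rev ((a, !d) : Strand (E × ℕ)) = (a, d) := by simp [rev]
  obtain ⟨M', hM', hf', he'⟩ := hM.extract (L := B) (x := (a, !d)) (B := C) (C := [(b, !d)])
    (by simpa [hBC, hr] using hf) (by simpa [hBC, hr] using hnd)
  refine ⟨mapWord h (whiskerWord B (vpass (a, !d) C) [] ++ M'), IsVirtual.map h (by simp [hM']),
    ?_, ?_⟩
  · rw [ports_map, hBC]
    unfold mapWord
    rw [List.map_append (f := Slice.map h)]
    have h1 := ((fits_passRight (V := V) .virt ((a, !d) : Strand (E × ℕ)) C).whisker B []).map h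
    have h2 := hf'.map h
    refine Fits.append (a := (B ++ (a, !d) :: C).map (mapStrand h))
      (b := (B ++ (C ++ [(b, !d)])).map (mapStrand h)) (c := [])
      (h1.cast (by simp) ?_ rfl) h2
    simp [mapStrand, ha, hb]
  · rw [nodesWord_map _ _ hh, mapWord_fst hh]
    set z : Strand E := (b.1, !d) with hz
    have hza : mapStrand Prod.fst (a, !d) = z := by simp [mapStrand, hproj, hz]
    have hzb : mapStrand Prod.fst (b, !d) = z := by simp [mapStrand, hz]
    have hzr : mapStrand Prod.fst (a, d) = rev z := by simp [mapStrand, hproj, hz, rev]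
    have hN := fits_nodesWord hms
    have hcup : Fits ((ports ms).map proj)
        [(⟨(ports ms).map proj, .cup (rev z), []⟩ : Slice V E)]
        ((ports ms).map proj ++ [rev z, z]) := by
      simp [Slice.dom, Slice.cod, Piece.dom, Piece.cod]
    have h1 := Eqv.prepend (hN.append hcup) ((he'.map Prod.fst).cast
      (by simp [hBC, hr, hzb, hzr]) rfl rfl rfl)
    have hfM' : Fits (B.map proj ++ (C.map proj ++ [z])) (mapWord Prod.fst M') [] := by
      simpa [hzb] using hf'.map Prod.fst
    have h2 := (Eqv.cup_capOver (V := V) z (C.map proj)).context (nodesWord ms)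
      (mapWord Prod.fst M') (B.map proj) [] (s := []) (t := [])
      (by simpa [hBC, hza] using hN) (by simpa using hfM')
    have hcap : mapWord Prod.fst (capOver (a, !d) C : List (Slice V (E × ℕ))) =
        capOver z (C.map proj) := by
      have e := mapWord_whiskerWord (V := V) (Prod.fst : E × ℕ → E) [] [rev (a, !d)]
        (vpass (a, !d) C)
      rw [mapWord_passRight, hza] at e
      simp only [mapWord] at e
      simp [capOver, mapWord, e, Slice.map, Piece.map, hza]
    have e1 := mapWord_whiskerWord (V := V) (Prod.fst : E × ℕ → E) B [(b, !d)]
      (capOver (a, !d) C)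
    rw [hcap] at e1
    have e2 := mapWord_whiskerWord (V := V) (Prod.fst : E × ℕ → E) B [] (vpass (a, !d) C)
    rw [mapWord_passRight, hza] at e2
    simp only [mapWord] at e1 e2
    refine he.trans (.trans (h1.cast rfl rfl ?_ rfl) (h2.cast rfl rfl ?_ ?_))
    · simp [nodesWord_append, nodesWord, Kind.word, hzr]
    · simp [mapWord, e1, hzb, hBC, hza]
    · simp [mapWord, e2]

theorem IsCode.remove_cup {ns : List (Node V E)} {W : E → List Letter} (hc : IsCode ns W)
    {w : List (Slice V E)} (hw : NormalForm ns w) {n : Node V E} (hn : n ∈ ns)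
    (hk : n.kind = .cup) :
    ∃ ns', IsCode ns' W ∧ NormalForm ns' w ∧ ns'.length < ns.length ∧
      vertexData ns' = vertexData ns ∧ (ns'.map Node.idx).Sublist (ns.map Node.idx) := by
  classical
  obtain ⟨k, κ, outs⟩ := n
  obtain rfl : κ = .cup := hk
  obtain ⟨z, hz⟩ := hc.admissible _ hn
  simp only [List.map_eq_cons_iff, List.map_eq_nil_iff] at hz
  obtain ⟨x, _, rfl, hx, y, _, rfl, hy, rfl⟩ := hz
  obtain ⟨a, d⟩ := x
  obtain ⟨b, d'⟩ := y
  obtain rfl : d' = !d := by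
    rw [← hx] at hy
    exact congrArg Prod.snd hy
  have hproj : a.1 = b.1 := by
    rw [← hx] at hy
    exact (congrArg Prod.fst hy).symm
  obtain ⟨X, Y, rfl⟩ := List.append_of_mem hn
  have hperm : (X ++ ⟨k, .cup, [(a, d), (b, !d)]⟩ :: Y).Perm
      ((X ++ Y) ++ [(⟨k, .cup, [(a, d), (b, !d)]⟩ : Node V E)]) :=
    (List.perm_middle).trans (List.perm_append_singleton _ _).symm
  have hports : (ports (X ++ ⟨k, .cup, [(a, d), (b, !d)]⟩ :: Y)).Perm
      (ports ((X ++ Y) ++ [(⟨k, .cup, [(a, d), (b, !d)]⟩ : Node V E)])) := hperm.flatMap_right _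
  have hnd := hports.nodup_iff.1 hc.nodup
  -- Equal labels would mean that the two ends of the minimum are joined to each other. Such a
  -- circle never reaches a vertex, contradicting `total`.
  have hab : a ≠ b := by
    rintro rfl
    cases d
    · obtain ⟨l, hl⟩ := hc.total (a, true) (mem_ports.2 ⟨_, hn, by simp⟩) rfl
      exact (hl.no_circle hc.nodup (a := (a, false)) hn).2 rfl
    · obtain ⟨l, hl⟩ := hc.total (a, true) (mem_ports.2 ⟨_, hn, by simp⟩) rfl
      exact (hl.no_circle hc.nodup (a := (a, true)) hn).1 rfl
  set h : E × ℕ → E × ℕ := fun c => if c = a then b else c with hdef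
  have ha : h a = b := by simp [hdef]
  have hb : h b = b := by simp [hdef]
  have hh : ∀ c, (h c).1 = c.1 := by
    intro c
    simp only [hdef]
    split_ifs with hca
    · rw [hca, hproj]
    · rfl
  have hms : ∀ n ∈ X ++ Y, n ∈ X ++ (⟨k, .cup, [(a, d), (b, !d)]⟩ : Node V E) :: Y := by
    intro n hn
    simp only [List.mem_append, List.mem_cons] at hn ⊢
    tauto
  have htrace : ∀ {x l}, NodeTrace (X ++ (⟨k, .cup, [(a, d), (b, !d)]⟩ : Node V E) :: Y) x l →
      NodeTrace ((X ++ Y).map (Node.map id h)) (mapStrand h x) l := by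
    intro x l hl
    induction hl with
    | @finish n v x hn hv hx =>
      have hn' : n ∈ X ++ Y := by
        rcases List.mem_cons.1 (List.perm_middle.mem_iff.1 hn) with rfl | hn
        · simp at hv
        · exact hn
      refine .finish (List.mem_map_of_mem hn') hv ?_
      exact List.mem_map_of_mem (f := mapStrand h) hx
    | @pass n x y m l hn hp _ ih =>
      rcases List.mem_cons.1 (List.perm_middle.mem_iff.1 hn) with rfl | hn
      · have : mapStrand h x = mapStrand h y ∧ m = none := by
          generalize hx' : rev x = x' at hp
          obtain rfl : x = rev x' := by rw [← hx', rev_rev]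
          cases hp <;> simp [mapStrand, rev, ha, hb]
        obtain ⟨hxy, rfl⟩ := this
        rw [hxy]
        exact ih
      · exact .pass (List.mem_map_of_mem hn) (hp.map h) ih
  have hnot1 : ((a, d) : Strand (E × ℕ)) ∉ ports (X ++ Y) := by
    intro hmem
    rw [ports_append (X ++ Y)] at hnd
    exact (List.nodup_append.1 hnd).2.2 _ hmem (a, d) (by simp) rfl
  have hnot2 : ((b, !d) : Strand (E × ℕ)) ∉ ports (X ++ Y) := by
    intro hmem
    rw [ports_append (X ++ Y)] at hnd
    exact (List.nodup_append.1 hnd).2.2 _ hmem (b, !d) (by simp) rfl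
  refine ⟨(X ++ Y).map (Node.map id h), ⟨?_, ?_, ?_, ?_, ?_⟩, ?_, ?_, ?_, ?_⟩
  · intro n hn₀
    obtain ⟨n, hn, rfl⟩ := List.mem_map.1 hn₀
    exact (hc.admissible n (hms n hn)).map id hh
  · rw [ports_map]
    refine List.Nodup.map_on ?_ (List.Nodup.of_append_left (l₂ := [(a, d), (b, !d)])
      (by simpa using hnd))
    rintro ⟨x, i⟩ hx ⟨y, j⟩ hy hxy
    simp only [mapStrand, Prod.mk.injEq] at hxy
    obtain ⟨hxy, rfl⟩ := hxy
    -- Merging `a` with `b` creates no coincidence: among the remaining ends, `a` only occurs with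
    -- direction `!d` and `b` only with direction `d`.
    have hi : ∀ c : E × ℕ, (c, i) ∈ ports (X ++ Y) → (c = a → i = !d) ∧ (c = b → i = d) := by
      intro c hc
      refine ⟨?_, ?_⟩
      · rintro rfl
        by_contra hi
        exact hnot1 (by cases i <;> cases d <;> simp_all)
      · rintro rfl
        by_contra hi
        exact hnot2 (by cases i <;> cases d <;> simp_all)
    have h1 := hi x hx
    have h2 := hi y hy
    simp only [hdef] at hxy
    split_ifs at hxy with hxa hya hya
    · rw [hxa, hya]
    · have := h1.1 hxa
      have := h2.2 hxy.symm
      simp_all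
    · have := h1.2 hxy
      have := h2.1 hya
      simp_all
    · rw [hxy]
  · intro n hn₀ n' hn₀' v v' hv hv' x hx₀ x' hx₀' hxx'
    obtain ⟨n, hn, rfl⟩ := List.mem_map.1 hn₀
    obtain ⟨n', hn', rfl⟩ := List.mem_map.1 hn₀'
    obtain ⟨x, hx, rfl⟩ := List.mem_map.1 hx₀
    obtain ⟨x', hx', rfl⟩ := List.mem_map.1 hx₀'
    rw [proj_mapStrand hh, proj_mapStrand hh] at hxx'
    rw [hc.vert_inj n (hms n hn) n' (hms n' hn') v v' hv hv' x hx x' hx' hxx']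
  · intro e
    obtain ⟨n, hn, v, hv, x, hx, hxe, hl⟩ := hc.start e
    have hn' : n ∈ X ++ Y := by
      rcases List.mem_cons.1 (List.perm_middle.mem_iff.1 hn) with rfl | hn
      · simp at hv
      · exact hn
    exact ⟨_, List.mem_map_of_mem hn', v, hv, _, List.mem_map_of_mem hx,
      by rw [proj_mapStrand hh, hxe], htrace hl⟩
  · intro x hx₀ hx2
    rw [ports_map] at hx₀
    obtain ⟨x, hx₁, rfl⟩ := List.mem_map.1 hx₀
    obtain ⟨n, hn, hx⟩ := mem_ports.1 hx₁
    obtain ⟨l, hl⟩ := hc.total x (mem_ports.2 ⟨n, hms n hn, hx⟩) hx2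
    exact ⟨l, htrace hl⟩
  · exact (hw.converts (.of_perm hperm hc.admissible)).remove_cup hab hproj
      (fun n hn => hc.admissible n (hms n hn)) hnd ha hb hh
  · simp
  · rw [vertexData_map _ _ hh, vertexData_append, vertexData_append]
    simp [vertexData]
  · rw [List.map_map]
    have : Node.idx ∘ Node.map (V := V) id h = Node.idx := rfl
    rw [this]
    simp

theorem IsCode.remove_cups {ns : List (Node V E)} {W : E → List Letter} (hc : IsCode ns W)
    {w : List (Slice V E)} (hw : NormalForm ns w) :
    ∃ ns', IsCode ns' W ∧ NormalForm ns' w ∧ (∀ n ∈ ns', n.kind ≠ .cup) ∧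
      vertexData ns' = vertexData ns ∧ (ns'.map Node.idx).Sublist (ns.map Node.idx) := by
  induction hlen : ns.length using Nat.strong_induction_on generalizing ns with
  | _ N ih =>
  by_cases h : ∃ n ∈ ns, n.kind = .cup
  · obtain ⟨n, hn, hk⟩ := h
    obtain ⟨ns₁, h1, h2, h3, h4, h5⟩ := hc.remove_cup hw hn hk
    obtain ⟨ns', g1, g2, g3, g4, g5⟩ := ih _ (hlen ▸ h3) h1 h2 rfl
    exact ⟨ns', g1, g2, g3, g4.trans h4, g5.trans h5⟩
  · push Not at h
    exact ⟨ns, hc, hw, h, rfl, List.Sublist.refl _⟩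

/-! ### The code of a diagram -/

theorem filterMap_inj {α β : Type*} {g : α → Option β} {l : List α} (h : (l.filterMap g).Nodup)
    {x y : α} {b : β} (hx : x ∈ l) (hy : y ∈ l) (hgx : g x = some b) (hgy : g y = some b) :
    x = y := by
  induction l with
  | nil => simp at hx
  | cons a l ih =>
    rcases List.mem_cons.1 hx with rfl | hx' <;> rcases List.mem_cons.1 hy with rfl | hy'
    · rfl
    · rw [List.filterMap_cons_some hgx, List.nodup_cons] at h
      exact absurd (List.mem_filterMap.2 ⟨y, hy', hgy⟩) h.1
    · rw [List.filterMap_cons_some hgy, List.nodup_cons] at h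
      exact absurd (List.mem_filterMap.2 ⟨x, hx', hgx⟩) h.1
    · refine ih (h.sublist ?_) hx' hy'
      exact (List.sublist_cons_self a l).filterMap g

theorem mem_vertexData {ns : List (Node V E)} {v : V} {os : List (Strand E)} :
    (v, os) ∈ vertexData ns ↔ ∃ n ∈ ns, n.kind = .vert v ∧ n.outs.map proj = os := by
  simp only [vertexData, List.mem_filterMap]
  refine exists_congr fun n => and_congr_right fun _ => ?_
  rcases n with ⟨k, _ | _ | _, outs⟩ <;> simp

theorem vert_unique {ns : List (Node V E)} (h : ((vertexData ns).map Prod.fst).Nodup)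
    {n n' : Node V E} {v : V} (hn : n ∈ ns) (hn' : n' ∈ ns) (hv : n.kind = .vert v)
    (hv' : n'.kind = .vert v) : n = n' := by
  have e : (vertexData ns).map Prod.fst = ns.filterMap fun n => match n.kind with
      | .vert v => some v
      | _ => none := by
    rw [vertexData, List.map_filterMap]
    congr 1
    funext n
    rcases n with ⟨k, _ | _ | _, outs⟩ <;> rfl
  rw [e] at h
  exact filterMap_inj h hn hn' (b := v) (by simp [hv]) (by simp [hv'])

theorem PieceLift.idx_eq {k : ℕ} {p : Piece V E} {d c : List (Strand (E × ℕ))}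
    {n : Node V E} (h : PieceLift k p d c (some n)) : n.idx = k := by
  cases h; rfl

theorem PieceLift.outs_eq {k : ℕ} {p : Piece V E} {d c : List (Strand (E × ℕ))}
    {n : Node V E} (h : PieceLift k p d c (some n)) : n.outs = (d.map rev).reverse ++ c := by
  cases h; rfl

theorem Lift.idx_nodup {k : ℕ} {b : List (Strand (E × ℕ))} {w : List (Slice V E)}
    {ns : List (Node V E)} (h : Lift k b w ns) :
    (∀ n ∈ ns, k ≤ n.idx) ∧ (ns.map Node.idx).Nodup := by
  induction h with
  | nil => simp
  | @cons k l r p d c o w ns hp _ ih =>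
    cases o with
    | none => exact ⟨fun n hn => (Nat.le_succ k).trans (ih.1 n hn), ih.2⟩
    | some m =>
      simp only [Option.toList_some, List.singleton_append, List.mem_cons, forall_eq_or_imp,
        List.map_cons, List.nodup_cons, hp.idx_eq, le_refl, true_and]
      refine ⟨fun n hn => (Nat.le_succ k).trans (ih.1 n hn), ?_, ih.2⟩
      intro hk
      obtain ⟨n, hn, hnk⟩ := List.mem_map.1 hk
      have := ih.1 n hn
      omega

/-- With all edges bent up, reading the ends from left to right goes clockwise around the vertex,
whence the reversal; the two lists then differ only in their starting point. -/
theorem Lift.vertexData {k : ℕ} {b : List (Strand (E × ℕ))} {w : List (Slice V E)}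
    {ns : List (Node V E)} (h : Lift k b w ns) :
    List.Forall₂ (fun a c => a.1 = c.1 ∧ a.2.reverse ~r c.2) (vertexData ns) (stars w) := by
  induction h with
  | nil => exact .nil
  | @cons k l r p d c o w ns hp _ ih =>
    cases hp with
    | cap x => exact ih
    | virt x y => exact ih
    | node hκ hd hc =>
      cases hκ with
      | cup x => exact ih
      | cross t x y ht => exact ih
      | vertex v below above =>
        refine .cons ⟨rfl, ?_⟩ ih
        simp only [Piece.dom, Piece.cod] at hd hc
        subst hd hc
        simp only [List.map_append, List.map_reverse, List.reverse_append, List.reverse_reverse,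
          List.map_map]
        exact List.isRotated_append

theorem Lift.exists_stars {k : ℕ} {b : List (Strand (E × ℕ))} {w : List (Slice V E)}
    {ns : List (Node V E)} (h : Lift k b w ns) {v : V} {os : List (Strand E)}
    (hv : (v, os) ∈ VirtualGraph.vertexData ns) :
    ∃ hs, (v, hs) ∈ stars w ∧ os.reverse ~r hs := by
  obtain ⟨i, hi, he⟩ := List.getElem_of_mem hv
  have hi' : i < (stars w).length := h.vertexData.length_eq ▸ hi
  have := h.vertexData.get hi hi'
  simp only [List.get_eq_getElem, he] at this
  refine ⟨(stars w)[i].2, ?_, this.2⟩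
  rw [this.1]
  exact List.getElem_mem hi'

theorem Lift.map_fst_vertexData {k : ℕ} {b : List (Strand (E × ℕ))} {w : List (Slice V E)}
    {ns : List (Node V E)} (h : Lift k b w ns) :
    (VirtualGraph.vertexData ns).map Prod.fst = (stars w).map Prod.fst := by
  have := h.vertexData
  generalize VirtualGraph.vertexData ns = a at this
  generalize stars w = c at this
  induction this with
  | nil => rfl
  | cons h _ ih => simp [h.1, ih]

/-- A strand followed against its edge can only end at the initial end of that edge, from which the
forward trace is known; retracing the passages one by one gives a forward trace from the place of
departure. This supplies traces for ends leaving a slice through its bottom, about which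
`Diagram.no_circle` says nothing directly. -/
theorem NodeTrace.backward {ns : List (Node V E)} {W : E → List Letter}
    (hadm : ∀ n ∈ ns, n.Admissible) (hnd : (ports ns).Nodup)
    (hinj : ∀ n ∈ ns, ∀ n' ∈ ns, ∀ v v', n.kind = .vert v → n'.kind = .vert v' →
      ∀ x ∈ n.outs, ∀ x' ∈ n'.outs, proj x = proj x' → x = x')
    (hstart : ∀ e, ∃ n ∈ ns, ∃ v, n.kind = .vert v ∧ ∃ x ∈ n.outs, proj x = (e, true) ∧
      NodeTrace ns x (W e))
    {z : Strand (E × ℕ)} {l : List Letter} (h : NodeTrace ns z l) (hz : z.2 = false) :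
    ∃ l', NodeTrace ns (rev z) l' := by
  induction h with
  | @finish n v z hn hv hx =>
    obtain ⟨n', hn', v', hv', x, hx', he, hl⟩ := hstart z.1.1
    have : rev z = x := by
      refine hinj n hn n' hn' v v' hv hv' _ hx _ hx' ?_
      rw [he]
      simp [rev, mapStrand, hz]
    exact ⟨_, this ▸ hl⟩
  | @pass n z y m l hn hp _ ih =>
    have hy : y.2 = false := by
      have := congrArg Prod.snd (hp.proj_eq (hadm n hn))
      simpa [mapStrand, rev, hz] using this
    obtain ⟨l', hl'⟩ := ih hy
    obtain ⟨l'', -, h''⟩ := hl'.of_pass hnd hn (by simpa using hp.symm)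
    exact ⟨l'', h''⟩

/-- The nodes of a diagram. -/
structure IsDiagramCode {G : DirectedGraph V E} (D : Diagram G) (ns : List (Node V E))
    (W : E → List Letter) : Prop extends IsCode ns W where
  normalForm : NormalForm ns D.word
  idx_nodup : (ns.map Node.idx).Nodup
  vert_nodup : ((vertexData ns).map Prod.fst).Nodup
  vert_mem : ∀ v, ∃ os, (v, os) ∈ vertexData ns
  vert_star : ∀ v os, (v, os) ∈ vertexData ns → ∃ hs, (v, hs) ∈ stars D.word ∧ os.reverse ~r hs

theorem Diagram.exists_code {G : DirectedGraph V E} (D : Diagram G) {W : E → List Letter}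
    (hW : ∀ e, EdgeTrace D.word e (W e)) :
    ∃ ns, IsDiagramCode D ns W ∧ ∀ n ∈ ns, n.kind ≠ .cup := by
  obtain ⟨b', ns, hb', hl, hnd⟩ := exists_lift D.fits 0
  obtain rfl : b' = [] := by simpa using hb'
  simp only [List.nil_append] at hnd
  obtain ⟨lev, o, h0, hlev, hns⟩ := hl.exists_levels
  simp only [Nat.zero_add] at hlev
  have hstars : ∀ v os, (v, os) ∈ vertexData ns →
      ∃ hs, (v, hs) ∈ stars D.word ∧ os.reverse ~r hs := fun v os h => hl.exists_stars h
  have hvnd : ((vertexData ns).map Prod.fst).Nodup := by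
    rw [hl.map_fst_vertexData]
    exact D.vertex_nodup
  have hvmem : ∀ v, ∃ os, (v, os) ∈ vertexData ns := by
    intro v
    obtain ⟨hs, hv⟩ := D.vertex_mem v
    have : v ∈ (vertexData ns).map Prod.fst := by
      rw [hl.map_fst_vertexData]
      exact List.mem_map.2 ⟨_, hv, rfl⟩
    obtain ⟨⟨v', os⟩, h, rfl⟩ := List.mem_map.1 this
    exact ⟨os, h⟩
  have hstar : ∀ n ∈ ns, ∀ v, n.kind = .vert v → (n.outs.map proj).Nodup ∧
      ∀ x ∈ n.outs, G.foot (proj x) = v := by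
    intro n hn v hv
    obtain ⟨hs, hmem, hrot⟩ := hstars v _ (mem_vertexData.2 ⟨n, hn, hv, rfl⟩)
    refine ⟨?_, fun x hx => ?_⟩
    · have := hrot.nodup_iff.2 (D.star_nodup v hs hmem)
      simpa using this
    · refine (D.star_mem v hs hmem _).1 (hrot.mem_iff.1 ?_)
      exact List.mem_reverse.2 (List.mem_map_of_mem hx)
  have hinj : ∀ n ∈ ns, ∀ n' ∈ ns, ∀ v v', n.kind = .vert v → n'.kind = .vert v' →
      ∀ x ∈ n.outs, ∀ x' ∈ n'.outs, proj x = proj x' → x = x' := by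
    intro n hn n' hn' v v' hv hv' x hx x' hx' hxx
    obtain ⟨h1, h2⟩ := hstar n hn v hv
    obtain ⟨-, h3⟩ := hstar n' hn' v' hv'
    -- A half-edge knows its vertex, a vertex is drawn once, and at a vertex each half-edge occurs
    -- once.
    obtain rfl : v = v' := by rw [← h2 x hx, ← h3 x' hx', hxx]
    obtain rfl := vert_unique hvnd hn hn' hv hv'
    exact List.inj_on_of_nodup_map h1 hx hx' hxx
  have hstart : ∀ e, ∃ n ∈ ns, ∃ v, n.kind = .vert v ∧ ∃ x ∈ n.outs, proj x = (e, true) ∧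
      NodeTrace ns x (W e) := by
    intro e
    have hpl : ∀ {k : ℕ} {v : V} {left below above right : List (Strand E)},
        D.word[k]? = some ⟨left, .vertex v below above, right⟩ →
        ∃ l r d c, ∃ n ∈ ns, lev k = l ++ d ++ r ∧ lev (k + 1) = l ++ c ++ r ∧
          l.length = left.length ∧ d.map proj = below ∧ c.map proj = above ∧
          n.kind = .vert v ∧ n.outs = (d.map rev).reverse ++ c := by
      intro k v left below above right hs
      obtain ⟨⟨l, r, d, c, hB, hT, hp, hleft, -⟩, ho⟩ := hlev k _ hs
      obtain ⟨hd, hc⟩ := hp.map_eq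
      simp only at hp hleft
      generalize ho' : o k = o' at hp
      cases hp with
      | node hκ _ _ =>
        cases hκ
        exact ⟨l, r, d, c, _, ho _ ho', hB, hT, by simp [hleft], hd, hc, rfl, rfl⟩
    cases hW e with
    | @up k i v left below above right _ hs hi ht =>
      obtain ⟨l, r, d, c, n, hn, -, hT, hlen, -, hc, hv, houts⟩ := hpl hs
      rw [← hc, List.getElem?_map, Option.map_eq_some_iff] at hi
      obtain ⟨x, hx, hxe⟩ := hi
      refine ⟨n, hn, v, hv, x, ?_, hxe, ?_⟩
      · rw [houts]
        exact List.mem_append_right _ (List.mem_of_getElem? hx)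
      · refine ht.nodeTrace (x := x) h0 hlev ?_
        have := (List.getElem?_eq_some_iff.1 hx).1
        simp only [if_true, hT]
        rw [getElem?_middle (by omega) (by omega), ← hlen]
        simpa using hx
    | @down k i v left below above right _ hs hi ht =>
      obtain ⟨l, r, d, c, n, hn, hB, -, hlen, hd, -, hv, houts⟩ := hpl hs
      rw [← hd, List.getElem?_map, Option.map_eq_some_iff] at hi
      obtain ⟨x, hx, hxe⟩ := hi
      refine ⟨n, hn, v, hv, rev x, ?_, congrArg rev hxe, ?_⟩
      · rw [houts]
        exact List.mem_append_left _
          (List.mem_reverse.2 (List.mem_map_of_mem (List.mem_of_getElem? hx)))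
      · refine ht.nodeTrace (x := x) h0 hlev ?_
        have := (List.getElem?_eq_some_iff.1 hx).1
        simp only [Bool.false_eq_true, if_false, hB]
        rw [getElem?_middle (by omega) (by omega), ← hlen]
        simpa using hx
  have hup : ∀ (i : ℕ) (s : Slice V E), D.word[i]? = some s → ∀ x ∈ lev (i + 1),
      ∃ l, NodeTrace ns x l := by
    intro i s hs x hx
    obtain ⟨j, hj, rfl⟩ := List.getElem_of_mem hx
    obtain ⟨⟨l, r, d, c, -, hT, hp, hleft, hright⟩, -⟩ := hlev i s hs
    have hlen : j < s.cod.length := by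
      have := hp.map_eq.2
      rw [Slice.cod, hleft, hright, ← this]
      simpa [hT] using hj
    obtain ⟨l', hl'⟩ := D.no_circle i s hs j hlen
    exact ⟨l', hl'.nodeTrace h0 hlev (by simp)⟩
  have htotal : ∀ x ∈ ports ns, x.2 = true → ∃ l, NodeTrace ns x l := by
    intro x hx hx2
    obtain ⟨n, hn, hx⟩ := mem_ports.1 hx
    obtain ⟨i, s, hs, ho⟩ := hns n hn
    obtain ⟨⟨l, r, d, c, hB, hT, hp, -, -⟩, -⟩ := hlev i s hs
    rw [ho] at hp
    rw [hp.outs_eq] at hx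
    rcases List.mem_append.1 hx with hx | hx
    · have hx' : rev x ∈ lev i := by
        obtain ⟨y, hy, rfl⟩ := List.mem_map.1 (List.mem_reverse.1 hx)
        rw [hB]
        simp [hy]
      rcases i with _ | i
      · simp [h0] at hx'
      · have hi : i < D.word.length := by
          have := (List.getElem?_eq_some_iff.1 hs).1
          omega
        obtain ⟨l', hl'⟩ := hup i _ (List.getElem?_eq_getElem hi) _ hx'
        have := NodeTrace.backward hl.admissible hnd hinj hstart hl' (by simp [rev, hx2])
        simpa using this
    · exact hup i s hs x (by rw [hT]; simp [hx])
  have hcode : IsCode ns W := ⟨hl.admissible, hnd, hinj, hstart, htotal⟩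
  -- The indices of the remaining nodes form a sublist, so the crossings keep the names used in the
  -- traces.
  obtain ⟨ns', hc', hn', hcup, hv', hi'⟩ := hcode.remove_cups hl.normalForm
  exact ⟨ns', ⟨hc', hn', hl.idx_nodup.2.sublist hi', hv' ▸ hvnd, hv' ▸ hvmem, hv' ▸ hstars⟩, hcup⟩

/-! ### Canonical labels -/

/-- Once the minima are gone, every passage records a letter, so the length of a trace counts its
passages. -/
theorem Pass.exists_letter {n : Node V E} {x y : Strand (E × ℕ)} {m : Option Letter}
    (h : Pass n x y m) (hk : n.kind ≠ .cup) : ∃ a : Letter, m = some a ∧ a.name = n.idx := by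
  cases h <;> simp_all

/-- Two traces of equal length along the same edge in the same direction reach the same end of the
edge at a vertex; as passages can be inverted, they agree at each stage back to the beginning. -/
theorem IsCode.trace_inj {ns : List (Node V E)} {W : E → List Letter} (hc : IsCode ns W)
    (hcup : ∀ n ∈ ns, n.kind ≠ .cup) {x y : Strand (E × ℕ)} {l l' : List Letter}
    (hx : NodeTrace ns x l) (hy : NodeTrace ns y l') (hxy : proj x = proj y)
    (hl : l.length = l'.length) : x = y := by
  induction hx generalizing y l' with
  | finish hn hv hx =>
    cases hy with
    | finish hn' hv' hy =>
      have := hc.vert_inj _ hn _ hn' _ _ hv hv' _ hx _ hy (congrArg rev hxy)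
      simpa using congrArg rev this
    | pass hn' hp _ =>
      obtain ⟨a, rfl, -⟩ := hp.exists_letter (hcup _ hn')
      simp at hl
  | pass hn hp _ ih =>
    obtain ⟨a, rfl, -⟩ := hp.exists_letter (hcup _ hn)
    cases hy with
    | finish hn' hv' hy => simp at hl
    | pass hn' hp' hy =>
      obtain ⟨a', rfl, -⟩ := hp'.exists_letter (hcup _ hn')
      have e1 := hp.proj_eq (hc.admissible _ hn)
      have e2 := hp'.proj_eq (hc.admissible _ hn')
      have e := ih hy (by rw [e1, e2]; exact congrArg (rev ∘ rev) hxy) (by simpa using hl)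
      subst e
      have en := node_unique hc.nodup hn hn' hp.mem.2 hp'.mem.2
      subst en
      have := (hp.symm.unique (outs_nodup hc.nodup hn) hp'.symm).1
      simpa using congrArg rev this

/-- The last clause records that after a nonempty initial part the strand emerges from a passage,
hence not from a vertex. -/
theorem IsCode.exists_drop {ns : List (Node V E)} {W : E → List Letter} (hc : IsCode ns W)
    (hcup : ∀ n ∈ ns, n.kind ≠ .cup) {x : Strand (E × ℕ)} {p l : List Letter}
    (hx : NodeTrace ns x (p ++ l)) :
    ∃ y, NodeTrace ns y l ∧ proj y = proj x ∧ (p ≠ [] → ∃ n ∈ ns, ∃ z m, Pass n z y m) := by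
  induction p generalizing x with
  | nil => exact ⟨x, hx, rfl, by simp⟩
  | cons a p ih =>
    generalize hq : a :: p ++ l = q at hx
    cases hx with
    | finish => simp at hq
    | @pass n _ y m l' hn hp h =>
      obtain ⟨a', rfl, -⟩ := hp.exists_letter (hcup _ hn)
      obtain ⟨rfl, rfl⟩ : a = a' ∧ p ++ l = l' := by simpa using hq
      obtain ⟨z, hz, hzy, hzp⟩ := ih h
      refine ⟨z, hz, ?_, fun _ => ?_⟩
      · rw [hzy, hp.proj_eq (hc.admissible _ hn)]
        simp
      · rcases p with _ | ⟨b, p⟩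
        · obtain rfl : z = y := hc.trace_inj hcup hz h hzy rfl
          exact ⟨n, hn, _, _, hp⟩
        · exact hzp (by simp)

theorem IsCode.exists_suffix {ns : List (Node V E)} {W : E → List Letter} (hc : IsCode ns W)
    (hcup : ∀ n ∈ ns, n.kind ≠ .cup) {x : Strand (E × ℕ)} {l : List Letter} {e : E}
    (hx : NodeTrace ns x l) (hxe : proj x = (e, true)) : ∃ p, W e = p ++ l := by
  obtain ⟨n, hn, v, hv, s, hs, hse, hst⟩ := hc.start e
  rcases le_or_gt l.length (W e).length with hle | hlt
  · rw [← List.take_append_drop ((W e).length - l.length) (W e)] at hst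
    obtain ⟨y, hy, hys, -⟩ := hc.exists_drop hcup hst
    have : x = y := hc.trace_inj hcup hx hy (by rw [hxe, hys, hse]) (by simp; omega)
    subst this
    rw [hx.unique hc.nodup hy]
    exact ⟨_, (List.take_append_drop _ _).symm⟩
  -- A trace longer than the word of the edge would pass through the start of the edge after meeting
  -- a crossing, but the start lies at a vertex.
  · rw [← List.take_append_drop (l.length - (W e).length) l] at hx
    obtain ⟨y, hy, hyx, hyp⟩ := hc.exists_drop hcup hx
    have : y = s := hc.trace_inj hcup hy hst (by rw [hyx, hxe, hse]) (by simp; omega)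
    subst this
    obtain ⟨n', hn', z, m, hp⟩ := hyp (by
      intro h
      have := congrArg List.length h
      simp at this
      omega)
    obtain rfl := node_unique hc.nodup hn hn' hs hp.mem.2
    exact absurd hv (hp.kind_ne v)

open Classical in
/-- The number of crossings met from the label `a` to the end of the edge. -/
noncomputable def depth (ns : List (Node V E)) (a : E × ℕ) : ℕ :=
  if h : ∃ l, NodeTrace ns (a, true) l then h.choose.length else 0

theorem depth_eq {ns : List (Node V E)} (hnd : (ports ns).Nodup) {a : E × ℕ} {l : List Letter}
    (h : NodeTrace ns (a, true) l) : depth ns a = l.length := by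
  have h' : ∃ l, NodeTrace ns (a, true) l := ⟨l, h⟩
  rw [depth, dif_pos h', h.unique hnd h'.choose_spec]

/-- The canonical label: the edge, and the number of crossings up to its end. -/
noncomputable def label (ns : List (Node V E)) (a : E × ℕ) : E × ℕ := (a.1, depth ns a)

theorem IsDiagramCode.rev_mem {G : DirectedGraph V E} {D : Diagram G} {ns : List (Node V E)}
    {W : E → List Letter} (hc : IsDiagramCode D ns W) {x : Strand (E × ℕ)} (hx : x ∈ ports ns) :
    rev x ∈ ports ns := by
  obtain ⟨M, hM, hf, -⟩ := hc.normalForm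
  exact hM.rev_mem hf hx

/-- The closing word forces each label to occur with both directions, so one of them is covered by
`total`. Thus the default value in `depth` is never taken at an end of a node. -/
theorem IsDiagramCode.exists_trace {G : DirectedGraph V E} {D : Diagram G} {ns : List (Node V E)}
    {W : E → List Letter} (hc : IsDiagramCode D ns W) {x : Strand (E × ℕ)} (hx : x ∈ ports ns) :
    ∃ l, NodeTrace ns (x.1, true) l := by
  obtain ⟨a, _ | _⟩ := x
  · exact hc.total _ (hc.rev_mem hx) rfl
  · exact hc.total _ hx rfl

theorem IsDiagramCode.nodup_label {G : DirectedGraph V E} {D : Diagram G} {ns : List (Node V E)}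
    {W : E → List Letter} (hc : IsDiagramCode D ns W) (hcup : ∀ n ∈ ns, n.kind ≠ .cup) :
    ((ports ns).map (mapStrand (label ns))).Nodup := by
  refine List.Nodup.map_on ?_ hc.nodup
  rintro x hx y hy hxy
  obtain ⟨l, hl⟩ := hc.exists_trace hx
  obtain ⟨l', hl'⟩ := hc.exists_trace hy
  simp only [mapStrand, label, Prod.mk.injEq, depth_eq hc.nodup hl, depth_eq hc.nodup hl'] at hxy
  obtain ⟨⟨h1, h2⟩, h3⟩ := hxy
  have := hc.trace_inj hcup hl hl' (by simp [mapStrand, h1]) h2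
  exact Prod.ext (Prod.mk.inj this).1 h3

/-- The position of the passage is read off from the suffix of the edge word that begins with its
letter. At the same position in the other diagram the same letter is met, and the labels before and
after it only depend on the lengths of the suffixes. -/
theorem IsDiagramCode.match_pass {G : DirectedGraph V E} {D D' : Diagram G}
    {ns ns' : List (Node V E)} {W : E → List Letter} (hc : IsDiagramCode D ns W)
    (hc' : IsDiagramCode D' ns' W) (hcup : ∀ n ∈ ns, n.kind ≠ .cup)
    (hcup' : ∀ n ∈ ns', n.kind ≠ .cup) {n : Node V E} (hn : n ∈ ns) {x y : Strand (E × ℕ)}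
    {m : Letter} (hp : Pass n x y (some m)) (hx : x.2 = false) :
    ∃ n' ∈ ns', ∃ x' y', Pass n' x' y' (some m) ∧
      mapStrand (label ns') x' = mapStrand (label ns) x ∧
      mapStrand (label ns') y' = mapStrand (label ns) y := by
  have hyx := hp.proj_eq (hc.admissible n hn)
  have hy : y.2 = true := by simpa [mapStrand, rev, hx] using congrArg Prod.snd hyx
  obtain ⟨l, hl⟩ := hc.total y (mem_ports.2 ⟨n, hn, hp.mem.2⟩) hy
  have hl1 : NodeTrace ns (rev x) (m :: l) := 
    NodeTrace.pass (x := rev x) (m := some m) hn (by simpa using hp) hl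
  obtain ⟨a, rfl⟩ : ∃ a, x = (a, false) := ⟨x.1, Prod.ext rfl hx⟩
  obtain ⟨b, rfl⟩ : ∃ b, y = (b, true) := ⟨y.1, Prod.ext rfl hy⟩
  have hab : b.1 = a.1 := congrArg (fun s : Strand E => s.1) hyx
  obtain ⟨p, hW⟩ := hc.exists_suffix hcup hl1 (e := a.1) rfl
  obtain ⟨-, -, -, -, s, -, hse, hst⟩ := hc'.start a.1
  rw [hW] at hst
  obtain ⟨z, hz, hzs, -⟩ := hc'.exists_drop hcup' hst
  rw [hse] at hzs
  obtain ⟨c, rfl⟩ : ∃ c, z = (c, true) := ⟨z.1, Prod.ext rfl (congrArg (fun s : Strand E => s.2) hzs)⟩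
  have hca : c.1 = a.1 := congrArg (fun s : Strand E => s.1) hzs
  have hzd := depth_eq hc'.nodup hz
  have hxd := depth_eq hc.nodup hl1
  generalize hq : m :: l = q at hz
  cases hz with
  | finish => simp at hq
  | @pass n' _ y' m' l' hn' hp' h =>
    obtain ⟨m'', rfl, -⟩ := hp'.exists_letter (hcup' _ hn')
    obtain ⟨rfl, rfl⟩ : m = m'' ∧ l = l' := by simpa using hq
    have hyz := hp'.proj_eq (hc'.admissible n' hn')
    obtain ⟨d, rfl⟩ : ∃ d, y' = (d, true) :=
      ⟨y'.1, Prod.ext rfl (congrArg (fun s : Strand E => s.2) hyz)⟩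
    have hdc : d.1 = c.1 := congrArg (fun s : Strand E => s.1) hyz
    refine ⟨n', hn', _, _, hp', ?_, ?_⟩
    · simp [mapStrand, label, rev, hca, hzd, hxd]
    · simp [mapStrand, label, hab, hdc, hca, depth_eq hc.nodup hl, depth_eq hc'.nodup h]

/-! ### Rotating nodes -/

theorem Converts.of_outs {n n' : Node V E} (hn : n.Admissible) (hk : n.kind = n'.kind)
    (ho : n.outs = n'.outs) : Converts [n] [n'] := by
  refine ⟨[], by simp, by simp [ho], ?_⟩
  have := Eqv.refl (fits_nodesWord (ns := [n]) (by simpa using hn))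
  refine this.cast rfl rfl rfl ?_
  simp [nodesWord, hk, ho, mapWord]

theorem Converts.rotate (k k' : ℕ) (v : V) (os : List (Strand (E × ℕ))) (i : ℕ) :
    Converts [(⟨k, .vert v, os.rotate i⟩ : Node V E)] [⟨k', .vert v, os⟩] := by
  induction i generalizing k with
  | zero => exact .of_outs (n := ⟨k, .vert v, os.rotate 0⟩) trivial rfl (by simp)
  | succ i ih =>
    refine .trans ?_ (ih 0)
    rw [← List.rotate_rotate]
    rcases h : os.rotate i with _ | ⟨z, zs⟩
    · exact .of_outs (n := ⟨k, .vert v, _⟩) trivial rfl (by simp)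
    · simpa using Converts.rotate_vertex v z zs

theorem Converts.of_isRotated {k k' : ℕ} {v : V} {os os' : List (Strand (E × ℕ))}
    (h : os ~r os') : Converts [(⟨k, .vert v, os⟩ : Node V E)] [⟨k', .vert v, os'⟩] := by
  obtain ⟨i, rfl⟩ := h.symm
  exact .rotate k k' v os' i

theorem Admissible.rotate {k : ℕ} {t : CrossingType} {a b c d : Strand (E × ℕ)}
    (h : (⟨k, .crs t, [a, b, c, d]⟩ : Node V E).Admissible) :
    (⟨k, .crs t.flip, [b, c, d, a]⟩ : Node V E).Admissible := by
  obtain ⟨ht, x, y, h⟩ := h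
  simp only [List.map_cons, List.map_nil, List.cons.injEq, and_true] at h
  obtain ⟨ha, hb, hc, hd⟩ := h
  refine ⟨by cases t <;> simp_all [CrossingType.flip], rev y, x, ?_⟩
  simp [ha, hb, hc, hd]

/-- Two nodes can be converted into each other. -/
def Interchangeable (n n' : Node V E) : Prop := Converts [n] [n'] ∧ Converts [n'] [n]

theorem Interchangeable.symm {n n' : Node V E} (h : Interchangeable n n') :
    Interchangeable n' n := ⟨h.2, h.1⟩

theorem Interchangeable.trans {n n' n'' : Node V E} (h : Interchangeable n n')
    (h' : Interchangeable n' n'') : Interchangeable n n'' :=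
  ⟨h.1.trans h'.1, h'.2.trans h.2⟩

/-- A quarter turn is available in one direction only; its inverse is obtained as three further
quarter turns, since four of them restore the node and its type. -/
theorem Interchangeable.rotate {k : ℕ} {t : CrossingType} {a b c d : Strand (E × ℕ)}
    (h : (⟨k, .crs t, [a, b, c, d]⟩ : Node V E).Admissible) :
    Interchangeable (⟨k, .crs t, [a, b, c, d]⟩ : Node V E) ⟨k, .crs t.flip, [b, c, d, a]⟩ := by
  have h1 := Converts.rotate_crossing (k' := k) h
  have h2 := Converts.rotate_crossing (k' := k) (Admissible.rotate h)
  have h3 := Converts.rotate_crossing (k' := k) (Admissible.rotate (Admissible.rotate h))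
  have h4 := Converts.rotate_crossing (k' := k)
    (Admissible.rotate (Admissible.rotate (Admissible.rotate h)))
  simp only [CrossingType.flip_flip] at h2 h3 h4
  exact ⟨h4.trans (h3.trans h2), h1⟩

/-- A crossing is determined up to rotation by its strands and its sign. -/
theorem Pass.interchangeable {n : Node V E} (hn : n.Admissible) {k : ℕ} {s : Bool}
    {x y x' y' : Strand (E × ℕ)} (ho : Pass n x y (some ⟨k, true, s⟩))
    (hu : Pass n x' y' (some ⟨k, false, s⟩)) (hx : x.2 = false) (hx' : x'.2 = false) :
    Interchangeable n ⟨k, .crs .upper, if s then [x', x, y', y] else [y', x, x', y]⟩ := by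
  have hy : y.2 = true := by
    simpa [mapStrand, rev, hx] using congrArg Prod.snd (ho.proj_eq hn)
  have hy' : y'.2 = true := by
    simpa [mapStrand, rev, hx'] using congrArg Prod.snd (hu.proj_eq hn)
  generalize hm : (some ⟨k, true, s⟩ : Option Letter) = m at ho
  generalize hm' : (some ⟨k, false, s⟩ : Option Letter) = m' at hu
  rcases n with ⟨i, v | t | _, outs⟩
  · cases ho
  · have hrefl : Interchangeable (⟨i, .crs t, outs⟩ : Node V E) ⟨i, .crs t, outs⟩ :=
      ⟨.refl (by simpa using hn), .refl (by simpa using hn)⟩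
    -- The target has the upper strand on the diagonal from bottom left and directed upwards; the
    -- sign then fixes the direction of the lower strand. A crossing of type `upper` needs no turn
    -- or a half turn, one of type `lower` three quarter turns or one, according to the direction of
    -- its upper strand.
    cases t
    · cases ho <;> cases hu <;> simp [hx, hx', hy, hy'] at hm hm' <;> obtain ⟨rfl, rfl⟩ := hm
      · simpa using hrefl
      · simpa using hrefl
      · simpa [CrossingType.flip] using
          (Interchangeable.rotate hn).trans (.rotate (Admissible.rotate hn))
      · simpa [CrossingType.flip] using
          (Interchangeable.rotate hn).trans (.rotate (Admissible.rotate hn))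
    · cases ho <;> cases hu <;> simp [hx, hx', hy, hy'] at hm hm' <;> obtain ⟨rfl, rfl⟩ := hm
      · simpa [CrossingType.flip] using ((Interchangeable.rotate hn).trans
          (.rotate (Admissible.rotate hn))).trans (.rotate (Admissible.rotate (Admissible.rotate hn)))
      · simpa [CrossingType.flip] using ((Interchangeable.rotate hn).trans
          (.rotate (Admissible.rotate hn))).trans (.rotate (Admissible.rotate (Admissible.rotate hn)))
      · simpa [CrossingType.flip] using Interchangeable.rotate hn
      · simpa [CrossingType.flip] using Interchangeable.rotate hn
    · exact absurd rfl hn.1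
  · cases ho <;> simp at hm

/-! ### Renaming crossings -/

/-- Rename the crossing of a letter. -/
def Letter.rename (f : ℕ → ℕ) (a : Letter) : Letter := { a with name := f a.name }

@[simp] theorem mapStrand_id : (mapStrand id : Strand E → Strand E) = id := rfl

theorem Node.outs_map_id (f : ℕ → ℕ) (n : Node V E) : (n.map f id).outs = n.outs := by
  simp [Node.map]

theorem Pass.rename {n : Node V E} {x y : Strand (E × ℕ)} {m : Option Letter}
    (hp : Pass n x y m) (f : ℕ → ℕ) : Pass (n.map f id) x y (m.map (Letter.rename f)) := by
  cases hp with
  | cup_left => exact .cup_left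
  | cup_right => exact .cup_right
  | cross_up => exact .cross_up
  | cross_down => exact .cross_down
  | cross_up' => exact .cross_up'
  | cross_down' => exact .cross_down'

theorem NodeTrace.rename {ns : List (Node V E)} {x : Strand (E × ℕ)} {l : List Letter}
    (h : NodeTrace ns x l) (f : ℕ → ℕ) :
    NodeTrace (ns.map (Node.map f id)) x (l.map (Letter.rename f)) := by
  induction h with
  | finish hn hv hx =>
    exact .finish (List.mem_map_of_mem hn) hv (by rwa [Node.outs_map_id])
  | @pass n x y m l hn hp _ ih =>
    have := NodeTrace.pass (List.mem_map_of_mem hn) (hp.rename f) ih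
    cases m <;> simpa using this

theorem IsCode.rename {ns : List (Node V E)} {W : E → List Letter} (hc : IsCode ns W)
    (f : ℕ → ℕ) :
    IsCode (ns.map (Node.map f id)) fun e => (W e).map (Letter.rename f) where
  admissible := by
    intro n' hn'
    obtain ⟨n, hn, rfl⟩ := List.mem_map.1 hn'
    exact (hc.admissible n hn).map f fun _ => rfl
  nodup := by
    rw [ports_map]
    simpa using hc.nodup
  vert_inj := by
    intro n₁ h₁ n₂ h₂ v₁ v₂ hv₁ hv₂ x hx y hy
    obtain ⟨n₁, hn₁, rfl⟩ := List.mem_map.1 h₁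
    obtain ⟨n₂, hn₂, rfl⟩ := List.mem_map.1 h₂
    rw [Node.outs_map_id] at hx hy
    exact hc.vert_inj n₁ hn₁ n₂ hn₂ v₁ v₂ hv₁ hv₂ x hx y hy
  start := by
    intro e
    obtain ⟨n, hn, v, hv, x, hx, hxe, hl⟩ := hc.start e
    exact ⟨_, List.mem_map_of_mem hn, v, hv, x, by rwa [Node.outs_map_id], hxe, hl.rename f⟩
  total := by
    intro x hx hx2
    rw [ports_map] at hx
    obtain ⟨l, hl⟩ := hc.total x (by simpa using hx) hx2
    exact ⟨_, hl.rename f⟩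

theorem IsDiagramCode.rename {G : DirectedGraph V E} {D : Diagram G} {ns : List (Node V E)}
    {W : E → List Letter} (hc : IsDiagramCode D ns W) {f : ℕ → ℕ} (hf : f.Injective) :
    IsDiagramCode D (ns.map (Node.map f id)) fun e => (W e).map (Letter.rename f) where
  toIsCode := hc.toIsCode.rename f
  normalForm := hc.normalForm.map f fun _ => rfl
  idx_nodup := by
    have : (ns.map (Node.map f id)).map Node.idx = (ns.map Node.idx).map f := by
      simp [Function.comp_def, Node.map]
    rw [this]
    exact hc.idx_nodup.map hf
  vert_nodup := by
    rw [vertexData_map (h := id) _ _ fun _ => rfl]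
    exact hc.vert_nodup
  vert_mem := by
    rw [vertexData_map (h := id) _ _ fun _ => rfl]
    exact hc.vert_mem
  vert_star := by
    rw [vertexData_map (h := id) _ _ fun _ => rfl]
    exact hc.vert_star

theorem Diagram.HasGaussCode.exists_code {G : DirectedGraph V E} {D : Diagram G}
    {S : GaussCode V E} (h : D.HasGaussCode S) :
    ∃ ns, IsDiagramCode D ns S.word ∧ ∀ n ∈ ns, n.kind ≠ .cup := by
  obtain ⟨⟨f, hf, hW⟩, -⟩ := h
  choose W hW hS using hW
  obtain ⟨ns, hc, hcup⟩ := D.exists_code hW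
  refine ⟨ns.map (Node.map f id), ?_, ?_⟩
  · rw [show S.word = fun e => (W e).map (Letter.rename f) from funext hS]
    exact hc.rename hf
  · intro n' hn'
    obtain ⟨n, hn, rfl⟩ := List.mem_map.1 hn'
    exact hcup n hn

/-! ### Matching the nodes of two diagrams with the same code -/

/-- The canonical label of an end of an edge at a vertex. -/
def endLabel (W : E → List Letter) (x : Strand E) : Strand (E × ℕ) :=
  ((x.1, if x.2 then (W x.1).length else 0), x.2)

/-- At a vertex, an end with direction `true` starts its edge and has the whole word ahead, while an
end with direction `false` finishes it and has none. So these labels depend only on the code. -/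
theorem IsDiagramCode.label_vert {G : DirectedGraph V E} {D : Diagram G} {ns : List (Node V E)}
    {W : E → List Letter} (hc : IsDiagramCode D ns W) {n : Node V E} (hn : n ∈ ns) {v : V}
    (hv : n.kind = .vert v) {x : Strand (E × ℕ)} (hx : x ∈ n.outs) :
    mapStrand (label ns) x = endLabel W (proj x) := by
  obtain ⟨a, _ | _⟩ := x
  · obtain ⟨l, hl⟩ := hc.exists_trace (mem_ports.2 ⟨n, hn, hx⟩)
    have := hl.of_vert hc.nodup hn hv hx
    subst this
    simp [mapStrand, label, endLabel, depth_eq hc.nodup hl]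
  · obtain ⟨n', hn', v', hv', x', hx', hxe, hl⟩ := hc.start a.1
    obtain rfl := hc.vert_inj n hn n' hn' v v' hv hv' _ hx _ hx' hxe.symm
    simp [mapStrand, label, endLabel, depth_eq hc.nodup hl]

theorem IsDiagramCode.map_label_vert {G : DirectedGraph V E} {D : Diagram G}
    {ns : List (Node V E)} {W : E → List Letter} (hc : IsDiagramCode D ns W) {n : Node V E}
    (hn : n ∈ ns) {v : V} (hv : n.kind = .vert v) :
    n.outs.map (mapStrand (label ns)) = (n.outs.map proj).map (endLabel W) := by
  rw [List.map_map]
  exact List.map_congr_left fun x hx => hc.label_vert hn hv hx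

theorem Pass.exists_in {n : Node V E} (hn : n.Admissible) {x y : Strand (E × ℕ)}
    {m : Option Letter} (h : Pass n x y m) : ∃ x' y', Pass n x' y' m ∧ x'.2 = false := by
  rcases hx : x.2 with _ | _
  · exact ⟨x, y, h, hx⟩
  · refine ⟨y, x, h.symm, ?_⟩
    simpa [mapStrand, rev, hx] using congrArg Prod.snd (h.proj_eq hn)

theorem Node.Admissible.exists_pass {n : Node V E} (hn : n.Admissible) {t : CrossingType}
    (hk : n.kind = .crs t) :
    ∃ s, ∀ o, ∃ x y, Pass n x y (some ⟨n.idx, o, s⟩) ∧ x.2 = false := by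
  obtain ⟨i, κ, outs⟩ := n
  obtain rfl : κ = .crs t := hk
  obtain ⟨-, x, y, h⟩ := id hn
  simp only [List.map_eq_cons_iff, List.map_eq_nil_iff] at h
  obtain ⟨a, _, rfl, -, b, _, rfl, -, c, _, rfl, -, d, _, rfl, -, rfl⟩ := h
  have h1 := (Pass.cross_up (k := i) (t := t) (a := a) (b := b) (c := c) (d := d)).exists_in hn
  have h2 := (Pass.cross_up' (k := i) (t := t) (a := a) (b := b) (c := c) (d := d)).exists_in hn
  refine ⟨(t == .upper) == (d.2 == c.2), fun o => ?_⟩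
  by_cases ho : o = (t == .upper)
  · exact ho ▸ h1
  · obtain rfl : o = !(t == .upper) := Bool.eq_not.2 ho
    exact h2

/-- The nodes are drawings of the same vertex, or crossings with the same name. -/
def Matches (n n' : Node V E) : Prop :=
  (∃ v, n.kind = .vert v ∧ n'.kind = .vert v) ∨
    (∀ v, n.kind ≠ .vert v) ∧ (∀ v, n'.kind ≠ .vert v) ∧ n.idx = n'.idx

theorem Matches.symm {n n' : Node V E} (h : Matches n n') : Matches n' n := by
  rcases h with ⟨v, h, h'⟩ | ⟨h, h', e⟩
  · exact .inl ⟨v, h', h⟩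
  · exact .inr ⟨h', h, e.symm⟩

theorem Matches.unique {G : DirectedGraph V E} {D : Diagram G} {ns : List (Node V E)}
    {W : E → List Letter} (hc : IsDiagramCode D ns W) {n m n' : Node V E} (hn : n ∈ ns)
    (hm : m ∈ ns) (h : Matches n n') (h' : Matches m n') : n = m := by
  rcases h with ⟨v, h1, h2⟩ | ⟨h1, h2, e⟩ <;> rcases h' with ⟨v', h1', h2'⟩ | ⟨h1', h2', e'⟩
  · rw [h2] at h2'
    obtain rfl : v = v' := by simpa using h2'
    exact vert_unique hc.vert_nodup hn hm h1 h1'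
  · exact absurd h2 (h2' v)
  · exact absurd h2' (h2 v')
  · exact List.inj_on_of_nodup_map hc.idx_nodup hn hm (e.trans e'.symm)

/-- After canonical relabelling a vertex is determined up to rotation by its cyclic order of
half-edges, and a crossing by its upper and lower passages together with its sign. -/
theorem IsDiagramCode.exists_matches {G : DirectedGraph V E} {D D' : Diagram G}
    {ns ns' : List (Node V E)} {W : E → List Letter} (hc : IsDiagramCode D ns W)
    (hc' : IsDiagramCode D' ns' W) (hcup : ∀ n ∈ ns, n.kind ≠ .cup)
    (hcup' : ∀ n ∈ ns', n.kind ≠ .cup)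
    (hrot : ∀ v hs hs', (v, hs) ∈ stars D.word → (v, hs') ∈ stars D'.word → hs ~r hs')
    {n : Node V E} (hn : n ∈ ns) : ∃ n' ∈ ns', Matches n n' ∧
      Converts [n.map id (label ns)] [n'.map id (label ns')] := by
  rcases hk : n.kind with v | t | _
  · obtain ⟨os', hos'⟩ := hc'.vert_mem v
    obtain ⟨hs', hs'mem, hr'⟩ := hc'.vert_star v os' hos'
    obtain ⟨n', hn', hv', rfl⟩ := mem_vertexData.1 hos'
    obtain ⟨hs, hsmem, hr⟩ := hc.vert_star v _ (mem_vertexData.2 ⟨n, hn, hk, rfl⟩)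
    refine ⟨n', hn', .inl ⟨v, hk, hv'⟩, ?_⟩
    have h1 : n.outs.map proj ~r n'.outs.map proj := by
      have := (hr.trans (hrot v hs hs' hsmem hs'mem)).trans hr'.symm
      simpa using this.reverse
    have h2 := h1.map (endLabel W)
    rw [← hc.map_label_vert hn hk, ← hc'.map_label_vert hn' hv'] at h2
    simp only [Node.map, hk, hv']
    exact .of_isRotated h2
  · have hadm := hc.admissible n hn
    obtain ⟨s, hs⟩ := hadm.exists_pass hk
    obtain ⟨x, y, ho, hx⟩ := hs true
    obtain ⟨x', y', hu, hx'⟩ := hs false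
    obtain ⟨n', hn', z, w, ho', hzx, hwy⟩ := hc.match_pass hc' hcup hcup' hn ho hx
    obtain ⟨n'', hn'', z', w', hu', hzx', hwy'⟩ := hc.match_pass hc' hcup hcup' hn hu hx'
    obtain ⟨a, ha, hai⟩ := ho'.exists_letter (hcup' _ hn')
    obtain ⟨b, hb, hbi⟩ := hu'.exists_letter (hcup' _ hn'')
    simp only [Option.some.injEq] at ha hb
    subst ha hb
    -- The upper and the lower passage were matched independently; their letters have the same name,
    -- so they belong to one crossing of the second diagram.
    obtain rfl := List.inj_on_of_nodup_map hc'.idx_nodup hn' hn'' (hai.symm.trans hbi)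
    refine ⟨n', hn', .inr ⟨fun v => ho.kind_ne v, fun v => ho'.kind_ne v, hai⟩, ?_⟩
    have h1 := (ho.map (label ns)).interchangeable (hadm.map id (h := label ns) fun _ => rfl)
      (hu.map (label ns)) hx hx'
    have h2 := (ho'.map (label ns')).interchangeable
      ((hc'.admissible n' hn').map id (h := label ns') fun _ => rfl) (hu'.map (label ns'))
      (by rw [hzx]; exact hx) (by rw [hzx']; exact hx')
    rw [hzx, hwy, hzx', hwy'] at h2
    exact (h1.trans h2.symm).1
  · exact absurd hk (hcup n hn)

theorem IsDiagramCode.eqv {G : DirectedGraph V E} {D D' : Diagram G}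
    {ns ns' : List (Node V E)} {W : E → List Letter} (hc : IsDiagramCode D ns W)
    (hc' : IsDiagramCode D' ns' W) (hcup : ∀ n ∈ ns, n.kind ≠ .cup)
    (hcup' : ∀ n ∈ ns', n.kind ≠ .cup)
    (hrot : ∀ v hs hs', (v, hs) ∈ stars D.word → (v, hs') ∈ stars D'.word → hs ~r hs') :
    Eqv [] [] D.word D'.word := by
  have : Nonempty (Node V E) := ⟨⟨0, .cup, []⟩⟩
  have hmatch := fun n (hn : n ∈ ns) => hc.exists_matches hc' hcup hcup' hrot hn
  choose! φ hφ hφm hφc using hmatch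
  have hadm' : ∀ n ∈ ns'.map (Node.map id (label ns')), n.Admissible := by
    intro m hm
    obtain ⟨n, hn, rfl⟩ := List.mem_map.1 hm
    exact (hc'.admissible n hn).map id fun _ => rfl
  -- The matching is injective because vertices and names are unique in `ns`; it is onto by matching
  -- in the reverse direction and using uniqueness in `ns'`.
  have hperm : (ns.map φ).Perm ns' := by
    refine (List.perm_ext_iff_of_nodup ?_ hc'.idx_nodup.of_map).2 fun m => ⟨?_, fun hm => ?_⟩
    · refine hc.idx_nodup.of_map.map_on ?_
      intro n hn m hm h
      exact Matches.unique hc hn hm (hφm n hn) (h ▸ hφm m hm)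
    · intro hm
      obtain ⟨n, hn, rfl⟩ := List.mem_map.1 hm
      exact hφ n hn
    · obtain ⟨n, hn, hnm, -⟩ := hc'.exists_matches hc hcup' hcup
        (fun v hs hs' h h' => (hrot v hs' hs h' h).symm) hm
      exact List.mem_map.2 ⟨n, hn, Matches.unique hc' (hφ n hn) hm (hφm n hn).symm hnm⟩
  have h1 := hc.normalForm.map id (h := label ns) fun _ => rfl
  have h2 : Converts (ns.map (Node.map id (label ns)))
      ((ns.map φ).map (Node.map id (label ns'))) := by
    refine .of_forall₂ ?_
    rw [List.map_map, List.forall₂_map_left_iff, List.forall₂_map_right_iff, List.forall₂_same]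
    exact fun n hn => ⟨hφc n hn, (hc'.admissible _ (hφ n hn)).map id fun _ => rfl⟩
  have h3 : Converts ((ns.map φ).map (Node.map id (label ns')))
      (ns'.map (Node.map id (label ns'))) :=
    .of_perm (hperm.map _) fun n hn => hadm' n ((hperm.map _).mem_iff.1 hn)
  refine NormalForm.eqv ?_ ((h1.converts h2).converts h3)
    (hc'.normalForm.map id (h := label ns') fun _ => rfl) hadm'
  rw [ports_map]
  exact hc'.nodup_label hcup'

/-- Diagrams with a common Gauss code are virtually equivalent. -/
theorem Diagram.HasGaussCode.virtuallyEquivalent {G : DirectedGraph V E} {D D' : Diagram G}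
    {S : GaussCode V E} (h : D.HasGaussCode S) (h' : D'.HasGaussCode S) :
    VirtuallyEquivalent D D' := by
  obtain ⟨ns, hc, hcup⟩ := h.exists_code
  obtain ⟨ns', hc', hcup'⟩ := h'.exists_code
  refine (hc.eqv hc' hcup hcup' fun v hs hs' hv hv' => ?_).eqvGen _ _ rfl rfl
  exact Cycle.coe_eq_coe.1 ((h.2 v hs hv).symm.trans (h'.2 v hs' hv'))

end VirtualGraph

theorem mainTheorem5 {V E : Type*} (G : VirtualGraph.DirectedGraph V E)
    (D : VirtualGraph.Diagram G) (S : VirtualGraph.GaussCode V E)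
    (hS : D.HasGaussCode S) (hr : S.Realizable G) :
    ∃ D' : VirtualGraph.Diagram G, D'.IsClassical ∧ VirtualGraph.VirtuallyEquivalent D D' := by
  obtain ⟨D', hD', hS'⟩ := hr
  exact ⟨D', hD', hS.virtuallyEquivalent hS'⟩
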